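/- Let $F$ be a non-archimedean local field with ring of integers $\mathfrak{o}_F$, uniformizer $\varpi$ and residue field $k_F$ of characteristic $p$. Let $G=GL_3(F)$ with center $Z\cong F^\times$ and $K=GL_3(\mathfrak{o}_F)$. Let $I$ (resp. $I_1$) be the inverse image in $K$ of the upper triangular (resp. unipotent upper triangular) matrices of $GL_3(k_F)$. All representations are over $\overline{\mathbf F}_p$. Let $\sigma$ be an irreducible smooth $\overline{\mathbf F}_p$-representation of $K$, extended to $KZ$ by letting the scalar $\varpi$ act trivially. Recall that $\sigma^{I_1}$ is a line; fix a non-zero vector $v_0\in\sigma^{I_1}$, and let $\chi_\sigma$ be the smooth character by which $IZ$ acts on it. Let $\mathrm{ind}_{KZ}^G\sigma$ be the space of functions $f:G\to\sigma$ with $f(kg)=\sigma(k)f(g)$ for $k\in KZ$, $g\in G$, which are invariant under right translation by some open subgroup and have support compact modulo $KZ$, with $G$ acting by right translation; define $\mathrm{ind}_{IZ}^G\chi_\sigma$ likewise. Let $\mathcal H(IZ,\chi_\sigma)=\mathrm{End}_G(\mathrm{ind}_{IZ}^G\chi_\sigma)$. It acts from the right, by composition, on the $(IZ,\chi_\sigma)$-isotypic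 part $$(\mathrm{ind}_{KZ}^G\sigma)^{IZ,\chi_\sigma}=\{f : h\cdot f=\chi_\sigma(h)f \text{ for all } h\in IZ\}\cong \mathrm{Hom}_G(\mathrm{ind}_{IZ}^G\chi_\sigma,\mathrm{ind}_{KZ}^G\sigma),$$ where the isomorphism is Frobenius reciprocity. For $a=(a_1,a_2)\in\mathbb Z^2$ put $t_a=\mathrm{diag}(\varpi^{a_1},\varpi^{a_2},1)$. Then $(\mathrm{ind}_{KZ}^G\sigma)^{IZ,\chi_\sigma}$ has non-zero $\mathcal H(IZ,\chi_\sigma)$-submodules of infinite codimension over $\overline{\mathbf F}_p$. More precisely, let $a_1<a_2<-1$. Then there is exactly one $I_1$-invariant function $f_{\mathrm{Id},a}$ in $\mathrm{ind}_{KZ}^G\sigma$ that is supported on $KZt_aI_1$ and takes the value $v_0$ at $t_a$; it lies in $(\mathrm{ind}_{KZ}^G\sigma)^{IZ,\chi_\sigma}$, and the $\mathcal H(IZ,\chi_\sigma)$-submodule generated by it is non-zero and of infinite codimension. In particular, the property that every non-zero $\mathcal H(IZ,\chi_\sigma)$-submodule of $(\mathrm{ind}_{KZ}^G\sigma)^{IZ,\chi_\sigma}$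 has finite codimension, whose analogue holds for $GL_2$ by Barthel and Livné, fails for $GL_3$. -/

import Mathlib

open scoped Pointwise MatrixGroups ValuativeRel

set_option linter.unusedSectionVars false

/-! ## Smooth representations and compact induction -/

section CompactInduction

variable {G : Type*} [Group G] [TopologicalSpace G]
variable {C : Type*} [Field C]

/-- A representation of a topological group is smooth if every vector is fixed by an
open subgroup. -/
def IsSmoothRep {W : Type*} [AddCommGroup W] [Module C W] (ρ : Representation C G W) : Prop :=
  ∀ w : W, ∃ U : OpenSubgroup G, ∀ u ∈ U, ρ u w = w

variable [IsTopologicalGroup G]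

/-- The space of the compact induction `ind_H^G τ`: functions `f : G → W` with
`f (h g) = τ h (f g)`, invariant under right translation by some open subgroup, and with
support compact modulo `H`. -/
def cInd {H : Subgroup G} {W : Type*} [AddCommGroup W] [Module C W]
    (τ : Representation C H W) : Submodule C (G → W) where
  carrier := {f | (∀ (h : H) (g : G), f (h * g) = τ h (f g)) ∧
    (∃ U : OpenSubgroup G, ∀ u ∈ U, ∀ g : G, f (g * u) = f g) ∧
    ∃ S : Set G, IsCompact S ∧ Function.support f ⊆ (H : Set G) * S}
  zero_mem' := ⟨by simp, ⟨⊤, by simp⟩, ∅, isCompact_empty, by simp⟩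
  add_mem' := by
    rintro f f' ⟨h1, ⟨U, hU⟩, S, hS, hfS⟩ ⟨h1', ⟨U', hU'⟩, S', hS', hfS'⟩
    refine ⟨fun h g => by simp [h1, h1'], ⟨U ⊓ U', fun u hu g => ?_⟩, S ∪ S', hS.union hS', ?_⟩
    · simp [hU u hu.1, hU' u hu.2]
    · rw [Set.mul_union]
      exact (Function.support_add f f').trans (Set.union_subset_union hfS hfS')
  smul_mem' := by
    rintro c f ⟨h1, ⟨U, hU⟩, S, hS, hfS⟩
    refine ⟨fun h g => by simp [h1], ⟨U, fun u hu g => by simp [hU u hu]⟩, S, hS, ?_⟩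
    exact (Function.support_const_smul_subset c f).trans hfS

/-- The group `G` acts on `ind_H^G τ` by right translation. -/
def cIndRep {H : Subgroup G} {W : Type*} [AddCommGroup W] [Module C W]
    (τ : Representation C H W) : Representation C G (cInd τ) where
  toFun x :=
    { toFun := fun f => ⟨fun g => f.1 (g * x), by
        obtain ⟨f, h1, ⟨U, hU⟩, S, hS, hfS⟩ := f
        refine ⟨fun h g => by simp [mul_assoc, h1],
          ⟨U.comap (MulAut.conj x⁻¹).toMonoidHom (by
            change Continuous fun g : G => x⁻¹ * g * x⁻¹⁻¹
            fun_prop), fun u hu g => ?_⟩,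
          (fun s => s * x⁻¹) '' S, hS.image (by fun_prop), fun g hg => ?_⟩
        · have hu' : x⁻¹ * u * x ∈ U := by simpa using hu
          have := hU _ hu' (g * x)
          simpa [mul_assoc] using this
        · obtain ⟨h, hh, s, hs, e⟩ := Set.mem_mul.1 (hfS hg)
          exact Set.mem_mul.2 ⟨h, hh, s * x⁻¹, ⟨s, hs, rfl⟩, by rw [← mul_assoc, e]; simp⟩⟩
      map_add' := fun _ _ => rfl
      map_smul' := fun _ _ => rfl }
  map_one' := by ext f g; simp
  map_mul' x y := by ext f g; simp [mul_assoc]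

@[simp] theorem cIndRep_apply {H : Subgroup G} {W : Type*} [AddCommGroup W] [Module C W]
    (τ : Representation C H W) (x : G) (f : cInd τ) (g : G) :
    (cIndRep τ x f).1 g = f.1 (g * x) := rfl

/-! ## Characters, isotypic parts, and the Hecke algebra of a character -/

/-- A smooth character of an open subgroup `H` of `G`: a homomorphism to the units of `C` that is
trivial on some open subgroup of `G` contained in `H`. (The existence of such a subgroup forces `H`
to be open.) -/
structure SmoothCharacter (H : Subgroup G) (C : Type*) [Field C] where
  toHom : H →* Cˣ
  smooth : ∃ (U : OpenSubgroup G) (hU : (U : Subgroup G) ≤ H),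
    ∀ (u : G) (hu : u ∈ (U : Subgroup G)), toHom ⟨u, hU hu⟩ = 1

namespace SmoothCharacter

variable {H : Subgroup G} (χ : SmoothCharacter H C)

/-- The one-dimensional representation of `H` on `C` attached to a character. -/
def rep : Representation C H C where
  toFun h := (χ.toHom h : C) • LinearMap.id
  map_one' := by ext; simp
  map_mul' x y := by ext; simp [mul_comm]

@[simp] theorem rep_apply (h : H) (c : C) : χ.rep h c = (χ.toHom h : C) * c := rfl

/-- The `(H, χ)`-isotypic part of a representation of `G`. -/
def isotypic {V : Type*} [AddCommGroup V] [Module C V] (ρ : Representation C G V) :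
    Submodule C V where
  carrier := {v | ∀ h : H, ρ h v = (χ.toHom h : C) • v}
  zero_mem' := by simp
  add_mem' := by
    intro v w hv hw h
    simp [hv h, hw h]
  smul_mem' := by
    intro c v hv h
    simp [hv h, smul_comm c]

/-- The Hecke algebra `End_G (ind_H^G χ)`. -/
abbrev heckeAlgebra : Type _ :=
  (cIndRep χ.rep).IntertwiningMap (cIndRep χ.rep)

open scoped Classical in
/-- The function in `ind_H^G χ` supported on `H` and with value `1` at `1`. -/
noncomputable def canonicalFun : cInd χ.rep :=
  ⟨fun g => if hg : g ∈ H then (χ.toHom ⟨g, hg⟩ : C) else 0, by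
    obtain ⟨U, hU, hχ⟩ := χ.smooth
    refine ⟨fun h g => ?_, ⟨U, fun u hu g => ?_⟩, {1}, isCompact_singleton, fun g hg => ?_⟩
    · by_cases hg : g ∈ H
      · have hhg : (h : G) * g ∈ H := H.mul_mem h.2 hg
        have : (⟨(h : G) * g, hhg⟩ : H) = h * ⟨g, hg⟩ := rfl
        simp only [dif_pos hg, dif_pos hhg, this, map_mul, rep_apply, Units.val_mul]
      · have hhg : (h : G) * g ∉ H := fun h' => hg ((H.mul_mem_cancel_left h.2).1 h')
        simp only [dif_neg hg, dif_neg hhg, map_zero]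
    · by_cases hg : g ∈ H
      · have hgu : g * u ∈ H := H.mul_mem hg (hU hu)
        have : (⟨g * u, hgu⟩ : H) = ⟨g, hg⟩ * ⟨u, hU hu⟩ := rfl
        simp only [dif_pos hg, dif_pos hgu, this, map_mul, hχ u hu, mul_one]
      · have hgu : g * u ∉ H := fun h' => hg ((H.mul_mem_cancel_right (hU hu)).1 h')
        simp only [dif_neg hg, dif_neg hgu]
    · by_cases h : g ∈ H
      · simpa using h
      · simp [h] at hg⟩

theorem canonicalFun_apply_mem {g : G} (hg : g ∈ H) :
    χ.canonicalFun.1 g = (χ.toHom ⟨g, hg⟩ : C) := by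
  simp [canonicalFun, hg]

theorem canonicalFun_apply_notMem {g : G} (hg : g ∉ H) : χ.canonicalFun.1 g = 0 := by
  simp [canonicalFun, hg]

theorem canonicalFun_mem_isotypic : χ.canonicalFun ∈ χ.isotypic (cIndRep χ.rep) := by
  intro h
  ext g
  change χ.canonicalFun.1 (g * h) = (χ.toHom h : C) * χ.canonicalFun.1 g
  by_cases hg : g ∈ H
  · have hgu : g * h ∈ H := H.mul_mem hg h.2
    have : (⟨g * h, hgu⟩ : H) = ⟨g, hg⟩ * h := rfl
    rw [canonicalFun_apply_mem χ hg, canonicalFun_apply_mem χ hgu, this, map_mul, Units.val_mul,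
      mul_comm]
  · have hgu : g * h ∉ H := fun h' => hg ((H.mul_mem_cancel_right h.2).1 h')
    rw [canonicalFun_apply_notMem χ hg, canonicalFun_apply_notMem χ hgu, mul_zero]

section Frobenius

variable {V : Type*} [AddCommGroup V] [Module C V] (ρ : Representation C G V)

/-- The summand `ψ(g⁻¹) ρ(g) v`, as a function of the coset `g H`. -/
def frobTerm (v : χ.isotypic ρ) (ψ : cInd χ.rep) : G ⧸ H → V :=
  Quotient.lift (fun g : G => ψ.1 g⁻¹ • ρ g v.1) (by
    intro a b hab
    have hab' : a⁻¹ * b ∈ H := QuotientGroup.leftRel_apply.1 hab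
    obtain ⟨h, rfl⟩ : ∃ h : H, b = a * h := ⟨⟨_, hab'⟩, by simp⟩
    have h1 : ψ.1 ((a * h)⁻¹) = ((χ.toHom h : C))⁻¹ * ψ.1 a⁻¹ := by
      have := ψ.2.1 h⁻¹ a⁻¹
      simpa [mul_inv_rev] using this
    have h2 := v.2 h
    change ψ.1 a⁻¹ • ρ a v.1 = ψ.1 (a * h)⁻¹ • ρ (a * h) v.1
    rw [h1, map_mul, Module.End.mul_apply, h2, map_smul, smul_smul]
    congr 1
    field_simp)

@[simp] theorem frobTerm_mk (v : χ.isotypic ρ) (ψ : cInd χ.rep) (g : G) :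
    χ.frobTerm ρ v ψ (g : G ⧸ H) = ψ.1 g⁻¹ • ρ g v.1 := rfl

theorem finite_cosets (ψ : cInd χ.rep) :
    {c : G ⧸ H | ∃ g : G, (g : G ⧸ H) = c ∧ ψ.1 g⁻¹ ≠ 0}.Finite := by
  obtain ⟨U, hU, -⟩ := χ.smooth
  have hH : IsOpen (H : Set G) := Subgroup.isOpen_mono hU U.isOpen
  have : DiscreteTopology (G ⧸ H) := QuotientGroup.discreteTopology hH
  obtain ⟨-, -, S, hS, hψ⟩ := ψ.2
  have hfin : ((fun s : G => ((s⁻¹ : G) : G ⧸ H)) '' S).Finite :=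
    (hS.image (continuous_quotient_mk'.comp continuous_inv)).finite_of_discrete
  refine hfin.subset ?_
  rintro c ⟨g, rfl, hg⟩
  obtain ⟨h, hh, s, hs, e⟩ := Set.mem_mul.1 (hψ hg)
  refine ⟨s, hs, ?_⟩
  rw [QuotientGroup.eq]
  have : g = s⁻¹ * h⁻¹ := by rw [← mul_inv_rev, e, inv_inv]
  rw [this]
  simpa using hh

theorem frobTerm_support_finite (v : χ.isotypic ρ) (ψ : cInd χ.rep) :
    (Function.support (χ.frobTerm ρ v ψ)).Finite := by
  refine (χ.finite_cosets ψ).subset ?_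
  intro c hc
  obtain ⟨g, rfl⟩ := QuotientGroup.mk_surjective c
  refine ⟨g, rfl, fun h0 => hc ?_⟩
  simp [h0]

/-- The `G`-equivariant map `ind_H^G χ → V` attached to a vector `v` of the isotypic part,
`ψ ↦ ∑_{g H} ψ(g⁻¹) g v`. -/
noncomputable def frobMap (v : χ.isotypic ρ) : (cIndRep χ.rep).IntertwiningMap ρ where
  toFun ψ := ∑ᶠ c : G ⧸ H, χ.frobTerm ρ v ψ c
  map_add' ψ ψ' := by
    rw [← finsum_add_distrib (χ.frobTerm_support_finite ρ v ψ)
      (χ.frobTerm_support_finite ρ v ψ')]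
    refine finsum_congr fun c => ?_
    obtain ⟨g, rfl⟩ := QuotientGroup.mk_surjective c
    simp [add_smul]
  map_smul' a ψ := by
    rw [RingHom.id_apply, smul_finsum' a (χ.frobTerm_support_finite ρ v ψ)]
    refine finsum_congr fun c => ?_
    obtain ⟨g, rfl⟩ := QuotientGroup.mk_surjective c
    simp [mul_smul]
  isIntertwining' x := by
    ext ψ
    change ∑ᶠ c : G ⧸ H, χ.frobTerm ρ v (cIndRep χ.rep x ψ) c
      = ρ x (∑ᶠ c : G ⧸ H, χ.frobTerm ρ v ψ c)
    change _ = (ρ x).toAddMonoidHom (∑ᶠ c : G ⧸ H, χ.frobTerm ρ v ψ c)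
    rw [AddMonoidHom.map_finsum _ (χ.frobTerm_support_finite ρ v ψ),
      ← finsum_comp_equiv (MulAction.toPerm x : Equiv.Perm (G ⧸ H))]
    refine finsum_congr fun c => ?_
    obtain ⟨g, rfl⟩ := QuotientGroup.mk_surjective c
    change (cIndRep χ.rep x ψ).1 (x * g)⁻¹ • ρ (x * g) v.1 = ρ x (ψ.1 g⁻¹ • ρ g v.1)
    simp

/-- The value at the canonical function is a vector of the isotypic part. -/
theorem map_canonicalFun_mem (Φ : (cIndRep χ.rep).IntertwiningMap ρ) :
    Φ χ.canonicalFun ∈ χ.isotypic ρ := by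
  intro h
  rw [← Φ.isIntertwining, χ.canonicalFun_mem_isotypic h, map_smul]

theorem frobMap_canonicalFun (v : χ.isotypic ρ) : χ.frobMap ρ v χ.canonicalFun = v.1 := by
  change ∑ᶠ c : G ⧸ H, χ.frobTerm ρ v χ.canonicalFun c = v.1
  rw [finsum_eq_single _ ((1 : G) : G ⧸ H)]
  · simp [canonicalFun_apply_mem χ H.one_mem, show (⟨1, H.one_mem⟩ : H) = 1 from rfl]
  · intro c hc
    obtain ⟨g, rfl⟩ := QuotientGroup.mk_surjective c
    have hg : g⁻¹ ∉ H := fun h => hc (by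
      rw [QuotientGroup.eq]; simpa using h)
    simp [canonicalFun_apply_notMem χ hg]

/-- The map attached to the canonical function itself is the identity. -/
theorem frobMap_canonicalFun_self (ψ : cInd χ.rep) :
    χ.frobMap (cIndRep χ.rep) ⟨χ.canonicalFun, χ.canonicalFun_mem_isotypic⟩ ψ = ψ := by
  ext x
  change ((∑ᶠ c : G ⧸ H, χ.frobTerm (cIndRep χ.rep) _ ψ c : cInd χ.rep) : G → C) x = ψ.1 x
  set v : χ.isotypic (cIndRep χ.rep) := ⟨χ.canonicalFun, χ.canonicalFun_mem_isotypic⟩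
  let ev : cInd χ.rep →+ C := ((LinearMap.proj x).comp (cInd χ.rep).subtype).toAddMonoidHom
  change ev _ = _
  rw [AddMonoidHom.map_finsum ev (χ.frobTerm_support_finite _ v ψ),
    finsum_eq_single _ ((x⁻¹ : G) : G ⧸ H)]
  · change ψ.1 x⁻¹⁻¹ * χ.canonicalFun.1 (x * x⁻¹) = ψ.1 x
    rw [mul_inv_cancel, inv_inv, canonicalFun_apply_mem χ H.one_mem,
      show (⟨1, H.one_mem⟩ : H) = 1 from rfl]
    simp
  · intro c hc
    obtain ⟨g, rfl⟩ := QuotientGroup.mk_surjective c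
    have hg : x * g ∉ H := fun h => hc (by
      rw [eq_comm, QuotientGroup.eq]; simpa using h)
    change ψ.1 g⁻¹ * χ.canonicalFun.1 (x * g) = 0
    rw [canonicalFun_apply_notMem χ hg, mul_zero]

/-- An equivariant map out of `ind_H^G χ` is determined by its value at the canonical function. -/
theorem eq_of_map_canonicalFun_eq {Φ Ψ : (cIndRep χ.rep).IntertwiningMap ρ}
    (h : Φ χ.canonicalFun = Ψ χ.canonicalFun) : Φ = Ψ := by
  suffices ∀ ψ, Φ ψ = Ψ ψ by
    ext ψ
    exact this ψ
  intro ψ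
  let v : χ.isotypic (cIndRep χ.rep) := ⟨χ.canonicalFun, χ.canonicalFun_mem_isotypic⟩
  have key : ∀ Θ : (cIndRep χ.rep).IntertwiningMap ρ, Θ ψ =
      ∑ᶠ c : G ⧸ H, χ.frobTerm ρ ⟨_, χ.map_canonicalFun_mem ρ Θ⟩ ψ c := by
    intro Θ
    conv_lhs => rw [← χ.frobMap_canonicalFun_self ψ]
    change Θ.toLinearMap.toAddMonoidHom (∑ᶠ c : G ⧸ H, χ.frobTerm (cIndRep χ.rep) v ψ c) = _
    rw [AddMonoidHom.map_finsum _ (χ.frobTerm_support_finite _ v ψ)]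
    refine finsum_congr fun c => ?_
    obtain ⟨g, rfl⟩ := QuotientGroup.mk_surjective c
    change Θ (ψ.1 g⁻¹ • cIndRep χ.rep g χ.canonicalFun) = ψ.1 g⁻¹ • ρ g (Θ χ.canonicalFun)
    rw [map_smul, Θ.isIntertwining]
  rw [key Φ, key Ψ]
  simp only [h]

/-- Frobenius reciprocity `Hom_G (ind_H^G χ, V) ≃ V^{H, χ}`, by evaluation at the canonical
function. -/
noncomputable def frobenius :
    (cIndRep χ.rep).IntertwiningMap ρ ≃ₗ[C] χ.isotypic ρ where
  toFun Φ := ⟨Φ χ.canonicalFun, χ.map_canonicalFun_mem ρ Φ⟩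
  map_add' _ _ := rfl
  map_smul' _ _ := rfl
  invFun v := χ.frobMap ρ v
  left_inv _ := χ.eq_of_map_canonicalFun_eq ρ (χ.frobMap_canonicalFun ρ _)
  right_inv v := Subtype.ext (χ.frobMap_canonicalFun ρ v)

/-- The isotypic part `V^{H, χ}` is a right module over the Hecke algebra: it is identified with
`Hom_G (ind_H^G χ, V)` by Frobenius reciprocity, and an endomorphism `T` of `ind_H^G χ` acts on
the latter by `Φ ↦ Φ ∘ T`. -/
noncomputable instance instModuleIsotypic : Module (χ.heckeAlgebra)ᵐᵒᵖ (χ.isotypic ρ) where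
  smul T v := χ.frobenius ρ (((χ.frobenius ρ).symm v).comp T.unop)
  one_smul v := by
    change χ.frobenius ρ ((χ.frobenius ρ).symm v) = v
    simp
  mul_smul S T v := by
    change χ.frobenius ρ (((χ.frobenius ρ).symm v).comp (T.unop * S.unop)) =
      χ.frobenius ρ (((χ.frobenius ρ).symm
        (χ.frobenius ρ (((χ.frobenius ρ).symm v).comp T.unop))).comp S.unop)
    rw [LinearEquiv.symm_apply_apply]
    rfl
  smul_zero T := by
    change χ.frobenius ρ (((χ.frobenius ρ).symm 0).comp T.unop) = 0
    rw [map_zero]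
    rfl
  zero_smul v := by
    apply Subtype.ext
    change ((χ.frobenius ρ).symm v) 0 = 0
    exact map_zero _
  smul_add T v w := by
    change χ.frobenius ρ (((χ.frobenius ρ).symm (v + w)).comp T.unop) = _
    rw [map_add]
    rfl
  add_smul S T v := by
    apply Subtype.ext
    change ((χ.frobenius ρ).symm v) (S.unop χ.canonicalFun + T.unop χ.canonicalFun) = _
    rw [map_add]
    rfl

theorem op_smul_def (T : χ.heckeAlgebra) (v : χ.isotypic ρ) :
    (MulOpposite.op T) • v = χ.frobenius ρ (((χ.frobenius ρ).symm v).comp T) := rfl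

theorem coe_op_smul (T : χ.heckeAlgebra) (v : χ.isotypic ρ) :
    ((MulOpposite.op T • v : χ.isotypic ρ) : V) = χ.frobMap ρ v (T χ.canonicalFun) := rfl

instance instIsScalarTowerIsotypic :
    IsScalarTower C (χ.heckeAlgebra)ᵐᵒᵖ (χ.isotypic ρ) where
  smul_assoc c T v := by
    apply Subtype.ext
    change ((χ.frobenius ρ).symm v) (c • T.unop χ.canonicalFun) = _
    rw [map_smul]
    rfl

/-- A Hecke submodule of the isotypic part has infinite codimension: the quotient is an infinite
dimensional vector space over `C`. -/
def HasInfiniteCodim (M : Submodule (χ.heckeAlgebra)ᵐᵒᵖ (χ.isotypic ρ)) : Prop :=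
  ¬ FiniteDimensional C (χ.isotypic ρ ⧸ M.restrictScalars C)

end Frobenius

end SmoothCharacter

end CompactInduction

/-! ## The group `GL₃` over a local field and its compact open subgroups -/

section GL3

/-- The subgroup of upper triangular matrices. -/
def upperTri (k : Type*) [Field k] : Subgroup (GL (Fin 3) k) where
  carrier := {g | ∀ i j : Fin 3, j < i → g.1 i j = 0}
  one_mem' i j h := by simp [Matrix.one_apply_ne h.ne']
  mul_mem' {a b} ha hb := by
    intro i j h
    exact Matrix.BlockTriangular.mul (b := id) (M := a.1) (N := b.1) (fun _ _ h => ha _ _ h)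
      (fun _ _ h => hb _ _ h) h
  inv_mem' {a} ha := by
    intro i j h
    have := Matrix.blockTriangular_inv_of_blockTriangular (M := a.1) (b := id)
      (fun _ _ h => ha _ _ h) h
    rwa [← Matrix.coe_units_inv] at this

theorem upperTri_mul_diag {k : Type*} [Field k] {a b : GL (Fin 3) k} (ha : a ∈ upperTri k)
    (hb : b ∈ upperTri k) (i : Fin 3) : (a * b).1 i i = a.1 i i * b.1 i i := by
  change (a.1 * b.1) i i = _
  rw [Matrix.mul_apply]
  refine Finset.sum_eq_single i (fun j _ hj => ?_) (by simp)
  rcases lt_or_gt_of_ne hj with h | h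
  · rw [ha i j h, zero_mul]
  · rw [hb j i h, mul_zero]

/-- The subgroup of upper triangular matrices with all diagonal entries equal to `1`. -/
def upperUnip (k : Type*) [Field k] : Subgroup (GL (Fin 3) k) where
  carrier := {g | g ∈ upperTri k ∧ ∀ i : Fin 3, g.1 i i = 1}
  one_mem' := ⟨(upperTri k).one_mem, by simp⟩
  mul_mem' {a b} ha hb := ⟨(upperTri k).mul_mem ha.1 hb.1, fun i => by
    rw [upperTri_mul_diag ha.1 hb.1, ha.2, hb.2, one_mul]⟩
  inv_mem' {a} ha := ⟨(upperTri k).inv_mem ha.1, fun i => by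
    have := upperTri_mul_diag ha.1 ((upperTri k).inv_mem ha.1) i
    rw [mul_inv_cancel, ha.2, one_mul] at this
    rw [← this]; simp⟩

variable (F : Type*) [Field F] [ValuativeRel F] [TopologicalSpace F] [IsNonarchimedeanLocalField F]

/-- The inclusion `GL₃(𝔬) → GL₃(F)`. -/
noncomputable abbrev inclGL : GL (Fin 3) 𝒪[F] →* GL (Fin 3) F :=
  Matrix.GeneralLinearGroup.map (algebraMap 𝒪[F] F)

/-- The reduction map `GL₃(𝔬) → GL₃(k)`. -/
noncomputable abbrev redGL : GL (Fin 3) 𝒪[F] →* GL (Fin 3) 𝓀[F] :=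
  Matrix.GeneralLinearGroup.map (IsLocalRing.residue 𝒪[F])

/-- `K = GL₃(𝔬)` as a subgroup of `GL₃(F)`. -/
noncomputable def maxCompact : Subgroup (GL (Fin 3) F) := (inclGL F).range

/-- The Iwahori subgroup `I`: the inverse image in `K` of the upper triangular matrices over the
residue field. -/
noncomputable def iwahori : Subgroup (GL (Fin 3) F) :=
  ((upperTri 𝓀[F]).comap (redGL F)).map (inclGL F)

/-- The pro-`p` Iwahori subgroup `I₁`: the inverse image in `K` of the unipotent upper triangular
matrices over the residue field. -/
noncomputable def proPIwahori : Subgroup (GL (Fin 3) F) :=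
  ((upperUnip 𝓀[F]).comap (redGL F)).map (inclGL F)

/-- `K Z`, where `Z` is the center of `GL₃(F)`. -/
noncomputable def maxCompactZ : Subgroup (GL (Fin 3) F) :=
  maxCompact F ⊔ Subgroup.center (GL (Fin 3) F)

/-- `I Z`, where `Z` is the center of `GL₃(F)`. -/
noncomputable def iwahoriZ : Subgroup (GL (Fin 3) F) :=
  iwahori F ⊔ Subgroup.center (GL (Fin 3) F)

theorem proPIwahori_le_maxCompact : proPIwahori F ≤ maxCompact F := by
  rintro _ ⟨g, -, rfl⟩
  exact ⟨g, rfl⟩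

theorem iwahoriZ_le_maxCompactZ : iwahoriZ F ≤ maxCompactZ F := by
  refine sup_le_sup_right ?_ _
  rintro _ ⟨g, -, rfl⟩
  exact ⟨g, rfl⟩

variable {F}

/-- A uniformizer as a unit of `F`. -/
noncomputable def unif {ϖ : 𝒪[F]} (hϖ : Irreducible ϖ) : Fˣ :=
  Units.mk0 (ϖ : F) (fun h => hϖ.ne_zero (Subtype.ext h))

/-- The scalar matrix `ϖ`. -/
noncomputable def scalarUnif {ϖ : 𝒪[F]} (hϖ : Irreducible ϖ) : GL (Fin 3) F :=
  Matrix.GeneralLinearGroup.scalar (Fin 3) (unif hϖ)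

theorem scalarUnif_zpow_comm {ϖ : 𝒪[F]} (hϖ : Irreducible ϖ) (n : ℤ) (g : GL (Fin 3) F) :
    scalarUnif hϖ ^ n * g = g * scalarUnif hϖ ^ n := by
  have : scalarUnif hϖ ∈ Subgroup.center (GL (Fin 3) F) := by
    rw [Matrix.GeneralLinearGroup.center_eq_range_scalar]
    exact ⟨_, rfl⟩
  exact (Subgroup.mem_center_iff.1 (Subgroup.zpow_mem _ this n) g).symm

theorem exists_unit_mul_zpow {ϖ : 𝒪[F]} (hϖ : Irreducible ϖ) (x : Fˣ) :
    ∃ (u : (𝒪[F])ˣ) (n : ℤ), x = Units.map (algebraMap 𝒪[F] F).toMonoidHom u * unif hϖ ^ n := by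
  have main : ∀ x : Fˣ, (x : F) ∈ 𝒪[F] → ∃ (u : (𝒪[F])ˣ) (n : ℤ),
      x = Units.map (algebraMap 𝒪[F] F).toMonoidHom u * unif hϖ ^ n := by
    intro x hx
    have hx0 : (⟨x, hx⟩ : 𝒪[F]) ≠ 0 := fun h => x.ne_zero (congrArg Subtype.val h)
    obtain ⟨n, u, h⟩ := IsDiscreteValuationRing.eq_unit_mul_pow_irreducible hx0 hϖ
    refine ⟨u, n, Units.ext ?_⟩
    have := congrArg Subtype.val h
    change (x : F) = ((u : 𝒪[F]) : F) * ((unif hϖ ^ (n : ℤ) : Fˣ) : F)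
    simpa [unif] using this
  rcases le_total (ValuativeRel.valuation F (x : F)) 1 with h | h
  · exact main x h
  · obtain ⟨u, n, hu⟩ := main x⁻¹ (by
      change ValuativeRel.valuation F ((x⁻¹ : Fˣ) : F) ≤ 1
      rw [Units.val_inv_eq_inv_val, map_inv₀]
      exact inv_le_one_of_one_le₀ h)
    refine ⟨u⁻¹, -n, ?_⟩
    rw [← inv_inv x, hu, mul_inv, map_inv, zpow_neg]

theorem exists_decomp {ϖ : 𝒪[F]} (hϖ : Irreducible ϖ) (g : maxCompactZ F) :
    ∃ k : maxCompact F, ∃ n : ℤ, (g : GL (Fin 3) F) = k * scalarUnif hϖ ^ n := by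
  obtain ⟨k, hk, z, hz, e⟩ := Subgroup.mem_sup_of_normal_right.1 g.2
  rw [Matrix.GeneralLinearGroup.center_eq_range_scalar] at hz
  obtain ⟨x, rfl⟩ := hz
  obtain ⟨u, n, rfl⟩ := exists_unit_mul_zpow hϖ x
  refine ⟨⟨k, hk⟩ * ⟨_, Matrix.GeneralLinearGroup.scalar (Fin 3) u, rfl⟩, n, ?_⟩
  rw [← e, map_mul, map_zpow, ← mul_assoc]
  congr 2
  ext i j
  by_cases hij : i = j
  · subst hij; simp
  · simp [hij]

theorem eq_zero_of_zpow_mem {ϖ : 𝒪[F]} (hϖ : Irreducible ϖ) {n : ℤ}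
    (h : scalarUnif hϖ ^ n ∈ maxCompact F) : n = 0 := by
  have key : ∀ m : ℕ, (scalarUnif hϖ ^ m)⁻¹ ∈ maxCompact F → m = 0 := by
    rintro m ⟨A, hA⟩
    have h1 : ((A.1 0 0 : 𝒪[F]) : F) = ((ϖ : F) ^ m)⁻¹ := by
      have := congrArg (fun g : GL (Fin 3) F => g.1 0 0) hA
      rw [scalarUnif, ← map_pow, ← map_inv] at this
      have h3 : algebraMap 𝒪[F] F (A.1 0 0) = (((unif hϖ ^ m)⁻¹ : Fˣ) : F) := by
        simpa [-map_pow, -map_inv] using this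
      change algebraMap 𝒪[F] F (A.1 0 0) = _
      simpa [unif] using h3
    have h2 : A.1 0 0 * ϖ ^ m = 1 := by
      apply Subtype.ext
      change ((A.1 0 0 : 𝒪[F]) : F) * (ϖ : F) ^ m = 1
      rw [h1]
      exact inv_mul_cancel₀ (pow_ne_zero _ (fun h => hϖ.ne_zero (Subtype.ext h)))
    by_contra hm
    exact hϖ.not_isUnit ((isUnit_pow_iff hm).1 (IsUnit.of_mul_eq_one_right _ h2))
  obtain ⟨m, rfl | rfl⟩ := n.eq_nat_or_neg
  · have := key m (by simpa using (maxCompact F).inv_mem h)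
    simp [this]
  · have := key m (by simpa using h)
    simp [this]

theorem decomp_unique {ϖ : 𝒪[F]} (hϖ : Irreducible ϖ) {k k' : maxCompact F} {n n' : ℤ}
    (h : (k : GL (Fin 3) F) * scalarUnif hϖ ^ n = k' * scalarUnif hϖ ^ n') : k = k' := by
  have h1 : scalarUnif hϖ ^ (n - n') = ((k⁻¹ * k' : maxCompact F) : GL (Fin 3) F) := by
    rw [zpow_sub, Subgroup.coe_mul, Subgroup.coe_inv, mul_inv_eq_iff_eq_mul, mul_assoc, ← h,
      inv_mul_cancel_left]
  have h2 : n - n' = 0 := eq_zero_of_zpow_mem hϖ (h1 ▸ (k⁻¹ * k').2)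
  rw [h2, zpow_zero] at h1
  have h3 : k⁻¹ * k' = 1 := Subtype.ext h1.symm
  exact (inv_mul_eq_one.1 h3)

/-- The projection `K Z → K` which sends the scalar `ϖ` to `1`; recall `K Z = K × ϖ^ℤ`. -/
noncomputable def projK {ϖ : 𝒪[F]} (hϖ : Irreducible ϖ) : maxCompactZ F →* maxCompact F :=
  MonoidHom.mk' (fun g => (exists_decomp hϖ g).choose) (by
    intro g g'
    obtain ⟨n, hn⟩ := (exists_decomp hϖ g).choose_spec
    obtain ⟨n', hn'⟩ := (exists_decomp hϖ g').choose_spec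
    obtain ⟨m, hm⟩ := (exists_decomp hϖ (g * g')).choose_spec
    refine decomp_unique hϖ (n := m) (n' := n + n') ?_
    refine hm.symm.trans ((congrArg₂ (· * ·) hn hn').trans ?_)
    rw [Subgroup.coe_mul, zpow_add]
    simp only [mul_assoc]
    rw [← mul_assoc (scalarUnif hϖ ^ n), scalarUnif_zpow_comm, mul_assoc])

theorem projK_eq {ϖ : 𝒪[F]} (hϖ : Irreducible ϖ) (g : maxCompactZ F) (k : maxCompact F) (n : ℤ)
    (h : (g : GL (Fin 3) F) = k * scalarUnif hϖ ^ n) : projK hϖ g = k := by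
  obtain ⟨m, hm⟩ := (exists_decomp hϖ g).choose_spec
  exact decomp_unique hϖ (n := m) (n' := n) (hm.symm.trans h)

/-- The extension of a representation of `K` to `K Z` on which the scalar `ϖ` acts trivially. -/
noncomputable def extendKZ {ϖ : 𝒪[F]} (hϖ : Irreducible ϖ) {C W : Type*} [Field C]
    [AddCommGroup W] [Module C W] (σ : Representation C (maxCompact F) W) :
    Representation C (maxCompactZ F) W :=
  σ.comp (projK hϖ)

/-- The diagonal matrix `t_a = diag(ϖ^{a₁}, ϖ^{a₂}, 1)`. -/
noncomputable def diagT {ϖ : 𝒪[F]} (hϖ : Irreducible ϖ) (a₁ a₂ : ℤ) : GL (Fin 3) F where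
  val := Matrix.diagonal ![(ϖ : F) ^ a₁, (ϖ : F) ^ a₂, 1]
  inv := Matrix.diagonal ![(ϖ : F) ^ (-a₁), (ϖ : F) ^ (-a₂), 1]
  val_inv := by
    have h : (ϖ : F) ≠ 0 := fun h => hϖ.ne_zero (Subtype.ext h)
    rw [Matrix.diagonal_mul_diagonal, ← Matrix.diagonal_one]
    congr 1
    funext i
    fin_cases i <;> simp [zpow_ne_zero, h]
  inv_val := by
    have h : (ϖ : F) ≠ 0 := fun h => hϖ.ne_zero (Subtype.ext h)
    rw [Matrix.diagonal_mul_diagonal, ← Matrix.diagonal_one]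
    congr 1
    funext i
    fin_cases i <;> simp [zpow_ne_zero, h]

/-- `f` is the function `f_{Id, a}` of `ind_{KZ}^G σ`: it is invariant under `I₁`, supported on
`K Z t_a I₁`, and has the value `v₀` at `t_a`. -/
def IsStdFunction {ϖ : 𝒪[F]} (hϖ : Irreducible ϖ) {C W : Type*} [Field C]
    [AddCommGroup W] [Module C W] (σ : Representation C (maxCompact F) W) (v₀ : W) (a₁ a₂ : ℤ)
    (f : cInd (extendKZ hϖ σ)) : Prop :=
  (∀ u ∈ proPIwahori F, cIndRep (extendKZ hϖ σ) u f = f) ∧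
  Function.support f.1 ⊆
    (maxCompactZ F : Set (GL (Fin 3) F)) * {diagT hϖ a₁ a₂} * (proPIwahori F) ∧
  f.1 (diagT hϖ a₁ a₂) = v₀

/-- `χ` is the character of `I Z` on the line spanned by `v₀`, where `σ` is extended to `K Z` by
letting the scalar `ϖ` act trivially. -/
def IsCharacterOnLine {ϖ : 𝒪[F]} (hϖ : Irreducible ϖ) {C W : Type*} [Field C]
    [AddCommGroup W] [Module C W] (σ : Representation C (maxCompact F) W) (v₀ : W)
    (χ : SmoothCharacter (iwahoriZ F) C) : Prop :=
  ∀ h : iwahoriZ F,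
    extendKZ hϖ σ (Subgroup.inclusion (iwahoriZ_le_maxCompactZ F) h) v₀ = (χ.toHom h : C) • v₀

end GL3

/-! ## Explicit elements of `GL₃` -/

/-! The Hecke submodule generated by `f` consists of finite combinations of `G`-translates of `f`,
so it stays inside every `G`-stable subspace containing `f`. It therefore suffices to find a
`G`-equivariant spherical Hecke operator `T` whose image contains `f_{Id,a}` but has infinite
codimension on the isotypic part.

The operator is `opT`, attached to the double coset of `s = diag(ϖ, ϖ, 1)` and to a linear map `τ`
on `σ`. Since `σ` has a nonzero vector fixed by `I₁`, it is inflated from a representation `ρ` of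
`GL₃` of the residue field. Let `U` be the upper unitriangular group, `P = MN` the upper block
triangular parabolic of type (2,1), and `N⁻` the opposite unipotent radical. Fixed-point arguments
for `p`-groups show that `σ^U` is a line, that it is not killed by some functional invariant under
the lower unitriangular group, and that `σ` is the direct sum of the `M`-span of `v₀` (on which `N`
acts trivially) and the span of the differences `n w - w` with `n ∈ N⁻`. Projection to the first
summand is `τ` (`exists_parabolic_projection`). Conjugation by `s` turns `P` modulo `ϖ` into the
opposite parabolic with the same Levi part, and `τ` intertwines the two, so `T` is well defined
(`opTerm_congr`).

The image contains `f_{Id,a}`: in fact `T f_{Id,1+a} = f_{Id,a}` (`opT_stdFun`). The cosets of `P`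
fall into three Bruhat cells. The trivial one gives the expected value; the other two contribute
nothing, because `τ (s₂ v₀) = e v₀` with `e` annihilating the Hecke translate of `v₀` for `s₂`. The
inequalities `a₁ < a₂ < -1` ensure that every `t_b` that can meet the support satisfies `b₁ ≤ b₂ ≤
0`, the range where this computation applies.

The image is small for another reason. Attach to `g`, with elementary divisors `|x| ≥ |y| ≥ |z|`,
the ratio `|y|/|z|`. If `h ≠ 0` attains its largest ratio `R` on the double coset of `t = diag(x, y,
z)`, then at `s⁻¹ t k`, of ratio `R/|ϖ| > 1`, only one coset contributes to `T h`, with value `τ (h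
(t k))`. This is nonzero for some `k`, since no nonzero vector has all its `U`-translates killed by
`τ` (`eq_zero_of_opT_eq_zero`). Hence no nonzero element of the image is supported on ratio `1`. The
functions `f_{Id,(-n,0)}`, `n ≥ 0`, live exactly there and have disjoint supports, so they are
linearly independent modulo the image (`hasInfiniteCodim_of_le_opImage`). -/

namespace GL3

section Elements

variable {R : Type*} [CommRing R]

/-- The upper unitriangular matrix with entries `a`, `b`, `c` at `(0,1)`, `(0,2)`, `(1,2)`. -/
def up (a b c : R) : GL (Fin 3) R where
  val := !![1, a, b; 0, 1, c; 0, 0, 1]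
  inv := !![1, -a, a * c - b; 0, 1, -c; 0, 0, 1]
  val_inv := by
    ext i j; fin_cases i <;> fin_cases j <;> simp [Matrix.mul_apply, Fin.sum_univ_three] <;> ring
  inv_val := by
    ext i j; fin_cases i <;> fin_cases j <;> simp [Matrix.mul_apply, Fin.sum_univ_three] <;> ring

/-- The lower unitriangular matrix with entries `a`, `b`, `c` at `(1,0)`, `(2,0)`, `(2,1)`. -/
def lo (a b c : R) : GL (Fin 3) R where
  val := !![1, 0, 0; a, 1, 0; b, c, 1]
  inv := !![1, 0, 0; -a, 1, 0; a * c - b, -c, 1]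
  val_inv := by
    ext i j; fin_cases i <;> fin_cases j <;> simp [Matrix.mul_apply, Fin.sum_univ_three] <;> ring
  inv_val := by
    ext i j; fin_cases i <;> fin_cases j <;> simp [Matrix.mul_apply, Fin.sum_univ_three] <;> ring

variable (R) in
/-- The permutation matrix of the first simple reflection. -/
def s₁ : GL (Fin 3) R where
  val := !![0, 1, 0; 1, 0, 0; 0, 0, 1]
  inv := !![0, 1, 0; 1, 0, 0; 0, 0, 1]
  val_inv := by
    ext i j; fin_cases i <;> fin_cases j <;> simp [Matrix.mul_apply, Fin.sum_univ_three]
  inv_val := by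
    ext i j; fin_cases i <;> fin_cases j <;> simp [Matrix.mul_apply, Fin.sum_univ_three]

variable (R) in
/-- The permutation matrix of the second simple reflection. -/
def s₂ : GL (Fin 3) R where
  val := !![1, 0, 0; 0, 0, 1; 0, 1, 0]
  inv := !![1, 0, 0; 0, 0, 1; 0, 1, 0]
  val_inv := by
    ext i j; fin_cases i <;> fin_cases j <;> simp [Matrix.mul_apply, Fin.sum_univ_three]
  inv_val := by
    ext i j; fin_cases i <;> fin_cases j <;> simp [Matrix.mul_apply, Fin.sum_univ_three]

/-- The diagonal matrix with entries `x`, `y`, `z`. -/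
def dg (x y z : Rˣ) : GL (Fin 3) R where
  val := !![(x : R), 0, 0; 0, y, 0; 0, 0, z]
  inv := !![((x⁻¹ : Rˣ) : R), 0, 0; 0, ((y⁻¹ : Rˣ) : R), 0; 0, 0, ((z⁻¹ : Rˣ) : R)]
  val_inv := by
    ext i j; fin_cases i <;> fin_cases j <;> simp [Matrix.mul_apply, Fin.sum_univ_three]
  inv_val := by
    ext i j; fin_cases i <;> fin_cases j <;> simp [Matrix.mul_apply, Fin.sum_univ_three]

theorem up_val (a b c : R) : (up a b c).1 = !![1, a, b; 0, 1, c; 0, 0, 1] := rfl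
theorem lo_val (a b c : R) : (lo a b c).1 = !![1, 0, 0; a, 1, 0; b, c, 1] := rfl
theorem s₁_val : (s₁ R).1 = !![0, 1, 0; 1, 0, 0; 0, 0, 1] := rfl
theorem s₂_val : (s₂ R).1 = !![1, 0, 0; 0, 0, 1; 0, 1, 0] := rfl
theorem dg_val (x y z : Rˣ) : (dg x y z).1 = !![(x : R), 0, 0; 0, y, 0; 0, 0, z] := rfl
theorem up_inv (a b c : R) : (up a b c)⁻¹ = up (-a) (a * c - b) (-c) := Units.ext rfl
theorem s₁_inv : (s₁ R)⁻¹ = s₁ R := Units.ext rfl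
theorem s₂_inv : (s₂ R)⁻¹ = s₂ R := Units.ext rfl
theorem dg_inv (x y z : Rˣ) : (dg x y z)⁻¹ = dg x⁻¹ y⁻¹ z⁻¹ := Units.ext rfl

theorem ext_fin_three {A B : GL (Fin 3) R} (h00 : A.1 0 0 = B.1 0 0) (h01 : A.1 0 1 = B.1 0 1)
    (h02 : A.1 0 2 = B.1 0 2) (h10 : A.1 1 0 = B.1 1 0) (h11 : A.1 1 1 = B.1 1 1)
    (h12 : A.1 1 2 = B.1 1 2) (h20 : A.1 2 0 = B.1 2 0) (h21 : A.1 2 1 = B.1 2 1)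
    (h22 : A.1 2 2 = B.1 2 2) : A = B := by
  ext i j
  fin_cases i <;> fin_cases j <;> assumption

theorem up_mul (a b c a' b' c' : R) :
    up a b c * up a' b' c' = up (a + a') (b + b' + a * c') (c + c') := by
  apply ext_fin_three <;>
    simp [up_val] <;> ring

theorem lo_mul (a b c a' b' c' : R) :
    lo a b c * lo a' b' c' = lo (a + a') (b + b' + c * a') (c + c') := by
  apply ext_fin_three <;> simp [lo_val] <;> ring

theorem up_zero : up (0 : R) 0 0 = 1 := by
  apply ext_fin_three <;> simp [up_val]

theorem lo_zero : lo (0 : R) 0 0 = 1 := by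
  apply ext_fin_three <;> simp [lo_val]

theorem s₁_mul_s₁ : s₁ R * s₁ R = 1 := by rw [mul_eq_one_iff_eq_inv, s₁_inv]

theorem s₂_mul_s₂ : s₂ R * s₂ R = 1 := by rw [mul_eq_one_iff_eq_inv, s₂_inv]

theorem s₁_up_s₁ (a : R) : s₁ R * up a 0 0 * s₁ R = lo a 0 0 := by
  apply ext_fin_three <;> simp [s₁_val, up_val, lo_val]

theorem s₂_up_s₂ (a : R) : s₂ R * up 0 0 a * s₂ R = lo 0 0 a := by
  apply ext_fin_three <;> simp [s₂_val, up_val, lo_val]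

/-- The rank-one identity moving the big cell to the opposite one. Its last factor is upper
triangular, hence acts by a scalar on a `U`-fixed torus eigenvector. -/
theorem up_mul_s₁ (y : Rˣ) :
    up (y : R) 0 0 * s₁ R = lo ((y⁻¹ : Rˣ) : R) 0 0 * (dg y (-y⁻¹) 1 * up ((y⁻¹ : Rˣ) : R) 0 0) := by
  apply ext_fin_three <;> simp [s₁_val, up_val, lo_val, dg_val]

theorem up_mul_s₂ (y : Rˣ) :
    up 0 0 (y : R) * s₂ R = lo 0 0 ((y⁻¹ : Rˣ) : R) * (dg 1 y (-y⁻¹) * up 0 0 ((y⁻¹ : Rˣ) : R)) := by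
  apply ext_fin_three <;> simp [s₂_val, up_val, lo_val, dg_val]

theorem dg_mul_up (x y z : Rˣ) (a b c : R) :
    dg x y z * up a b c = up (x * a * (y⁻¹ : Rˣ)) (x * b * (z⁻¹ : Rˣ)) (y * c * (z⁻¹ : Rˣ)) * dg x y z := by
  apply ext_fin_three <;> simp [up_val, dg_val]

theorem dg_mul_lo (x y z : Rˣ) (a b c : R) :
    dg x y z * lo a b c = lo (y * a * (x⁻¹ : Rˣ)) (z * b * (x⁻¹ : Rˣ)) (z * c * (y⁻¹ : Rˣ)) * dg x y z := by
  apply ext_fin_three <;> simp [lo_val, dg_val]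

theorem dg_mul_s₁ (x y z : Rˣ) : dg x y z * s₁ R = s₁ R * dg y x z := by
  apply ext_fin_three <;> simp [s₁_val, dg_val]

theorem dg_mul_s₂ (x y z : Rˣ) : dg x y z * s₂ R = s₂ R * dg x z y := by
  apply ext_fin_three <;> simp [s₂_val, dg_val]

theorem up_mul_up_s₁ (a b c y : R) : up a b c * (up y 0 0 * s₁ R) =
    up (a + y) 0 0 * s₁ R * up 0 c (b - (a + y) * c) := by
  apply ext_fin_three <;> simp [s₁_val, up_val, add_comm]

theorem up_mul_up_s₂ (a b c y : R) : up a b c * (up 0 0 y * s₂ R) =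
    up 0 0 (c + y) * s₂ R * up (a * y + b) a 0 := by
  apply ext_fin_three <;> simp [s₂_val, up_val] <;> ring

/-- The reflection normalises the lower unipotent group with vanishing (1,0) entry, so the action of
`s₁` on lower translates reduces to rank one. -/
theorem s₁_mul_lo (a b c : R) : s₁ R * lo a b c = lo 0 (c) (b - c * a) * (s₁ R * lo a 0 0) := by
  apply ext_fin_three <;> simp [s₁_val, lo_val]

theorem s₂_mul_lo (a b c : R) : s₂ R * lo a b c = lo b a 0 * (s₂ R * lo 0 0 c) := by
  apply ext_fin_three <;> simp [s₂_val, lo_val]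

/-- With `braid_right`, this gives two parametrisations of the big cell of `GL₃`; they differ only
by the shift of the middle coordinate by `a * c`. -/
theorem braid_left (a b c : R) :
    up a 0 0 * s₁ R * (up 0 0 b * s₂ R * (up c 0 0 * s₁ R)) =
      up a (b + a * c) c * (s₁ R * s₂ R * s₁ R) := by
  apply ext_fin_three <;> simp [s₁_val, s₂_val, up_val] <;> ring

theorem braid_right (a b c : R) :
    up 0 0 c * s₂ R * (up b 0 0 * s₁ R * (up 0 0 a * s₂ R)) =
      up a b c * (s₁ R * s₂ R * s₁ R) := by
  apply ext_fin_three <;> simp [s₁_val, s₂_val, up_val]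

end Elements

/-! ### Generators of `GL₃` over a field -/

section Generation

variable {k : Type*} [Field k]

/-- A set closed under multiplication containing the standard generators of `GL₃` is everything. -/
theorem gen_induction (P : GL (Fin 3) k → Prop) (hd : ∀ x y z, P (dg x y z)) (h₁ : P (s₁ k))
    (h₂ : P (s₂ k)) (hl : ∀ a b c, P (lo a b c)) (hmul : ∀ A B, P A → P B → P (A * B))
    (g : GL (Fin 3) k) : P g := by
  have hdet : g.1.det ≠ 0 := (Matrix.isUnits_det_units g).ne_zero
  have key : ∃ A : GL (Fin 3) k, P A ∧ A.1 = g.1 := by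
    refine Matrix.diagonal_transvection_induction_of_det_ne_zero
      (fun M => ∃ A : GL (Fin 3) k, P A ∧ A.1 = M) g.1 hdet ?_ ?_ ?_
    · intro D hD
      rw [Matrix.det_diagonal, Fin.prod_univ_three] at hD
      have h0 : D 0 ≠ 0 := fun h => hD (by simp [h])
      have h1 : D 1 ≠ 0 := fun h => hD (by simp [h])
      have h2 : D 2 ≠ 0 := fun h => hD (by simp [h])
      refine ⟨dg (Units.mk0 _ h0) (Units.mk0 _ h1) (Units.mk0 _ h2), hd _ _ _, ?_⟩
      ext i j
      fin_cases i <;> fin_cases j <;> simp [dg_val]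
    · rintro ⟨i, j, hij, c⟩
      -- Upper transvections are conjugates of lower ones under the simple reflections; the one at
      -- (0,2) is obtained from the one at (1,2).
      have h01 : P (up c 0 0) := by
        have : up c 0 0 = s₁ k * lo c 0 0 * s₁ k := by
          rw [← s₁_up_s₁, ← mul_assoc, ← mul_assoc, s₁_mul_s₁, one_mul, mul_assoc, s₁_mul_s₁,
            mul_one]
        rw [this]
        exact hmul _ _ (hmul _ _ h₁ (hl _ _ _)) h₁
      have h12 : P (up 0 0 c) := by
        have : up 0 0 c = s₂ k * lo 0 0 c * s₂ k := by
          rw [← s₂_up_s₂, ← mul_assoc, ← mul_assoc, s₂_mul_s₂, one_mul, mul_assoc, s₂_mul_s₂,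
            mul_one]
        rw [this]
        exact hmul _ _ (hmul _ _ h₂ (hl _ _ _)) h₂
      have h02 : P (up 0 c 0) := by
        have : up 0 c 0 = s₁ k * up 0 0 c * s₁ k := by
          apply ext_fin_three <;> simp [s₁_val, up_val]
        rw [this]
        exact hmul _ _ (hmul _ _ h₁ h12) h₁
      fin_cases i <;> fin_cases j
      · simp at hij
      · refine ⟨_, h01, ?_⟩
        ext i j
        fin_cases i <;> fin_cases j <;>
          simp [up_val, Matrix.TransvectionStruct.toMatrix, Matrix.transvection, Matrix.single]
      · refine ⟨_, h02, ?_⟩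
        ext i j
        fin_cases i <;> fin_cases j <;>
          simp [up_val, Matrix.TransvectionStruct.toMatrix, Matrix.transvection, Matrix.single]
      · refine ⟨_, hl c 0 0, ?_⟩
        ext i j
        fin_cases i <;> fin_cases j <;>
          simp [lo_val, Matrix.TransvectionStruct.toMatrix, Matrix.transvection, Matrix.single]
      · simp at hij
      · refine ⟨_, h12, ?_⟩
        ext i j
        fin_cases i <;> fin_cases j <;>
          simp [up_val, Matrix.TransvectionStruct.toMatrix, Matrix.transvection, Matrix.single]
      · refine ⟨_, hl 0 c 0, ?_⟩
        ext i j
        fin_cases i <;> fin_cases j <;>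
          simp [lo_val, Matrix.TransvectionStruct.toMatrix, Matrix.transvection, Matrix.single]
      · refine ⟨_, hl 0 0 c, ?_⟩
        ext i j
        fin_cases i <;> fin_cases j <;>
          simp [lo_val, Matrix.TransvectionStruct.toMatrix, Matrix.transvection, Matrix.single]
      · simp at hij
    · rintro A B - - ⟨A', hA', rfl⟩ ⟨B', hB', rfl⟩
      exact ⟨A' * B', hmul _ _ hA' hB', rfl⟩
  obtain ⟨A, hA, e⟩ := key
  rwa [← Units.ext e]

end Generation

end GL3

/-! ## Representations of `GL₃` of a finite field in the defining characteristic -/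

namespace GL3

/-! ### Fixed vectors of `p`-groups in characteristic `p` -/

section FixedVectors

/-- The span of one `U`-orbit over the finite field `K` is a finite `U`-stable set whose order is a
positive power of `p`. The number of fixed points is divisible by `p` and `0` is one of them, so
there is another. No finiteness of `W` is required. -/
theorem exists_fixed_vector_of_algebra {U K C W : Type*} [Group U] [Finite U] {p : ℕ}
    [Fact p.Prime] (hU : IsPGroup p U) [Field K] [Finite K] [CharP K p] [Field C] [Algebra K C]
    [AddCommGroup W] [Module C W] [Module K W] [IsScalarTower K C W]
    (ρ : Representation C U W) (A : Submodule C W) (hA : ∀ u, ∀ w ∈ A, ρ u w ∈ A) (hne : A ≠ ⊥) :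
    ∃ w ∈ A, w ≠ 0 ∧ ∀ u, ρ u w = w := by
  obtain ⟨w, hwA, hw⟩ := Submodule.exists_mem_ne_zero_of_ne_bot hne
  let S : Submodule K W := Submodule.span K (Set.range fun u => ρ u w)
  have hfin : FiniteDimensional K S :=
    FiniteDimensional.span_of_finite K (Set.finite_range fun u => ρ u w)
  have hSfin : Finite S := Module.finite_of_finite K
  have hstab : ∀ u, ∀ x ∈ S, ρ u x ∈ S := by
    intro u
    change S ≤ S.comap ((ρ u).restrictScalars K)
    refine Submodule.span_le.2 ?_
    rintro _ ⟨u', rfl⟩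
    refine Submodule.subset_span ⟨u * u', ?_⟩
    simp
  have hSA : S ≤ A.restrictScalars K :=
    Submodule.span_le.2 (by rintro _ ⟨u, rfl⟩; exact hA _ _ hwA)
  letI : MulAction U S :=
    { smul := fun u x => ⟨ρ u x, hstab u x x.2⟩
      one_smul := fun x => Subtype.ext (by change ρ 1 (x : W) = x; simp)
      mul_smul := fun u u' x => Subtype.ext (by change ρ (u * u') (x : W) = ρ u (ρ u' x); simp) }
  have hw0 : ρ 1 w = w := by simp
  have hwS : w ∈ S := Submodule.subset_span ⟨1, hw0⟩
  have : Nontrivial S := ⟨⟨⟨w, hwS⟩, 0, fun h => hw (congrArg Subtype.val h)⟩⟩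
  have hcard : p ∣ Nat.card S := by
    have h1 : Nat.card S = Nat.card K ^ Module.finrank K S := Module.natCard_eq_pow_finrank
    have : Fintype K := Fintype.ofFinite K
    obtain ⟨n, -, hn⟩ := FiniteField.card K p
    rw [h1, Nat.card_eq_fintype_card, hn, ← pow_mul]
    exact dvd_pow_self p (Nat.mul_ne_zero n.ne_zero (Module.finrank_pos).ne')
  have h0 : (0 : S) ∈ MulAction.fixedPoints U S := fun u => Subtype.ext (map_zero (ρ u))
  obtain ⟨b, hb, hb0⟩ := hU.exists_fixed_point_of_prime_dvd_card_of_fixed_point S hcard h0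
  exact ⟨b, hSA b.2, fun h => hb0 (Subtype.ext h.symm), fun u => congrArg Subtype.val (hb u)⟩

/-- A `p`-group acting linearly on a vector space over a field of characteristic `p`, preserving a
nonzero subspace, fixes a nonzero vector of it. -/
theorem exists_fixed_vector {U C W : Type*} [Group U] [Finite U] {p : ℕ} [Fact p.Prime]
    (hU : IsPGroup p U) [Field C] [CharP C p] [AddCommGroup W] [Module C W]
    (ρ : Representation C U W) (A : Submodule C W) (hA : ∀ u, ∀ w ∈ A, ρ u w ∈ A) (hne : A ≠ ⊥) :
    ∃ w ∈ A, w ≠ 0 ∧ ∀ u, ρ u w = w := by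
  letI : Algebra (ZMod p) C := ZMod.algebra C p
  letI : Module (ZMod p) W := Module.compHom W (algebraMap (ZMod p) C)
  haveI : IsScalarTower (ZMod p) C W := ⟨fun a c w => by
    rw [Algebra.smul_def, mul_smul]; rfl⟩
  exact exists_fixed_vector_of_algebra (K := ZMod p) hU ρ A hA hne

variable {k : Type*} [Field k]

theorem up_mem_upperUnip (a b c : k) : up a b c ∈ upperUnip k := by
  refine ⟨fun i j h => ?_, fun i => ?_⟩
  · fin_cases i <;> fin_cases j <;> simp [up_val] at h ⊢
  · fin_cases i <;> simp [up_val]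

theorem exists_eq_up {g : GL (Fin 3) k} (hg : g ∈ upperUnip k) : ∃ a b c, g = up a b c := by
  refine ⟨g.1 0 1, g.1 0 2, g.1 1 2, ?_⟩
  have h1 := hg.1
  have h2 := hg.2
  apply ext_fin_three <;> simp [up_val, h2]
  · exact h1 1 0 (by decide)
  · exact h1 2 0 (by decide)
  · exact h1 2 1 (by decide)

theorem isPGroup_upperUnip (p : ℕ) [Fact p.Prime] [CharP k p] : IsPGroup p (upperUnip k) := by
  rintro ⟨g, hg⟩
  obtain ⟨a, b, c, rfl⟩ := exists_eq_up hg
  -- Write the matrix as `1 + N` with `N ^ 3 = 0`. The exponent `p ^ 2` is at least `3` for every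
  -- prime, whereas `p` itself fails for `p = 2`.
  refine ⟨2, Subtype.ext (Units.ext ?_)⟩
  change (up a b c).1 ^ p ^ 2 = 1
  have h1 : (up a b c).1 = 1 + !![0, a, b; 0, 0, c; 0, 0, 0] := by
    ext i j; fin_cases i <;> fin_cases j <;> simp [up_val]
  have h3 : (!![0, a, b; 0, 0, c; 0, 0, 0] : Matrix (Fin 3) (Fin 3) k) ^ 3 = 0 := by
    rw [pow_succ, pow_two]
    ext i j; fin_cases i <;> fin_cases j <;> simp [Matrix.mul_apply, Fin.sum_univ_three]
  have hp : 3 ≤ p ^ 2 := by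
    have := (Fact.out : p.Prime).two_le
    nlinarith
  rw [h1, add_pow_char_pow_of_commute _ _ (Commute.one_left _), one_pow,
    pow_eq_zero_of_le hp h3, add_zero]

end FixedVectors

/-! ### Rank-one Hecke operators -/

section RankOne

variable {k C W G : Type*} [Field k] [Fintype k] [Field C] [AddCommGroup W] [Module C W] [Group G]

/-- The operator `v ↦ ∑ y, u(y) s v`. -/
def heckeOp (ρ : Representation C G W) (u : k → G) (s : G) : W →ₗ[C] W :=
  ∑ y, ρ (u y * s)

theorem heckeOp_apply (ρ : Representation C G W) (u : k → G) (s : G) (v : W) :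
    heckeOp ρ u s v = ∑ y, ρ (u y * s) v := by
  simp [heckeOp]

variable {p : ℕ} [Fact p.Prime] [CharP k p] [CharP C p]

theorem card_smul_eq_zero (p : ℕ) [Fact p.Prime] [CharP k p] [CharP C p] (w : W) :
    Fintype.card k • w = 0 := by
  have : (Fintype.card k : C) = 0 := by
    obtain ⟨n, -, hn⟩ := FiniteField.card k p
    rw [hn, Nat.cast_pow, CharP.cast_eq_zero, zero_pow n.ne_zero]
  rw [← Nat.cast_smul_eq_nsmul C, this, zero_smul]

variable (ρ : Representation C G W) {u l : k → G} {s : G} {b : kˣ → G}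

/-- A fixed vector which is an eigenvector of the Hecke operator is moved by the reflection into
the span of its translates under the opposite root subgroup. -/
theorem exists_reflection_eq_sum (p : ℕ) [Fact p.Prime] [CharP k p] [CharP C p]
    (hsus : ∀ y, s * u y * s = l y)
    (hus : ∀ y : kˣ, u y * s = l (y⁻¹ : kˣ) * b y) (hu0 : u 0 = 1)
    {v : W} {β : kˣ → C}
    (hb : ∀ y, ρ (b y) v = β y • v) {η : C} (hη : heckeOp ρ u s v = η • v) :
    ∃ c : k → C, ρ s v = ∑ y, c y • ρ (l y) v ∧ (∑ y, c y) * η = 0 := by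
  classical
  -- If `η = 0`, the term `y = 0` of the vanishing sum is `s v`, so `s v` is minus the sum of the
  -- others; each of these is a lower translate of a multiple of `v`, with parameter `y⁻¹`.
  by_cases h : η = 0
  · subst h
    rw [zero_smul, heckeOp_apply, ← Finset.add_sum_erase _ _ (Finset.mem_univ 0), hu0, one_mul] at hη
    refine ⟨fun y => if hy : y = 0 then 0 else -β (Units.mk0 y hy)⁻¹, ?_, by simp⟩
    rw [eq_neg_of_add_eq_zero_left hη, ← Finset.add_sum_erase _ _ (Finset.mem_univ 0)]
    simp only [dite_true, zero_smul, zero_add]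
    rw [← Finset.sum_neg_distrib]
    refine Finset.sum_bij' (fun y _ => y⁻¹) (fun y _ => y⁻¹) (by simp) (by simp) (by simp) (by simp)
      ?_
    intro y hy
    have hy0 : y ≠ 0 := by simpa using hy
    have := hus (Units.mk0 y hy0)
    rw [Units.val_mk0] at this
    rw [this, dif_neg (inv_ne_zero hy0), map_mul, Module.End.mul_apply, hb, map_smul, neg_smul]
    congr 3
    ext; simp
  -- If `η ≠ 0`, apply `s` to `v = η⁻¹ ∑ u(y) s v`. The coefficients are constant, so their sum is a
  -- multiple of `|k|`, which is zero in `C`.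
  · refine ⟨fun _ => η⁻¹, ?_, ?_⟩
    · have h1 : v = η⁻¹ • heckeOp ρ u s v := by rw [hη, smul_smul, inv_mul_cancel₀ h, one_smul]
      conv_lhs => rw [h1]
      rw [heckeOp_apply, map_smul, map_sum, Finset.smul_sum]
      refine Finset.sum_congr rfl fun y _ => ?_
      rw [← Module.End.mul_apply, ← map_mul, ← mul_assoc, hsus]
    · have := card_smul_eq_zero (k := k) (C := C) p (η⁻¹)
      rw [Finset.sum_const, Finset.card_univ, this, zero_mul]

/-- The quadratic relation. In the double sum, the term `z = 0` gives `|k| v = 0`. For `z ≠ 0`, `s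
u(z) s = l(z)` equals `u(z⁻¹) s` times the inverse of an element acting on `v` by a scalar, and the
factor `u(z⁻¹)` is absorbed by translating `y`. -/
theorem heckeOp_heckeOp (p : ℕ) [Fact p.Prime] [CharP k p] [CharP C p]
    (hss : s * s = 1) (hsus : ∀ y, s * u y * s = l y)
    (hus : ∀ y : kˣ, u y * s = l (y⁻¹ : kˣ) * b y) (hu0 : u 0 = 1)
    (huu : ∀ y z, u y * u z = u (y + z))
    {v : W} (hv : ∀ y, ρ (u y) v = v) {β : kˣ → C} (hb : ∀ y, ρ (b y) v = β y • v) :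
    ∃ c : C, heckeOp ρ u s (heckeOp ρ u s v) = c • heckeOp ρ u s v := by
  classical
  refine ⟨∑ z : kˣ, (β z)⁻¹, ?_⟩
  have hbinv : ∀ y, ρ (b y)⁻¹ v = (β y)⁻¹ • v := by
    intro y
    have h1 : ρ (b y)⁻¹ (ρ (b y) v) = v := by simp
    -- A vanishing eigenvalue of an invertible operator forces `v = 0`, where the convention `0⁻¹ =
    -- 0` does no harm.
    by_cases h0 : β y = 0
    · rw [hb, h0] at h1
      simp at h1
      simp [← h1]
    · rw [hb, map_smul] at h1
      rw [← h1, smul_smul, inv_mul_cancel₀ h0, one_smul, h1]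
  have key : ∀ z, ∑ y, ρ (u y * s) (ρ (u z * s) v) =
      if hz : z = 0 then 0 else (β (Units.mk0 z hz)⁻¹)⁻¹ • heckeOp ρ u s v := by
    intro z
    have h1 : ∀ y, ρ (u y * s) (ρ (u z * s) v) = ρ (u y) (ρ (l z) v) := by
      intro y
      rw [← hsus, ← Module.End.mul_apply, ← Module.End.mul_apply, ← map_mul, ← map_mul]
      simp only [mul_assoc]
    simp only [h1]
    split_ifs with hz
    · subst hz
      have h2 : l 0 = 1 := by rw [← hsus, hu0, mul_one, hss]
      simp only [h2, map_one, Module.End.one_apply, hv, Finset.sum_const, Finset.card_univ]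
      exact card_smul_eq_zero (C := C) p v
    · have h2 : l z = u z⁻¹ * s * (b (Units.mk0 z hz)⁻¹)⁻¹ := by
        have := hus (Units.mk0 z hz)⁻¹
        rw [inv_inv, Units.val_mk0, Units.val_inv_eq_inv_val, Units.val_mk0] at this
        rw [this, mul_inv_cancel_right]
      rw [heckeOp_apply, Finset.smul_sum]
      refine Fintype.sum_equiv (Equiv.addRight z⁻¹) _ _ fun y => ?_
      rw [h2, ← Module.End.mul_apply, ← map_mul, ← mul_assoc, ← mul_assoc, huu, map_mul,
        Module.End.mul_apply, hbinv, map_smul]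
      rfl
  rw [heckeOp_apply ρ u s v, map_sum]
  simp only [heckeOp_apply]
  rw [Finset.sum_congr rfl fun z _ => key z, ← Finset.add_sum_erase _ _ (Finset.mem_univ 0)]
  simp only [dite_true, zero_add]
  rw [← heckeOp_apply, Finset.sum_smul]
  symm
  refine Finset.sum_bij' (fun z _ => ((z⁻¹ : kˣ) : k))
    (fun z hz => (Units.mk0 z (by simpa using hz))⁻¹) (by simp) (by simp)
    (fun z _ => by ext; simp) (fun z _ => by simp) fun z _ => ?_
  rw [dif_neg (Units.ne_zero _)]
  congr 3
  ext; simp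

end RankOne

end GL3

namespace GL3

/-! ### The Levi subgroup of type (2,1) and the transpose -/

section Levi

variable {R : Type*} [CommRing R]

/-- The block diagonal matrix with blocks `A` and `d`. -/
def levi (A : GL (Fin 2) R) (d : Rˣ) : GL (Fin 3) R where
  val := !![A.1 0 0, A.1 0 1, 0; A.1 1 0, A.1 1 1, 0; 0, 0, d]
  inv := !![A⁻¹.1 0 0, A⁻¹.1 0 1, 0; A⁻¹.1 1 0, A⁻¹.1 1 1, 0; 0, 0, (d⁻¹ : Rˣ)]
  val_inv := by
    have h : ∀ i j, (A.1 * A⁻¹.1) i j = (1 : Matrix (Fin 2) (Fin 2) R) i j := fun i j => by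
      rw [← Units.val_mul, mul_inv_cancel, Units.val_one]
    simp only [Matrix.mul_apply, Fin.sum_univ_two] at h
    ext i j; fin_cases i <;> fin_cases j <;>
      simp [Matrix.mul_apply, Fin.sum_univ_three, h, -Matrix.coe_units_inv]
  inv_val := by
    have h : ∀ i j, (A⁻¹.1 * A.1) i j = (1 : Matrix (Fin 2) (Fin 2) R) i j := fun i j => by
      rw [← Units.val_mul, inv_mul_cancel, Units.val_one]
    simp only [Matrix.mul_apply, Fin.sum_univ_two] at h
    ext i j; fin_cases i <;> fin_cases j <;>
      simp [Matrix.mul_apply, Fin.sum_univ_three, h, -Matrix.coe_units_inv]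

theorem levi_val (A : GL (Fin 2) R) (d : Rˣ) :
    (levi A d).1 = !![A.1 0 0, A.1 0 1, 0; A.1 1 0, A.1 1 1, 0; 0, 0, (d : R)] := rfl

theorem levi_inv (A : GL (Fin 2) R) (d : Rˣ) : (levi A d)⁻¹ = levi A⁻¹ d⁻¹ := Units.ext rfl

theorem levi_mul (A B : GL (Fin 2) R) (d e : Rˣ) :
    levi A d * levi B e = levi (A * B) (d * e) := by
  apply ext_fin_three <;> simp [levi_val, Matrix.mul_apply, Fin.sum_univ_two, Fin.sum_univ_three]

theorem levi_mul_up (A : GL (Fin 2) R) (d : Rˣ) (b c : R) : ∃ b' c' : R,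
    levi A d * up 0 b c = up 0 b' c' * levi A d := by
  refine ⟨(A.1 0 0 * b + A.1 0 1 * c) * (d⁻¹ : Rˣ), (A.1 1 0 * b + A.1 1 1 * c) * (d⁻¹ : Rˣ), ?_⟩
  apply ext_fin_three <;> simp [levi_val, up_val]

theorem up_mul_levi (A : GL (Fin 2) R) (d : Rˣ) (b c : R) : ∃ b' c' : R,
    up 0 b c * levi A d = levi A d * up 0 b' c' := by
  obtain ⟨b', c', h⟩ := levi_mul_up A⁻¹ d⁻¹ b c
  refine ⟨b', c', ?_⟩
  rw [← levi_inv] at h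
  rw [← mul_inv_cancel_left (levi A d) (up 0 b c), h]
  simp only [mul_assoc, inv_mul_cancel, mul_one]

theorem levi_mul_lo (A : GL (Fin 2) R) (d : Rˣ) (b c : R) : ∃ b' c' : R,
    levi A d * lo 0 b c = lo 0 b' c' * levi A d := by
  have h : ∀ i j, (A⁻¹.1 * A.1) i j = (1 : Matrix (Fin 2) (Fin 2) R) i j := fun i j => by
    rw [← Units.val_mul, inv_mul_cancel, Units.val_one]
  simp only [Matrix.mul_apply, Fin.sum_univ_two] at h
  refine ⟨d * (b * A⁻¹.1 0 0 + c * A⁻¹.1 1 0), d * (b * A⁻¹.1 0 1 + c * A⁻¹.1 1 1), ?_⟩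
  have h00 := h 0 0
  have h01 := h 0 1
  have h10 := h 1 0
  have h11 := h 1 1
  simp [-Matrix.coe_units_inv] at h00 h01 h10 h11
  apply ext_fin_three <;> simp [levi_val, lo_val, -Matrix.coe_units_inv]
  · linear_combination -(d : R) * (b * h00 + c * h10)
  · linear_combination -(d : R) * (b * h01 + c * h11)

/-- An upper unitriangular `2 × 2` matrix. -/
def up₂ (a : R) : GL (Fin 2) R where
  val := !![1, a; 0, 1]
  inv := !![1, -a; 0, 1]
  val_inv := by
    ext i j; fin_cases i <;> fin_cases j <;> simp [Matrix.mul_apply, Fin.sum_univ_two]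
  inv_val := by
    ext i j; fin_cases i <;> fin_cases j <;> simp [Matrix.mul_apply, Fin.sum_univ_two]

/-- A lower unitriangular `2 × 2` matrix. -/
def lo₂ (a : R) : GL (Fin 2) R where
  val := !![1, 0; a, 1]
  inv := !![1, 0; -a, 1]
  val_inv := by
    ext i j; fin_cases i <;> fin_cases j <;> simp [Matrix.mul_apply, Fin.sum_univ_two]
  inv_val := by
    ext i j; fin_cases i <;> fin_cases j <;> simp [Matrix.mul_apply, Fin.sum_univ_two]

theorem levi_up₂ (a : R) : levi (up₂ a) 1 = up a 0 0 := by
  apply ext_fin_three <;> simp [levi_val, up_val, up₂]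

theorem levi_lo₂ (a : R) : levi (lo₂ a) 1 = lo a 0 0 := by
  apply ext_fin_three <;> simp [levi_val, lo_val, lo₂]

theorem levi_one : levi (1 : GL (Fin 2) R) 1 = 1 := by
  apply ext_fin_three <;> simp [levi_val]

/-- The transpose of an invertible matrix. -/
def tr (g : GL (Fin 3) R) : GL (Fin 3) R where
  val := g.1.transpose
  inv := g⁻¹.1.transpose
  val_inv := by rw [← Matrix.transpose_mul, ← Units.val_mul, inv_mul_cancel]; simp
  inv_val := by rw [← Matrix.transpose_mul, ← Units.val_mul, mul_inv_cancel]; simp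

theorem tr_val (g : GL (Fin 3) R) : (tr g).1 = g.1.transpose := rfl
theorem tr_mul (g h : GL (Fin 3) R) : tr (g * h) = tr h * tr g := Units.ext (Matrix.transpose_mul _ _)
theorem tr_one : tr (1 : GL (Fin 3) R) = 1 := Units.ext Matrix.transpose_one
theorem tr_tr (g : GL (Fin 3) R) : tr (tr g) = g := Units.ext (Matrix.transpose_transpose _)
theorem tr_up (a b c : R) : tr (up a b c) = lo a b c := by
  apply ext_fin_three <;> simp [tr_val, up_val, lo_val]
theorem tr_lo (a b c : R) : tr (lo a b c) = up a b c := by rw [← tr_up, tr_tr]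

end Levi

/-! ### Hecke eigenvectors and the simple reflections -/

section Weights

variable {k C W : Type*} [Field k] [Fintype k] [Field C] [AddCommGroup W] [Module C W]
  (ρ : Representation C (GL (Fin 3) k) W)

/-- The Hecke operators of the two simple reflections. -/
def hecke₁ : W →ₗ[C] W := heckeOp ρ (fun y : k => up y 0 0) (s₁ k)

/-- The Hecke operator of the second simple reflection. -/
def hecke₂ : W →ₗ[C] W := heckeOp ρ (fun y : k => up 0 0 y) (s₂ k)

/-- Vectors fixed by the upper unitriangular matrices. -/
def UFixed (v : W) : Prop := ∀ a b c : k, ρ (up a b c) v = v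

/-- Eigenvectors of the diagonal matrices. -/
def TEigen (v : W) : Prop := ∀ x y z : kˣ, ∃ c : C, ρ (dg x y z) v = c • v

variable {ρ}

theorem UFixed.diag {v : W} (hv : UFixed ρ v) (x y z : kˣ) : UFixed ρ (ρ (dg x y z) v) := by
  intro a b c
  have h := dg_mul_up x y z ((x⁻¹ : kˣ) * a * y) ((x⁻¹ : kˣ) * b * z) ((y⁻¹ : kˣ) * c * z)
  have h' : dg x y z * up ((x⁻¹ : kˣ) * a * y) ((x⁻¹ : kˣ) * b * z) ((y⁻¹ : kˣ) * c * z) =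
      up a b c * dg x y z := by
    rw [h]
    congr 2 <;> simp [mul_assoc]
  rw [← Module.End.mul_apply, ← map_mul, ← h', map_mul, Module.End.mul_apply, hv]

theorem UFixed.hecke₁ {v : W} (hv : UFixed ρ v) : UFixed ρ (hecke₁ ρ v) := by
  intro a b c
  rw [GL3.hecke₁, heckeOp_apply, map_sum]
  refine Fintype.sum_equiv (Equiv.addLeft a) _ _ fun y => ?_
  rw [← Module.End.mul_apply, ← map_mul, up_mul_up_s₁, map_mul, Module.End.mul_apply, hv]
  rfl

theorem UFixed.hecke₂ {v : W} (hv : UFixed ρ v) : UFixed ρ (hecke₂ ρ v) := by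
  intro a b c
  rw [GL3.hecke₂, heckeOp_apply, map_sum]
  refine Fintype.sum_equiv (Equiv.addLeft c) _ _ fun y => ?_
  rw [← Module.End.mul_apply, ← map_mul, up_mul_up_s₂, map_mul, Module.End.mul_apply, hv]
  rfl

theorem TEigen.hecke₁ {v : W} (hv : TEigen ρ v) : TEigen ρ (hecke₁ ρ v) := by
  intro x y z
  obtain ⟨c, hc⟩ := hv y x z
  refine ⟨c, ?_⟩
  rw [GL3.hecke₁, heckeOp_apply, map_sum, Finset.smul_sum]
  refine Fintype.sum_equiv ((Units.mulLeft (x * y⁻¹))) _ _ fun a => ?_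
  have h : dg x y z * (up a 0 0 * s₁ k) = up ((x * y⁻¹ : kˣ) * a : k) 0 0 * s₁ k * dg y x z := by
    rw [← mul_assoc, dg_mul_up, mul_assoc, dg_mul_s₁, ← mul_assoc]
    congr 3 <;> push_cast <;> ring
  rw [← map_smul, ← hc, ← Module.End.mul_apply, ← Module.End.mul_apply, ← map_mul, ← map_mul, h]
  rfl

theorem TEigen.hecke₂ {v : W} (hv : TEigen ρ v) : TEigen ρ (hecke₂ ρ v) := by
  intro x y z
  obtain ⟨c, hc⟩ := hv x z y
  refine ⟨c, ?_⟩
  rw [GL3.hecke₂, heckeOp_apply, map_sum, Finset.smul_sum]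
  refine Fintype.sum_equiv ((Units.mulLeft (y * z⁻¹))) _ _ fun a => ?_
  have h : dg x y z * (up 0 0 a * s₂ k) = up 0 0 ((y * z⁻¹ : kˣ) * a : k) * s₂ k * dg x z y := by
    rw [← mul_assoc, dg_mul_up, mul_assoc, dg_mul_s₂, ← mul_assoc]
    congr 3 <;> push_cast <;> ring
  rw [← map_smul, ← hc, ← Module.End.mul_apply, ← Module.End.mul_apply, ← map_mul, ← map_mul, h]
  rfl

/-- Both sides sum the translates of `v` over the big cell; for fixed `a` and `c` the shift of `b`
by `a * c` is a bijection. -/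
theorem hecke_braid (v : W) :
    hecke₁ ρ (hecke₂ ρ (hecke₁ ρ v)) = hecke₂ ρ (hecke₁ ρ (hecke₂ ρ v)) := by
  let f : k → k → k → W := fun a b c => ρ (up a b c * (s₁ k * s₂ k * s₁ k)) v
  have hl : hecke₁ ρ (hecke₂ ρ (hecke₁ ρ v)) = ∑ a : k, ∑ b : k, ∑ c : k, f a (b + a * c) c := by
    simp only [f, ← braid_left, map_mul _ (_ * _) (_ * _), Module.End.mul_apply, ← map_sum,
      ← heckeOp_apply]
    rfl
  have hr : hecke₂ ρ (hecke₁ ρ (hecke₂ ρ v)) = ∑ c : k, ∑ b : k, ∑ a : k, f a b c := by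
    simp only [f, ← braid_right, map_mul _ (_ * _) (_ * _), Module.End.mul_apply, ← map_sum,
      ← heckeOp_apply]
    rfl
  rw [hl, hr, Finset.sum_comm]
  have h : ∀ a : k, ∑ b : k, ∑ c : k, f a (b + a * c) c = ∑ c : k, ∑ b : k, f a b c := by
    intro a
    rw [Finset.sum_comm]
    exact Finset.sum_congr rfl fun c _ =>
      Fintype.sum_equiv (Equiv.addRight (a * c)) _ _ fun b => rfl
  rw [Finset.sum_comm, Finset.sum_congr rfl fun a _ => h a, Finset.sum_comm]
  exact Finset.sum_congr rfl fun c _ => Finset.sum_comm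

variable {p : ℕ} [Fact p.Prime] [CharP k p] [CharP C p]

theorem TEigen.exists_dg_up {v : W} (hv : UFixed ρ v) (ht : TEigen ρ v) :
    (∃ β : kˣ → C, ∀ y : kˣ, ρ (GL3.dg y (-y⁻¹) 1 * up ((y⁻¹ : kˣ) : k) 0 0) v = β y • v) ∧
    ∃ β : kˣ → C, ∀ y : kˣ, ρ (GL3.dg 1 y (-y⁻¹) * up 0 0 ((y⁻¹ : kˣ) : k)) v = β y • v := by
  choose f hf using ht
  refine ⟨⟨fun y => f y (-y⁻¹) 1, fun y => ?_⟩, ⟨fun y => f 1 y (-y⁻¹), fun y => ?_⟩⟩ <;>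
    rw [map_mul, Module.End.mul_apply, hv, hf]

theorem hecke₁_hecke₁ (p : ℕ) [Fact p.Prime] [CharP k p] [CharP C p] {v : W} (hv : UFixed ρ v)
    (ht : TEigen ρ v) : ∃ c : C, hecke₁ ρ (hecke₁ ρ v) = c • hecke₁ ρ v := by
  obtain ⟨β, hβ⟩ := (ht.exists_dg_up hv).1
  exact heckeOp_heckeOp ρ p s₁_mul_s₁ s₁_up_s₁ up_mul_s₁ up_zero
    (fun y z => by rw [up_mul]; simp) (fun y => hv _ _ _) hβ

theorem hecke₂_hecke₂ (p : ℕ) [Fact p.Prime] [CharP k p] [CharP C p] {v : W} (hv : UFixed ρ v)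
    (ht : TEigen ρ v) : ∃ c : C, hecke₂ ρ (hecke₂ ρ v) = c • hecke₂ ρ v := by
  obtain ⟨β, hβ⟩ := (ht.exists_dg_up hv).2
  exact heckeOp_heckeOp ρ p s₂_mul_s₂ s₂_up_s₂ up_mul_s₂ up_zero
    (fun y z => by rw [up_mul]; simp) (fun y => hv _ _ _) hβ

variable (ρ) in
/-- A fixed vector of the unitriangular matrices which is an eigenvector of the diagonal matrices
and of the two Hecke operators. -/
structure IsEigen (v : W) : Prop where
  fixed : UFixed ρ v
  torus : TEigen ρ v
  eigen₁ : ∃ η : C, hecke₁ ρ v = η • v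
  eigen₂ : ∃ η : C, hecke₂ ρ v = η • v

/-- Apply alternating words in the two operators to `v`. A nonzero vector whose word starts with an
operator is an eigenvector of it by the quadratic relation. Stopping just before the word produces
zero makes the other eigenvalue `0`; if the longest word survives, the braid relation lets it start
with either operator. -/
theorem exists_isEigen (p : ℕ) [Fact p.Prime] [CharP k p] [CharP C p] {v : W} (hv0 : v ≠ 0)
    (hv : UFixed ρ v) (ht : TEigen ρ v) : ∃ v' : W, v' ≠ 0 ∧ IsEigen ρ v' := by
  have sq₁ := fun {w : W} (h : UFixed ρ w) (h' : TEigen ρ w) => hecke₁_hecke₁ p h h'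
  have sq₂ := fun {w : W} (h : UFixed ρ w) (h' : TEigen ρ w) => hecke₂_hecke₂ p h h'
  by_cases h121 : hecke₁ ρ (hecke₂ ρ (hecke₁ ρ v)) = 0
  · by_cases h1 : hecke₁ ρ v = 0
    · by_cases h12 : hecke₁ ρ (hecke₂ ρ v) = 0
      · by_cases h2 : hecke₂ ρ v = 0
        · exact ⟨v, hv0, hv, ht, ⟨0, by rw [h1, zero_smul]⟩, ⟨0, by rw [h2, zero_smul]⟩⟩
        · exact ⟨_, h2, hv.hecke₂, ht.hecke₂, ⟨0, by rw [h12, zero_smul]⟩, sq₂ hv ht⟩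
      · refine ⟨_, h12, hv.hecke₂.hecke₁, ht.hecke₂.hecke₁, sq₁ hv.hecke₂ ht.hecke₂, ⟨0, ?_⟩⟩
        rw [← hecke_braid, h121, zero_smul]
    · by_cases h21 : hecke₂ ρ (hecke₁ ρ v) = 0
      · exact ⟨_, h1, hv.hecke₁, ht.hecke₁, sq₁ hv ht, ⟨0, by rw [h21, zero_smul]⟩⟩
      · exact ⟨_, h21, hv.hecke₁.hecke₂, ht.hecke₁.hecke₂, ⟨0, by rw [h121, zero_smul]⟩,
          sq₂ hv.hecke₁ ht.hecke₁⟩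
  · refine ⟨_, h121, hv.hecke₁.hecke₂.hecke₁, ht.hecke₁.hecke₂.hecke₁,
      sq₁ hv.hecke₁.hecke₂ ht.hecke₁.hecke₂, ?_⟩
    rw [hecke_braid]
    exact sq₂ hv.hecke₂.hecke₁ ht.hecke₂.hecke₁

/-- A map insensitive to lower translates sees only the sum of the coefficients, which is why that
sum is controlled along with the expansion. -/
theorem IsEigen.reflection₁ (p : ℕ) [Fact p.Prime] [CharP k p] [CharP C p] {v : W}
    (hv : IsEigen ρ v) : ∃ c : k → C, ρ (s₁ k) v = ∑ y, c y • ρ (lo y 0 0) v ∧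
      (∑ y, c y) • hecke₁ ρ v = 0 := by
  obtain ⟨β, hβ⟩ := (hv.torus.exists_dg_up hv.fixed).1
  obtain ⟨η, hη⟩ := hv.eigen₁
  obtain ⟨c, hc, hc'⟩ := exists_reflection_eq_sum ρ p s₁_up_s₁ up_mul_s₁ up_zero hβ hη
  exact ⟨c, hc, by rw [hη, smul_smul, hc', zero_smul]⟩

theorem IsEigen.reflection₂ (p : ℕ) [Fact p.Prime] [CharP k p] [CharP C p] {v : W}
    (hv : IsEigen ρ v) : ∃ c : k → C, ρ (s₂ k) v = ∑ y, c y • ρ (lo 0 0 y) v ∧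
      (∑ y, c y) • hecke₂ ρ v = 0 := by
  obtain ⟨β, hβ⟩ := (hv.torus.exists_dg_up hv.fixed).2
  obtain ⟨η, hη⟩ := hv.eigen₂
  obtain ⟨c, hc, hc'⟩ := exists_reflection_eq_sum ρ p s₂_up_s₂ up_mul_s₂ up_zero hβ hη
  exact ⟨c, hc, by rw [hη, smul_smul, hc', zero_smul]⟩

variable (ρ) in
/-- The span of the translates of a vector under the lower unitriangular matrices. -/
def loSpan (v : W) : Submodule C W :=
  Submodule.span C (Set.range fun t : k × k × k => ρ (lo t.1 t.2.1 t.2.2) v)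

theorem lo_mem_loSpan (v : W) (a b c : k) : ρ (lo a b c) v ∈ loSpan ρ v :=
  Submodule.subset_span ⟨(a, b, c), rfl⟩

theorem mem_loSpan_self (v : W) : v ∈ loSpan ρ v := by
  simpa [lo_zero] using lo_mem_loSpan (ρ := ρ) v 0 0 0

theorem loSpan_le {v : W} {A : Submodule C W} (h : ∀ a b c, ρ (lo a b c) v ∈ A) :
    loSpan ρ v ≤ A :=
  Submodule.span_le.2 (by rintro _ ⟨⟨a, b, c⟩, rfl⟩; exact h a b c)

theorem lo_loSpan {v : W} (a b c : k) : ∀ w ∈ loSpan ρ v, ρ (lo a b c) w ∈ loSpan ρ v := by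
  change loSpan ρ v ≤ (loSpan ρ v).comap (ρ (lo a b c))
  refine loSpan_le fun a' b' c' => ?_
  rw [Submodule.mem_comap, ← Module.End.mul_apply, ← map_mul, lo_mul]
  exact lo_mem_loSpan _ _ _ _

/-- The span of the translates of an eigenvector under the lower unitriangular matrices is
stable under `GL₃`. -/
theorem IsEigen.loSpan_stable (p : ℕ) [Fact p.Prime] [CharP k p] [CharP C p] {v : W}
    (hv : IsEigen ρ v) (g : GL (Fin 3) k) : ∀ w ∈ loSpan ρ v, ρ g w ∈ loSpan ρ v := by
  obtain ⟨β₁, hβ₁⟩ := (hv.torus.exists_dg_up hv.fixed).1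
  obtain ⟨β₂, hβ₂⟩ := (hv.torus.exists_dg_up hv.fixed).2
  obtain ⟨c₁, hc₁, -⟩ := hv.reflection₁ p
  obtain ⟨c₂, hc₂, -⟩ := hv.reflection₂ p
  refine gen_induction (fun g => ∀ w ∈ loSpan ρ v, ρ g w ∈ loSpan ρ v) ?_ ?_ ?_
    (fun a b c => lo_loSpan a b c) ?_ g
  · intro x y z
    change loSpan ρ v ≤ (loSpan ρ v).comap (ρ (dg x y z))
    refine loSpan_le fun a b c => ?_
    obtain ⟨e, he⟩ := hv.torus x y z
    rw [Submodule.mem_comap, ← Module.End.mul_apply, ← map_mul, dg_mul_lo, map_mul,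
      Module.End.mul_apply, he, map_smul]
    exact Submodule.smul_mem _ _ (lo_mem_loSpan _ _ _ _)
  · change loSpan ρ v ≤ (loSpan ρ v).comap (ρ (s₁ k))
    refine loSpan_le fun a b c => ?_
    rw [Submodule.mem_comap, ← Module.End.mul_apply, ← map_mul, s₁_mul_lo, map_mul,
      Module.End.mul_apply]
    refine lo_loSpan _ _ _ _ ?_
    -- The rank-one identity handles `a ≠ 0`; at `a = 0` it is unavailable, and the Hecke
    -- eigenvector property supplies the expansion of `s₁ v` instead.
    by_cases ha : a = 0
    · rw [ha, lo_zero, mul_one, hc₁]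
      exact Submodule.sum_mem _ fun y _ => Submodule.smul_mem _ _ (lo_mem_loSpan _ _ _ _)
    · have h : s₁ k * lo a 0 0 = up a 0 0 * s₁ k := by
        rw [← s₁_up_s₁, ← mul_assoc, ← mul_assoc, s₁_mul_s₁, one_mul]
      have h' := up_mul_s₁ (Units.mk0 a ha)
      rw [Units.val_mk0] at h'
      rw [h, h', map_mul, Module.End.mul_apply, hβ₁, map_smul]
      exact Submodule.smul_mem _ _ (lo_mem_loSpan _ _ _ _)
  · change loSpan ρ v ≤ (loSpan ρ v).comap (ρ (s₂ k))
    refine loSpan_le fun a b c => ?_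
    rw [Submodule.mem_comap, ← Module.End.mul_apply, ← map_mul, s₂_mul_lo, map_mul,
      Module.End.mul_apply]
    refine lo_loSpan _ _ _ _ ?_
    by_cases hc : c = 0
    · rw [hc, lo_zero, mul_one, hc₂]
      exact Submodule.sum_mem _ fun y _ => Submodule.smul_mem _ _ (lo_mem_loSpan _ _ _ _)
    · have h : s₂ k * lo 0 0 c = up 0 0 c * s₂ k := by
        rw [← s₂_up_s₂, ← mul_assoc, ← mul_assoc, s₂_mul_s₂, one_mul]
      have h' := up_mul_s₂ (Units.mk0 c hc)
      rw [Units.val_mk0] at h'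
      rw [h, h', map_mul, Module.End.mul_apply, hβ₂, map_smul]
      exact Submodule.smul_mem _ _ (lo_mem_loSpan _ _ _ _)
  · intro A B hA hB w hw
    rw [map_mul, Module.End.mul_apply]
    exact hA _ (hB _ hw)

end Weights

end GL3

namespace GL3

/-! ### The line of `U`-invariants and the parabolic projection -/

section Line

variable {k C W : Type*} [Field k] [Fintype k] [Field C] [AddCommGroup W] [Module C W]
  (ρ : Representation C (GL (Fin 3) k) W)

/-- The action of `GL₃` on the dual space twisted by the transpose. -/
def transposeDual : Representation C (GL (Fin 3) k) (Module.Dual C W) where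
  toFun g := Module.Dual.transpose (R := C) (ρ (tr g))
  map_one' := by ext; simp [tr_one, Module.Dual.transpose_apply]
  map_mul' g h := by ext; simp [tr_mul, Module.Dual.transpose_apply]

theorem transposeDual_apply (g : GL (Fin 3) k) (φ : Module.Dual C W) (w : W) :
    transposeDual ρ g φ w = φ (ρ (tr g) w) := rfl

variable {ρ}

/-- If the vectors fixed by the unitriangular matrices form a line, they are eigenvectors. -/
theorem isEigen_of_line {v : W} (hv : UFixed ρ v)
    (h : ∀ w, UFixed ρ w → ∃ c : C, w = c • v) : IsEigen ρ v :=
  ⟨hv, fun x y z => h _ (hv.diag x y z), h _ hv.hecke₁, h _ hv.hecke₂⟩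

theorem exists_uFixed (p : ℕ) [Fact p.Prime] [CharP k p] [CharP C p]
    (A : Submodule C W) (hA : ∀ a b c, ∀ w ∈ A, ρ (up a b c) w ∈ A)
    (hne : A ≠ ⊥) : ∃ w ∈ A, w ≠ 0 ∧ UFixed ρ w := by
  obtain ⟨w, hw, h0, hfix⟩ := exists_fixed_vector (isPGroup_upperUnip (k := k) p)
    (ρ.comp (upperUnip k).subtype) A (by
      rintro ⟨u, hu⟩ w hw
      obtain ⟨a, b, c, rfl⟩ := exists_eq_up hu
      exact hA a b c w hw) hne
  exact ⟨w, hw, h0, fun a b c => hfix ⟨_, up_mem_upperUnip a b c⟩⟩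

/-- The structure of the vectors fixed by the unitriangular matrices in an irreducible
representation: they form a line, which generates the representation under the lower
unitriangular matrices, and is not killed by some functional invariant under them. -/
theorem line_of_irreducible (p : ℕ) [Fact p.Prime] [CharP k p] [CharP C p]
    (hirr : ∀ A : Submodule C W, (∀ g, ∀ w ∈ A, ρ g w ∈ A) → A = ⊥ ∨ A = ⊤)
    {v : W} (hv0 : v ≠ 0) (hv : UFixed ρ v) (ht : TEigen ρ v) :
    (∀ w, UFixed ρ w → ∃ c : C, w = c • v) ∧ IsEigen ρ v ∧ loSpan ρ v = ⊤ ∧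
      ∃ φ : Module.Dual C W, φ v ≠ 0 ∧ ∀ a b c w, φ (ρ (lo a b c) w) = φ w := by
  have hspan : ∀ {w : W}, w ≠ 0 → IsEigen ρ w → loSpan ρ w = ⊤ := by
    intro w hw0 hw
    refine (hirr _ (hw.loSpan_stable p)).resolve_left fun h => hw0 ?_
    have := mem_loSpan_self (ρ := ρ) w
    rwa [h, Submodule.mem_bot] at this
  -- At this stage `v` itself is not known to be a Hecke eigenvector, so the argument passes through
  -- an auxiliary one.
  obtain ⟨v', hv'0, hv'⟩ := exists_isEigen p hv0 hv ht
  have hdual : (⊤ : Submodule C (Module.Dual C W)) ≠ ⊥ := by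
    have : Nontrivial W := ⟨⟨v, 0, hv0⟩⟩
    exact top_ne_bot
  -- The transpose swaps upper and lower matrices, so a `U`-fixed vector of the twisted dual is a
  -- functional invariant under the lower unitriangular group.
  obtain ⟨φ, -, hφ0, hφ⟩ := exists_uFixed p (ρ := transposeDual ρ) ⊤ (fun _ _ _ _ _ => trivial) hdual
  have hinv : ∀ ψ : Module.Dual C W, UFixed (transposeDual ρ) ψ →
      ∀ a b c w, ψ (ρ (lo a b c) w) = ψ w := by
    intro ψ hψ a b c w
    have := LinearMap.congr_fun (hψ a b c) w
    rwa [transposeDual_apply, tr_up] at this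
  -- Lower translates of `v'` span `W`, so such a functional is determined by its value at `v'`.
  -- Hence these functionals form a line and `φ` is a Hecke eigenvector.
  have hdet : ∀ ψ : Module.Dual C W, UFixed (transposeDual ρ) ψ → ψ v' = 0 → ψ = 0 := by
    intro ψ hψ h
    have : loSpan ρ v' ≤ LinearMap.ker ψ := loSpan_le fun a b c => by
      rw [LinearMap.mem_ker, hinv ψ hψ, h]
    rw [hspan hv'0 hv', top_le_iff] at this
    exact LinearMap.ker_eq_top.1 this
  have hφv' : φ v' ≠ 0 := fun h => hφ0 (hdet φ hφ h)
  have hφE : IsEigen (transposeDual ρ) φ := by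
    refine isEigen_of_line hφ fun ψ hψ => ⟨ψ v' * (φ v')⁻¹, ?_⟩
    rw [← sub_eq_zero]
    refine hdet _ (fun a b c => ?_) ?_
    · rw [map_sub, map_smul, hψ, hφ]
    · simp [hφv']
  -- Irreducibility of the dual is not available, but the common kernel of the translates of `φ` is
  -- `GL₃`-stable in `W` and hence zero.
  let A : Submodule C W := (loSpan (transposeDual ρ) φ).dualCoannihilator
  have hA : ∀ w, w ∈ A ↔ ∀ ψ ∈ loSpan (transposeDual ρ) φ, ψ w = 0 := fun w =>
    Submodule.mem_dualCoannihilator w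
  have hAbot : A = ⊥ := by
    refine (hirr A fun g w hw => ?_).resolve_right fun h => ?_
    · rw [hA] at hw ⊢
      intro ψ hψ
      have := hw _ (hφE.loSpan_stable p (tr g) ψ hψ)
      rwa [transposeDual_apply, tr_tr] at this
    · refine hφ0 (LinearMap.ext fun w => ?_)
      have : w ∈ A := h ▸ trivial
      exact (hA w).1 this φ (mem_loSpan_self φ)
  -- A `U`-fixed vector in the kernel of `φ` is killed by all translates of `φ`; so `φ` is injective
  -- on `U`-fixed vectors, which therefore form a line.
  have hker : ∀ w, UFixed ρ w → φ w = 0 → w = 0 := by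
    intro w hw h
    rw [← Submodule.mem_bot C, ← hAbot, hA]
    intro ψ hψ
    have hle : loSpan (transposeDual ρ) φ ≤ LinearMap.ker (Module.Dual.eval C W w) :=
      loSpan_le fun a b c => by
        rw [LinearMap.mem_ker, Module.Dual.eval_apply, transposeDual_apply, tr_lo, hw, h]
    exact hle hψ
  have hφv : φ v ≠ 0 := fun h => hv0 (hker v hv h)
  have hline : ∀ w, UFixed ρ w → ∃ c : C, w = c • v := by
    refine fun w hw => ⟨φ w * (φ v)⁻¹, ?_⟩
    rw [← sub_eq_zero]
    refine hker _ (fun a b c => ?_) ?_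
    · rw [map_sub, map_smul, hw, hv]
    · simp [hφv]
  have hvE := isEigen_of_line hv hline
  exact ⟨hline, hvE, hspan hv0 hvE, φ, hφv, hinv φ hφ⟩

variable (ρ) in
/-- The span of the vectors `n w - w`, for `n` in the unipotent radical of the lower block
triangular matrices. -/
def unipDiff : Submodule C W :=
  Submodule.span C (Set.range fun t : k × k × W => ρ (lo 0 t.1 t.2.1) t.2.2 - t.2.2)

theorem mem_unipDiff (b c : k) (w : W) : ρ (lo 0 b c) w - w ∈ unipDiff ρ :=
  Submodule.subset_span ⟨(b, c, w), rfl⟩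

theorem unipDiff_le {A : Submodule C W} (h : ∀ b c w, ρ (lo 0 b c) w - w ∈ A) :
    unipDiff ρ ≤ A :=
  Submodule.span_le.2 (by rintro _ ⟨⟨b, c, w⟩, rfl⟩; exact h b c w)

theorem levi_unipDiff (A : GL (Fin 2) k) (d : kˣ) :
    ∀ w ∈ unipDiff ρ, ρ (levi A d) w ∈ unipDiff ρ := by
  change unipDiff ρ ≤ (unipDiff ρ).comap (ρ (levi A d))
  refine unipDiff_le fun b c w => ?_
  obtain ⟨b', c', h⟩ := levi_mul_lo A d b c
  rw [Submodule.mem_comap, map_sub, ← Module.End.mul_apply, ← map_mul, h, map_mul,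
    Module.End.mul_apply]
  exact mem_unipDiff _ _ _

variable (ρ) in
/-- The span of the translates of a vector under the block diagonal matrices. -/
def leviSpan (v : W) : Submodule C W :=
  Submodule.span C (Set.range fun t : GL (Fin 2) k × kˣ => ρ (levi t.1 t.2) v)

theorem mem_leviSpan (v : W) (A : GL (Fin 2) k) (d : kˣ) : ρ (levi A d) v ∈ leviSpan ρ v :=
  Submodule.subset_span ⟨(A, d), rfl⟩

theorem leviSpan_le {v : W} {S : Submodule C W} (h : ∀ A d, ρ (levi A d) v ∈ S) :
    leviSpan ρ v ≤ S :=
  Submodule.span_le.2 (by rintro _ ⟨⟨A, d⟩, rfl⟩; exact h A d)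

theorem levi_leviSpan {v : W} (A : GL (Fin 2) k) (d : kˣ) :
    ∀ w ∈ leviSpan ρ v, ρ (levi A d) w ∈ leviSpan ρ v := by
  change leviSpan ρ v ≤ (leviSpan ρ v).comap (ρ (levi A d))
  refine leviSpan_le fun B e => ?_
  rw [Submodule.mem_comap, ← Module.End.mul_apply, ← map_mul, levi_mul]
  exact mem_leviSpan _ _ _

theorem up_leviSpan {v : W} (hv : UFixed ρ v) (b c : k) :
    ∀ w ∈ leviSpan ρ v, ρ (up 0 b c) w = w := by
  change leviSpan ρ v ≤ LinearMap.eqLocus (ρ (up 0 b c)) LinearMap.id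
  refine leviSpan_le fun A d => ?_
  obtain ⟨b', c', h⟩ := up_mul_levi A d b c
  rw [LinearMap.mem_eqLocus, ← Module.End.mul_apply, ← map_mul, h, map_mul,
    Module.End.mul_apply, hv]
  rfl

/-- The projection of an irreducible representation to the invariants of the unipotent radical of
the upper block triangular matrices, which factors through the coinvariants of the opposite
unipotent radical. -/
theorem exists_parabolic_projection (p : ℕ) [Fact p.Prime] [CharP k p] [CharP C p]
    (hirr : ∀ A : Submodule C W, (∀ g, ∀ w ∈ A, ρ g w ∈ A) → A = ⊥ ∨ A = ⊤)
    {v : W} (hv0 : v ≠ 0) (hv : UFixed ρ v) (ht : TEigen ρ v) :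
    ∃ τ : W →ₗ[C] W, τ v = v ∧
      (∀ (A : GL (Fin 2) k) (d : kˣ) (b c b' c' : k) (w : W),
        τ (ρ (levi A d * lo 0 b c) w) = ρ (levi A d * up 0 b' c') (τ w)) ∧
      (∀ w, (∀ a b c, τ (ρ (up a b c) w) = 0) → w = 0) ∧
      ∑ y : k, ρ (up 0 0 y * s₂ k) (τ (ρ (s₂ k) v)) = 0 ∧
      ∑ y : k, ∑ z : k, ρ (up y z 0 * (s₁ k * s₂ k)) (τ (ρ (s₂ k * s₁ k) v)) = 0 := by
  obtain ⟨hline, hE, hspan, φ, hφv, hφ⟩ := line_of_irreducible p hirr hv0 hv ht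
  -- Every nonzero `U`-stable subspace contains a `U`-fixed vector, hence the line through `v`.
  have hmem : ∀ A : Submodule C W, (∀ a b c, ∀ w ∈ A, ρ (up a b c) w ∈ A) → A ≠ ⊥ → v ∈ A := by
    intro A hA hne
    obtain ⟨w, hw, hw0, hfix⟩ := exists_uFixed p A hA hne
    obtain ⟨c, rfl⟩ := hline w hfix
    have hc : c ≠ 0 := fun h => hw0 (by rw [h, zero_smul])
    exact (Submodule.smul_mem_iff _ hc).1 hw
  have hvL : v ∈ leviSpan ρ v := by simpa [levi_one] using mem_leviSpan (ρ := ρ) v 1 1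
  have hφD : unipDiff ρ ≤ LinearMap.ker φ := unipDiff_le fun b c w => by
    rw [LinearMap.mem_ker, map_sub, hφ, sub_self]
  -- The intersection is `U`-stable, so if nonzero it would contain `v`; but the invariant
  -- functional `φ` kills all differences and not `v`. The sum is everything because each lower
  -- translate of `v` is a Levi translate plus a difference.
  have hcompl : IsCompl (leviSpan ρ v) (unipDiff ρ) := by
    constructor
    · rw [disjoint_iff]
      by_contra hne
      refine hφv (hφD (hmem _ ?_ hne).2)
      rintro a b c w ⟨hw, hw'⟩
      have h : up a b c = levi (up₂ a) 1 * up 0 (b - a * c) c := by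
        rw [levi_up₂, up_mul]; simp
      rw [h, map_mul, Module.End.mul_apply, up_leviSpan hv _ _ _ hw]
      exact ⟨levi_leviSpan _ _ _ hw, levi_unipDiff _ _ _ hw'⟩
    · rw [codisjoint_iff, ← top_le_iff, ← hspan]
      refine loSpan_le fun a b c => ?_
      have h : lo a b c = lo 0 (b - c * a) c * levi (lo₂ a) 1 := by
        rw [levi_lo₂, lo_mul]; simp
      rw [h, map_mul, Module.End.mul_apply, ← sub_add_cancel (ρ (lo _ _ _) _) (ρ (levi (lo₂ a) 1) v)]
      exact add_mem (Submodule.mem_sup_right (mem_unipDiff _ _ _))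
        (Submodule.mem_sup_left (mem_leviSpan _ _ _))
  let τ : W →ₗ[C] W := Submodule.projection _ _ hcompl
  have hτl : ∀ w ∈ leviSpan ρ v, τ w = w := fun w hw =>
    Submodule.projection_apply_left hcompl ⟨w, hw⟩
  have hτD : ∀ w ∈ unipDiff ρ, τ w = 0 := fun w hw =>
    (Submodule.projection_apply_eq_zero_iff hcompl).2 hw
  have hτv : τ v = v := hτl v hvL
  have hτm : ∀ w, τ w ∈ leviSpan ρ v := Submodule.projection_apply_mem hcompl
  have hτlo : ∀ b c w, τ (ρ (lo 0 b c) w) = τ w := by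
    intro b c w
    rw [← sub_eq_zero, ← map_sub]
    exact hτD _ (mem_unipDiff _ _ _)
  have hτlevi : ∀ A d w, τ (ρ (levi A d) w) = ρ (levi A d) (τ w) := by
    intro A d w
    have h : w - τ w ∈ unipDiff ρ := by
      rw [← Submodule.projection_apply_eq_zero_iff hcompl]
      change τ (w - τ w) = 0
      rw [map_sub, hτl _ (hτm w), sub_self]
    rw [← sub_eq_zero, ← hτl _ (levi_leviSpan A d _ (hτm w)), ← map_sub, ← map_sub]
    exact hτD _ (levi_unipDiff _ _ _ h)
  -- Here `e` is the sum of the coefficients expanding `s₂ v` in lower translates, all of which `τ`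
  -- sends to `v`.
  have h₂ : ∃ e : C, τ (ρ (s₂ k) v) = e • v ∧ e • hecke₂ ρ v = 0 := by
    obtain ⟨c, hc, hc'⟩ := hE.reflection₂ p
    refine ⟨_, ?_, hc'⟩
    rw [hc, map_sum, Finset.sum_smul]
    exact Finset.sum_congr rfl fun y _ => by rw [map_smul, hτlo, hτv]
  -- The translates expanding `s₁ v` move past `s₂` into the opposite radical, where `τ` absorbs
  -- them.
  have h₁ : ∃ e : C, τ (ρ (s₂ k * s₁ k) v) = e • τ (ρ (s₂ k) v) := by
    obtain ⟨c, hc, -⟩ := hE.reflection₁ p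
    refine ⟨∑ y, c y, ?_⟩
    rw [map_mul, Module.End.mul_apply, hc, map_sum, map_sum, Finset.sum_smul]
    refine Finset.sum_congr rfl fun y _ => ?_
    rw [map_smul, map_smul, ← Module.End.mul_apply (ρ (s₂ k)), ← map_mul, s₂_mul_lo, lo_zero, mul_one, map_mul,
      Module.End.mul_apply, hτlo]
  obtain ⟨e₂, he₂, he₂'⟩ := h₂
  obtain ⟨e₁, he₁⟩ := h₁
  refine ⟨τ, hτv, ?_, ?_, ?_, ?_⟩
  · intro A d b c b' c' w
    rw [map_mul, map_mul, Module.End.mul_apply, Module.End.mul_apply, hτlevi, hτlo,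
      up_leviSpan hv _ _ _ (hτm w)]
  -- The vectors all of whose `U`-translates are killed by `τ` form a `U`-stable subspace; if it
  -- were nonzero it would contain `v`, contrary to `τ v = v`.
  · intro w hw
    by_contra hw0
    let A : Submodule C W := ⨅ t : k × k × k, LinearMap.ker (τ ∘ₗ ρ (up t.1 t.2.1 t.2.2))
    have hA : ∀ w, w ∈ A ↔ ∀ a b c, τ (ρ (up a b c) w) = 0 := by
      intro w
      simp [A, Submodule.mem_iInf]
    have : v ∈ A := by
      refine hmem A (fun a b c w hw => ?_) fun h => hw0 ?_
      · rw [hA] at hw ⊢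
        intro a' b' c'
        rw [← Module.End.mul_apply (ρ (up a' b' c')), ← map_mul, up_mul, hw]
      · rw [← Submodule.mem_bot C, ← h, hA]
        exact hw
    have h := (hA v).1 this 0 0 0
    rw [up_zero, map_one, Module.End.one_apply, hτv] at h
    exact hv0 h
  · have := heckeOp_apply ρ (fun y : k => up 0 0 y) (s₂ k) (e₂ • v)
    rw [he₂, ← this]
    change hecke₂ ρ (e₂ • v) = 0
    rw [map_smul, he₂']
  -- The two-dimensional cell factors, so its sum is the first Hecke operator applied to the second,
  -- and the second already kills `e₂ v`.
  · have h : ∀ y z : k, up y z 0 * (s₁ k * s₂ k) = up y 0 0 * s₁ k * (up 0 0 z * s₂ k) := by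
      intro y z
      apply ext_fin_three <;> simp [up_val, s₁_val, s₂_val]
    simp only [h, map_mul _ (_ * _) (_ * _), Module.End.mul_apply, ← map_sum, ← heckeOp_apply, he₁,
      he₂]
    change hecke₁ ρ (hecke₂ ρ (e₁ • e₂ • v)) = 0
    rw [map_smul, map_smul, map_smul (hecke₂ ρ), he₂', map_zero, smul_zero]

end Line

end GL3

/-! ## Matrices over the ring of integers -/

namespace GL3

section Integral

variable {F : Type*} [Field F] [ValuativeRel F] [TopologicalSpace F] [IsNonarchimedeanLocalField F]

open ValuativeRel (valuation ValueGroupWithZero)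

theorem val_le_one (a : 𝒪[F]) : valuation F (a : F) ≤ 1 := a.2

theorem val_unit (u : (𝒪[F])ˣ) : valuation F ((u : 𝒪[F]) : F) = 1 := by
  refine le_antisymm (val_le_one _) ?_
  have h : valuation F ((u : 𝒪[F]) : F) * valuation F (((u⁻¹ : (𝒪[F])ˣ) : 𝒪[F]) : F) = 1 := by
    rw [← map_mul]
    have := congrArg (fun x : 𝒪[F] => (x : F)) (u.mul_inv)
    change valuation F (((u : 𝒪[F]) : F) * _) = 1
    have h2 : ((u : 𝒪[F]) : F) * (((u⁻¹ : (𝒪[F])ˣ) : 𝒪[F]) : F) = 1 := this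
    rw [h2, map_one]
  calc (1 : ValueGroupWithZero F) = _ := h.symm
    _ ≤ valuation F ((u : 𝒪[F]) : F) * 1 := by gcongr; exact val_le_one _
    _ = _ := mul_one _

theorem isUnit_of_val_eq_one {a : 𝒪[F]} (h : valuation F (a : F) = 1) : IsUnit a := by
  have h0 : (a : F) ≠ 0 := fun h0 => by simp [h0] at h
  refine IsUnit.of_mul_eq_one ⟨(a : F)⁻¹, ?_⟩ (Subtype.ext (mul_inv_cancel₀ h0))
  change valuation F _ ≤ 1
  rw [map_inv₀, h, inv_one]

theorem residue_eq_zero_iff_val (a : 𝒪[F]) : IsLocalRing.residue 𝒪[F] a = 0 ↔ valuation F (a : F) < 1 := by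
  rw [IsLocalRing.residue_eq_zero_iff, IsLocalRing.mem_maximalIdeal, mem_nonunits_iff,
    ← not_iff_not, not_not, not_lt]
  exact ⟨fun ⟨u, hu⟩ => hu ▸ (val_unit u).ge, fun h =>
    isUnit_of_val_eq_one (le_antisymm (val_le_one a) h)⟩

theorem redGL_apply (A : GL (Fin 3) 𝒪[F]) (i j : Fin 3) :
    (redGL F A).1 i j = IsLocalRing.residue 𝒪[F] (A.1 i j) := rfl

/-- Lift the entries arbitrarily: over a local ring a determinant with nonzero residue is a unit. -/
theorem redGL_surjective : Function.Surjective (redGL F) := by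
  intro B
  choose f hf using fun i j => IsLocalRing.residue_surjective (R := 𝒪[F]) (B.1 i j)
  have h1 : (IsLocalRing.residue 𝒪[F]).mapMatrix (Matrix.of f) = B.1 := by
    ext i j; exact hf i j
  have h2 : IsUnit (Matrix.of f).det := by
    rw [← isUnit_map_iff (IsLocalRing.residue 𝒪[F]), RingHom.map_det, h1]
    exact Matrix.isUnits_det_units B
  refine ⟨Matrix.GeneralLinearGroup.mk'' _ h2, ?_⟩
  ext i j
  exact hf i j

theorem val_det_inclGL (A : GL (Fin 3) 𝒪[F]) : valuation F (inclGL F A).1.det = 1 := by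
  have h : (inclGL F A).1.det = ((A.1.det : 𝒪[F]) : F) :=
    (RingHom.map_det (algebraMap 𝒪[F] F) A.1).symm
  obtain ⟨u, hu⟩ := Matrix.isUnits_det_units A
  rw [h, ← hu, val_unit]

theorem exists_inclGL_eq (g : GL (Fin 3) F) (h : ∀ i j, valuation F (g.1 i j) ≤ 1) (hd : valuation F g.1.det = 1) :
    ∃ A, inclGL F A = g := by
  let M : Matrix (Fin 3) (Fin 3) 𝒪[F] := Matrix.of fun i j => ⟨g.1 i j, h i j⟩
  have h1 : (algebraMap 𝒪[F] F).mapMatrix M = g.1 := by ext i j; rfl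
  have h2 : IsUnit M.det := by
    refine isUnit_of_val_eq_one ?_
    have : ((M.det : 𝒪[F]) : F) = g.1.det := by
      rw [← h1]; exact RingHom.map_det (algebraMap 𝒪[F] F) M
    rw [this, hd]
  exact ⟨Matrix.GeneralLinearGroup.mk'' _ h2, by ext i j; rfl⟩

theorem map_up {R S : Type*} [CommRing R] [CommRing S] (f : R →+* S) (a b c : R) :
    Matrix.GeneralLinearGroup.map f (up a b c) = up (f a) (f b) (f c) := by
  apply ext_fin_three <;> simp [up_val]

theorem map_lo {R S : Type*} [CommRing R] [CommRing S] (f : R →+* S) (a b c : R) :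
    Matrix.GeneralLinearGroup.map f (lo a b c) = lo (f a) (f b) (f c) := by
  apply ext_fin_three <;> simp [lo_val]

theorem map_s₁ {R S : Type*} [CommRing R] [CommRing S] (f : R →+* S) :
    Matrix.GeneralLinearGroup.map f (s₁ R) = s₁ S := by
  apply ext_fin_three <;> simp [s₁_val]

theorem map_s₂ {R S : Type*} [CommRing R] [CommRing S] (f : R →+* S) :
    Matrix.GeneralLinearGroup.map f (s₂ R) = s₂ S := by
  apply ext_fin_three <;> simp [s₂_val]

theorem map_dg {R S : Type*} [CommRing R] [CommRing S] (f : R →+* S) (x y z : Rˣ) :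
    Matrix.GeneralLinearGroup.map f (dg x y z) =
      dg (Units.map f x) (Units.map f y) (Units.map f z) := by
  apply ext_fin_three <;> simp [dg_val]

theorem inclGL_mem (A : GL (Fin 3) 𝒪[F]) : inclGL F A ∈ maxCompact F := ⟨A, rfl⟩

variable (F) in
/-- The isomorphism of `GL₃(𝔬)` with `K`. -/
noncomputable def toK : GL (Fin 3) 𝒪[F] →* maxCompact F :=
  (inclGL F).codRestrict (maxCompact F) inclGL_mem

theorem toK_surjective : Function.Surjective (toK F) := by
  rintro ⟨_, A, rfl⟩
  exact ⟨A, rfl⟩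

variable {C W : Type*} [Field C] [AddCommGroup W] [Module C W]

theorem mem_proPIwahori_of_mem_ker {A : GL (Fin 3) 𝒪[F]} (hA : A ∈ (redGL F).ker) :
    inclGL F A ∈ proPIwahori F := ⟨A, by
  change redGL F A ∈ upperUnip _
  rw [MonoidHom.mem_ker.1 hA]
  exact (upperUnip _).one_mem, rfl⟩

/-- The reduction kernel is normal, so its fixed vectors form a subrepresentation; it contains `v ≠
0` and is therefore everything. -/
theorem ker_redGL_le (σ : Representation C (maxCompact F) W)
    (hirr : ∀ S : Submodule C W, (∀ g, ∀ w ∈ S, σ g w ∈ S) → S = ⊥ ∨ S = ⊤)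
    {v : W} (hv0 : v ≠ 0) (hfix : ∀ A ∈ (redGL F).ker, σ (toK F A) v = v) :
    (redGL F).ker ≤ (σ.comp (toK F)).ker := by
  let S : Submodule C W := ⨅ A : (redGL F).ker, LinearMap.eqLocus (σ (toK F A)) LinearMap.id
  have hS : ∀ w, w ∈ S ↔ ∀ A ∈ (redGL F).ker, σ (toK F A) w = w := by
    intro w; simp [S, Submodule.mem_iInf, -MonoidHom.mem_ker]
  have hStop : S = ⊤ := by
    refine (hirr S ?_).resolve_left fun h => hv0 ?_
    · intro g w hw
      obtain ⟨B, rfl⟩ := toK_surjective g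
      rw [hS] at hw ⊢
      intro A hA
      have : A * B = B * (B⁻¹ * A * B) := by group
      rw [← Module.End.mul_apply, ← map_mul, ← map_mul, this, map_mul, map_mul,
        Module.End.mul_apply, hw]
      have := (MonoidHom.normal_ker (redGL F)).conj_mem A hA B⁻¹
      rwa [inv_inv] at this
    · rw [← Submodule.mem_bot C, ← h, hS]
      exact hfix
  intro A hA
  refine LinearMap.ext fun w => ?_
  have : w ∈ S := hStop ▸ trivial
  exact (hS w).1 this A hA

/-- An irreducible representation of `K` with a nonzero vector fixed by the pro-`p` Iwahori
subgroup is inflated from an irreducible representation of `GL₃` of the residue field. -/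
theorem exists_inflation (σ : Representation C (maxCompact F) W) (hirr : σ.IsIrreducible)
    {v : W} (hv0 : v ≠ 0)
    (hfix : ∀ u (hu : u ∈ proPIwahori F), σ ⟨u, proPIwahori_le_maxCompact F hu⟩ v = v) :
    ∃ ρ : Representation C (GL (Fin 3) 𝓀[F]) W,
      (∀ A, σ (toK F A) = ρ (redGL F A)) ∧
      ∀ S : Submodule C W, (∀ g, ∀ w ∈ S, ρ g w ∈ S) → S = ⊥ ∨ S = ⊤ := by
  have hirr' : ∀ S : Submodule C W, (∀ g, ∀ w ∈ S, σ g w ∈ S) → S = ⊥ ∨ S = ⊤ := by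
    intro S hS
    let S' : Subrepresentation σ := ⟨S, fun g w hw => hS g w hw⟩
    rcases eq_bot_or_eq_top S' with h | h
    · left; exact congrArg Subrepresentation.toSubmodule h
    · right; exact congrArg Subrepresentation.toSubmodule h
  have hker := ker_redGL_le σ hirr' hv0 fun A hA =>
    hfix (inclGL F A) (mem_proPIwahori_of_mem_ker hA)
  have hwd : ∀ A B, redGL F A = redGL F B → σ (toK F A) = σ (toK F B) := by
    intro A B h
    have h1 : σ (toK F (B⁻¹ * A)) = 1 := hker (by
      rw [MonoidHom.mem_ker, map_mul, map_inv, h, inv_mul_cancel])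
    rw [← mul_one (σ (toK F B)), ← h1, ← map_mul, ← map_mul, mul_inv_cancel_left]
  let lift := Function.surjInv (redGL_surjective (F := F))
  have hlift : ∀ B, redGL F (lift B) = B := Function.surjInv_eq redGL_surjective
  let ρ : Representation C (GL (Fin 3) 𝓀[F]) W :=
    { toFun := fun B => σ (toK F (lift B))
      map_one' := by
        rw [hwd _ 1 (by rw [hlift, map_one]), map_one, map_one]
      map_mul' := fun B B' => by
        rw [← map_mul, ← map_mul]
        exact hwd _ _ (by rw [map_mul, hlift, hlift, hlift]) }
  have hρ : ∀ A, ρ (redGL F A) = σ (toK F A) := fun A => hwd _ _ (hlift _)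
  refine ⟨ρ, fun A => (hρ A).symm, fun S hS => hirr' S fun g w hw => ?_⟩
  obtain ⟨A, rfl⟩ := toK_surjective g
  rw [← hρ A]
  exact hS _ w hw

end Integral

end GL3

/-! ## The spherical Hecke operator -/

namespace GL3
open ValuativeRel (valuation ValueGroupWithZero)

/-! ### The parabolic of type (2,1) over a field and its cosets -/

section Parabolic

variable {k : Type*} [Field k]

variable (k) in
/-- The upper block triangular matrices with blocks of size `2` and `1`. -/
def parUp : Subgroup (GL (Fin 3) k) where
  carrier := {g | g.1 2 0 = 0 ∧ g.1 2 1 = 0}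
  one_mem' := by simp
  mul_mem' {a b} ha hb := by
    change (a.1 * b.1) 2 0 = 0 ∧ (a.1 * b.1) 2 1 = 0
    simp [Matrix.mul_apply, Fin.sum_univ_three, ha.1, ha.2, hb.1, hb.2]
  inv_mem' {g} hg := by
    have hdet : g.1.det ≠ 0 := (Matrix.isUnits_det_units g).ne_zero
    have h : ∀ j, (g⁻¹.1 * g.1) 2 j = (1 : Matrix (Fin 3) (Fin 3) k) 2 j := fun j => by
      rw [← Units.val_mul, inv_mul_cancel, Units.val_one]
    have h0 := h 0
    have h1 := h 1
    simp only [Matrix.mul_apply, Fin.sum_univ_three, hg.1, hg.2, mul_zero, add_zero,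
      Matrix.one_apply] at h0 h1
    simp at h0 h1
    rw [Matrix.det_fin_three, hg.1, hg.2] at hdet
    have hD : g.1 0 0 * g.1 1 1 - g.1 0 1 * g.1 1 0 ≠ 0 := fun hD => hdet (by
      linear_combination g.1 2 2 * hD)
    constructor
    · refine (mul_eq_zero.1 (?_ : g⁻¹.1 2 0 * (g.1 0 0 * g.1 1 1 - g.1 0 1 * g.1 1 0) = 0)).resolve_right hD
      simp only [Matrix.coe_units_inv]
      linear_combination g.1 1 1 * h0 - g.1 1 0 * h1
    · refine (mul_eq_zero.1 (?_ : g⁻¹.1 2 1 * (g.1 0 0 * g.1 1 1 - g.1 0 1 * g.1 1 0) = 0)).resolve_right hD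
      simp only [Matrix.coe_units_inv]
      linear_combination g.1 0 0 * h1 - g.1 0 1 * h0

theorem mem_parUp {g : GL (Fin 3) k} : g ∈ parUp k ↔ g.1 2 0 = 0 ∧ g.1 2 1 = 0 := Iff.rfl

theorem tr_inv {R : Type*} [CommRing R] (g : GL (Fin 3) R) : tr g⁻¹ = (tr g)⁻¹ := by
  rw [eq_inv_iff_mul_eq_one, ← tr_mul, mul_inv_cancel, tr_one]

/-- If an upper and a lower block triangular matrix have the same diagonal blocks, they are products
of the same block diagonal matrix with unipotent ones. -/
theorem exists_levi_decomp {g g' : GL (Fin 3) k} (h : g.1 2 0 = 0 ∧ g.1 2 1 = 0)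
    (h' : g'.1 0 2 = 0 ∧ g'.1 1 2 = 0) (h00 : g'.1 0 0 = g.1 0 0) (h01 : g'.1 0 1 = g.1 0 1)
    (h10 : g'.1 1 0 = g.1 1 0) (h11 : g'.1 1 1 = g.1 1 1) (h22 : g'.1 2 2 = g.1 2 2) :
    ∃ (A : GL (Fin 2) k) (d : kˣ) (b c b' c' : k),
      g' = levi A d * lo 0 b c ∧ g = levi A d * up 0 b' c' := by
  have hdet : g.1.det ≠ 0 := (Matrix.isUnits_det_units g).ne_zero
  rw [Matrix.det_fin_three, h.1, h.2] at hdet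
  have hd : g.1 2 2 ≠ 0 := fun hd => hdet (by rw [hd]; ring)
  have hD : g.1 0 0 * g.1 1 1 - g.1 0 1 * g.1 1 0 ≠ 0 := fun hD => hdet (by
    linear_combination g.1 2 2 * hD)
  let A : GL (Fin 2) k := Matrix.GeneralLinearGroup.mkOfDetNeZero
    !![g.1 0 0, g.1 0 1; g.1 1 0, g.1 1 1] (by rwa [Matrix.det_fin_two_of])
  let d : kˣ := Units.mk0 _ hd
  have e : g = up 0 (g.1 0 2 / g.1 2 2) (g.1 1 2 / g.1 2 2) * levi A d := by
    apply ext_fin_three <;>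
      simp [up_val, levi_val, A, d, h, hd, Matrix.GeneralLinearGroup.mkOfDetNeZero]
  obtain ⟨b', c', e'⟩ := up_mul_levi A d (g.1 0 2 / g.1 2 2) (g.1 1 2 / g.1 2 2)
  refine ⟨A, d, g'.1 2 0 / g.1 2 2, g'.1 2 1 / g.1 2 2, b', c', ?_, e.trans e'⟩
  apply ext_fin_three <;>
    simp [lo_val, levi_val, A, d, h', hd, h00, h01, h10, h11, h22, mul_div_cancel₀,
      Matrix.GeneralLinearGroup.mkOfDetNeZero]

/-- Representatives of the cosets of the upper block triangular matrices. -/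
def bruhatRep {R : Type*} [CommRing R] : Unit ⊕ R ⊕ R × R → GL (Fin 3) R
  | .inl _ => 1
  | .inr (.inl y) => up 0 0 y * s₂ R
  | .inr (.inr (y, z)) => up y z 0 * (s₁ R * s₂ R)

/-- The coset of `x` corresponds to the last row of `x⁻¹` up to scaling, a point of the projective
plane. The three families are the cells given by the position of the first nonzero coordinate. -/
theorem bruhatRep_bijective :
    Function.Bijective fun i : Unit ⊕ k ⊕ k × k =>
      (QuotientGroup.mk (bruhatRep i) : GL (Fin 3) k ⧸ parUp k) := by
  constructor
  · intro i j hij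
    have h : (bruhatRep i)⁻¹ * bruhatRep j ∈ parUp k := QuotientGroup.eq.1 hij
    rw [mem_parUp] at h
    rcases i with i | y | ⟨y, z⟩ <;> rcases j with j | y' | ⟨y', z'⟩ <;>
      simp only [bruhatRep, mul_inv_rev, up_inv, s₁_inv, s₂_inv, inv_one, one_mul, mul_one,
        Units.val_mul, up_val, s₁_val, s₂_val] at h <;>
      simp at h ⊢
    · linear_combination -h
    · exact ⟨by linear_combination -h.1, by linear_combination -h.2⟩
  · intro q
    obtain ⟨x, rfl⟩ := QuotientGroup.mk_surjective q
    have hr : ¬ (x⁻¹.1 2 0 = 0 ∧ x⁻¹.1 2 1 = 0 ∧ x⁻¹.1 2 2 = 0) := by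
      rintro ⟨h0, h1, h2⟩
      apply (Matrix.isUnits_det_units x⁻¹).ne_zero
      rw [Matrix.det_fin_three, h0, h1, h2]
      ring
    have key : ∀ i, x⁻¹ * bruhatRep i ∈ parUp k →
        ∃ i, (QuotientGroup.mk (bruhatRep i) : GL (Fin 3) k ⧸ parUp k) = x := fun i hi =>
      ⟨i, (QuotientGroup.eq.2 hi).symm⟩
    by_cases h0 : x⁻¹.1 2 0 = 0
    · by_cases h1 : x⁻¹.1 2 1 = 0
      · exact key (.inl ()) (by
          simp only [bruhatRep, mul_one]; exact ⟨h0, h1⟩)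
      · refine key (.inr (.inl (-x⁻¹.1 2 2 / x⁻¹.1 2 1))) ?_
        rw [mem_parUp]
        simp only [Matrix.coe_units_inv] at h0 h1 ⊢
        simp [bruhatRep, up_val, s₂_val, Matrix.mul_apply, Fin.sum_univ_three, h0]
        field_simp
        ring
    · refine key (.inr (.inr (-x⁻¹.1 2 1 / x⁻¹.1 2 0, -x⁻¹.1 2 2 / x⁻¹.1 2 0))) ?_
      rw [mem_parUp]
      simp only [Matrix.coe_units_inv] at h0 ⊢
      simp [bruhatRep, up_val, s₁_val, s₂_val, Matrix.mul_apply, Fin.sum_univ_three]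
      constructor <;> field_simp <;> ring

/-- The Bruhat decomposition relative to a lower block triangular and the upper unitriangular
subgroups. -/
theorem exists_bruhat_low (g : GL (Fin 3) k) : ∃ a b c : k, ∃ w : GL (Fin 3) k,
    (w = 1 ∨ w = s₂ k ∨ w = s₂ k * s₁ k) ∧ tr (g * (up a b c)⁻¹ * w⁻¹) ∈ parUp k := by
  -- After inversion the condition concerns only the last column of `g⁻¹`: its lowest nonzero entry
  -- clears those above it through `U`, and `w` moves that entry to the bottom.
  have key : ∀ (a b c : k) (w : GL (Fin 3) k), (w * up a b c * g⁻¹).1 0 2 = 0 →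
      (w * up a b c * g⁻¹).1 1 2 = 0 → tr (g * (up a b c)⁻¹ * w⁻¹) ∈ parUp k := by
    intro a b c w h0 h1
    rw [← Subgroup.inv_mem_iff, ← tr_inv]
    simp only [mul_inv_rev, inv_inv]
    rw [← mul_assoc]
    exact ⟨h0, h1⟩
  by_cases h2 : g⁻¹.1 2 2 = 0
  · by_cases h1 : g⁻¹.1 1 2 = 0
    · refine ⟨0, 0, 0, _, .inr (.inr rfl), key _ _ _ _ ?_ ?_⟩ <;>
        simp only [Matrix.coe_units_inv] at h1 h2 <;>
        simp [up_val, s₁_val, s₂_val, Matrix.mul_apply, Fin.sum_univ_three, h1, h2]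
    · refine ⟨-g⁻¹.1 0 2 / g⁻¹.1 1 2, 0, 0, _, .inr (.inl rfl), key _ _ _ _ ?_ ?_⟩ <;>
        simp only [Matrix.coe_units_inv] at h1 h2 ⊢ <;>
        simp [up_val, s₂_val, Matrix.mul_apply, Fin.sum_univ_three, h1, h2]
  · refine ⟨0, -g⁻¹.1 0 2 / g⁻¹.1 2 2, -g⁻¹.1 1 2 / g⁻¹.1 2 2, _, .inl rfl, key _ _ _ _ ?_ ?_⟩ <;>
      simp only [Matrix.coe_units_inv] at h2 ⊢ <;>
      simp [up_val, Matrix.mul_apply, Fin.sum_univ_three, h2]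

end Parabolic

/-! ### Multiplication by diagonal matrices -/

section Diagonal

variable {R : Type*} [CommRing R]

theorem dg_mul_apply (x y z : Rˣ) (g : GL (Fin 3) R) (i j : Fin 3) :
    (dg x y z * g).1 i j = (![x, y, z] i : Rˣ) * g.1 i j := by
  have h : (dg x y z).1 = Matrix.diagonal fun i => ((![x, y, z] i : Rˣ) : R) := by
    ext i j; fin_cases i <;> fin_cases j <;> simp [dg_val]
  rw [Units.val_mul, h, Matrix.diagonal_mul]

theorem mul_dg_apply (x y z : Rˣ) (g : GL (Fin 3) R) (i j : Fin 3) :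
    (g * dg x y z).1 i j = g.1 i j * (![x, y, z] j : Rˣ) := by
  have h : (dg x y z).1 = Matrix.diagonal fun i => ((![x, y, z] i : Rˣ) : R) := by
    ext i j; fin_cases i <;> fin_cases j <;> simp [dg_val]
  rw [Units.val_mul, h, Matrix.mul_diagonal]

theorem dg_mul_dg (x y z x' y' z' : Rˣ) :
    dg x y z * dg x' y' z' = dg (x * x') (y * y') (z * z') := by
  apply ext_fin_three <;> simp [dg_val]

end Diagonal

/-! ### Conjugation by `diag(ϖ, ϖ, 1)` -/

section Uniformizer

variable {F : Type*} [Field F] [ValuativeRel F] [TopologicalSpace F] [IsNonarchimedeanLocalField F]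
  {ϖ : 𝒪[F]} (hϖ : Irreducible ϖ)

theorem val_unif : valuation F (unif hϖ : F) = valuation F (ϖ : F) := rfl

theorem val_unif_lt_one : valuation F (unif hϖ : F) < 1 := by
  rw [val_unif]
  rw [← residue_eq_zero_iff_val, IsLocalRing.residue_eq_zero_iff, IsLocalRing.mem_maximalIdeal]
  exact hϖ.not_isUnit

theorem val_unif_pos : 0 < valuation F (unif hϖ : F) :=
  zero_lt_iff.2 ((Valuation.ne_zero_iff _).2 (unif hϖ).ne_zero)

theorem val_le_val_unif {a : F} (ha : valuation F a < 1) :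
    valuation F a ≤ valuation F (unif hϖ : F) := by
  have h := (residue_eq_zero_iff_val (⟨a, ha.le⟩ : 𝒪[F])).2 ha
  rw [IsLocalRing.residue_eq_zero_iff, hϖ.maximalIdeal_eq, Ideal.mem_span_singleton] at h
  obtain ⟨b, hb⟩ := h
  have hb' : a = (ϖ : F) * (b : F) := congrArg Subtype.val hb
  rw [hb', map_mul]
  exact mul_le_of_le_one_right' (val_le_one b)

/-- The diagonal matrix `diag(ϖ, ϖ, 1)`. -/
noncomputable def sMat : GL (Fin 3) F := dg (unif hϖ) (unif hϖ) 1

theorem sMat_conj (j : GL (Fin 3) F) :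
    (sMat hϖ * j * (sMat hϖ)⁻¹).1 = !![j.1 0 0, j.1 0 1, (unif hϖ : F) * j.1 0 2;
      j.1 1 0, j.1 1 1, (unif hϖ : F) * j.1 1 2;
      j.1 2 0 * (unif hϖ : F)⁻¹, j.1 2 1 * (unif hϖ : F)⁻¹, j.1 2 2] := by
  have h := (unif hϖ).ne_zero
  ext i l
  rw [sMat, dg_inv, mul_dg_apply, dg_mul_apply]
  fin_cases i <;> fin_cases l <;> simp [mul_comm, h]

theorem sMat_inv_conj (j : GL (Fin 3) F) :
    ((sMat hϖ)⁻¹ * j * sMat hϖ).1 = !![j.1 0 0, j.1 0 1, j.1 0 2 * (unif hϖ : F)⁻¹;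
      j.1 1 0, j.1 1 1, j.1 1 2 * (unif hϖ : F)⁻¹;
      (unif hϖ : F) * j.1 2 0, (unif hϖ : F) * j.1 2 1, j.1 2 2] := by
  have h := (unif hϖ).ne_zero
  ext i l
  rw [sMat, dg_inv, mul_dg_apply, dg_mul_apply]
  fin_cases i <;> fin_cases l <;> simp [mul_comm, h]

theorem val_mul_inv_unif_le {a : F} (ha : valuation F a < 1) :
    valuation F (a * (unif hϖ : F)⁻¹) ≤ 1 := by
  rw [map_mul, map_inv₀]
  exact mul_inv_le_one_of_le₀ (val_le_val_unif hϖ ha) zero_le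

theorem val_unif_mul_lt {a : F} (ha : valuation F a ≤ 1) :
    valuation F ((unif hϖ : F) * a) < 1 := by
  rw [map_mul]
  exact mul_lt_one_of_lt_of_le (val_unif_lt_one hϖ) ha

/-- Conjugation by `diag(ϖ, ϖ, 1)` takes an integral matrix which is upper block triangular modulo
`ϖ` to one which is lower block triangular modulo `ϖ` with the same diagonal blocks. -/
theorem exists_sMat_conj {j : GL (Fin 3) 𝒪[F]} (hj : redGL F j ∈ parUp 𝓀[F]) :
    ∃ j' : GL (Fin 3) 𝒪[F], sMat hϖ * inclGL F j = inclGL F j' * sMat hϖ ∧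
      ∃ (A : GL (Fin 2) 𝓀[F]) (d : (𝓀[F])ˣ) (b c b' c' : 𝓀[F]),
        redGL F j' = levi A d * lo 0 b c ∧ redGL F j = levi A d * up 0 b' c' := by
  have h0 := (residue_eq_zero_iff_val _).1 hj.1
  have h1 := (residue_eq_zero_iff_val _).1 hj.2
  have hM := sMat_conj hϖ (inclGL F j)
  obtain ⟨j', hj'⟩ := exists_inclGL_eq (sMat hϖ * inclGL F j * (sMat hϖ)⁻¹) (by
      rw [hM]
      intro i l
      fin_cases i <;> fin_cases l
      · exact val_le_one (j.1 0 0)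
      · exact val_le_one (j.1 0 1)
      · exact (val_unif_mul_lt hϖ (val_le_one (j.1 0 2))).le
      · exact val_le_one (j.1 1 0)
      · exact val_le_one (j.1 1 1)
      · exact (val_unif_mul_lt hϖ (val_le_one (j.1 1 2))).le
      · exact val_mul_inv_unif_le hϖ h0
      · exact val_mul_inv_unif_le hϖ h1
      · exact val_le_one (j.1 2 2)) (by
      rw [Units.val_mul, Units.val_mul, Matrix.det_mul, Matrix.det_mul, mul_right_comm,
        ← Matrix.det_mul, ← Units.val_mul, mul_inv_cancel, Units.val_one, Matrix.det_one, one_mul,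
        val_det_inclGL])
  have he : ∀ i l, ((j'.1 i l : 𝒪[F]) : F) = (sMat hϖ * inclGL F j * (sMat hϖ)⁻¹).1 i l :=
    fun i l => by rw [← hj']; rfl
  rw [hM] at he
  have heq : ∀ i l, ((j'.1 i l : 𝒪[F]) : F) = ((j.1 i l : 𝒪[F]) : F) →
      (redGL F j').1 i l = (redGL F j).1 i l := fun i l h => by
    rw [redGL_apply, redGL_apply, Subtype.ext h]
  refine ⟨j', by rw [hj', inv_mul_cancel_right], exists_levi_decomp hj ⟨?_, ?_⟩ (heq _ _ (he 0 0))
    (heq _ _ (he 0 1)) (heq _ _ (he 1 0)) (heq _ _ (he 1 1)) (heq _ _ (he 2 2))⟩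
  · exact (residue_eq_zero_iff_val _).2 (he 0 2 ▸ val_unif_mul_lt hϖ (val_le_one (j.1 0 2)))
  · exact (residue_eq_zero_iff_val _).2 (he 1 2 ▸ val_unif_mul_lt hϖ (val_le_one (j.1 1 2)))

theorem exists_sMat_inv_conj {j : GL (Fin 3) 𝒪[F]} (hj : tr (redGL F j) ∈ parUp 𝓀[F]) :
    ∃ j' : GL (Fin 3) 𝒪[F], (sMat hϖ)⁻¹ * inclGL F j = inclGL F j' * (sMat hϖ)⁻¹ := by
  have h0 := (residue_eq_zero_iff_val _).1 hj.1
  have h1 := (residue_eq_zero_iff_val _).1 hj.2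
  have hM := sMat_inv_conj hϖ (inclGL F j)
  obtain ⟨j', hj'⟩ := exists_inclGL_eq ((sMat hϖ)⁻¹ * inclGL F j * sMat hϖ) (by
      rw [hM]
      intro i l
      fin_cases i <;> fin_cases l
      · exact val_le_one (j.1 0 0)
      · exact val_le_one (j.1 0 1)
      · exact val_mul_inv_unif_le hϖ h0
      · exact val_le_one (j.1 1 0)
      · exact val_le_one (j.1 1 1)
      · exact val_mul_inv_unif_le hϖ h1
      · exact (val_unif_mul_lt hϖ (val_le_one (j.1 2 0))).le
      · exact (val_unif_mul_lt hϖ (val_le_one (j.1 2 1))).le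
      · exact val_le_one (j.1 2 2)) (by
      rw [Units.val_mul, Units.val_mul, Matrix.det_mul, Matrix.det_mul, mul_right_comm,
        ← Matrix.det_mul, ← Units.val_mul, inv_mul_cancel, Units.val_one, Matrix.det_one, one_mul,
        val_det_inclGL])
  exact ⟨j', by rw [hj', mul_inv_cancel_right]⟩

end Uniformizer

/-! ### The operator and its equivariance -/

section Operator

variable {F : Type*} [Field F] [ValuativeRel F] [TopologicalSpace F] [IsNonarchimedeanLocalField F]
  {ϖ : 𝒪[F]} (hϖ : Irreducible ϖ) {C W : Type*} [Field C] [AddCommGroup W] [Module C W]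
  (ρ : Representation C (GL (Fin 3) 𝓀[F]) W) (τ : W →ₗ[C] W)

/-- Functions which are equivariant under `K` and invariant under the scalar `ϖ`. -/
def IsEquivariant (f : GL (Fin 3) F → W) : Prop :=
  (∀ A g, f (inclGL F A * g) = ρ (redGL F A) (f g)) ∧ ∀ (n : ℤ) g, f (scalarUnif hϖ ^ n * g) = f g

/-- Compatibility of a linear map with the two opposite parabolic subgroups: it intertwines elements
with the same image in the Levi subgroup. -/
def IsParabolicMap {k C W : Type*} [Field k] [Field C] [AddCommGroup W] [Module C W]
    (ρ : Representation C (GL (Fin 3) k) W) (τ : W →ₗ[C] W) : Prop :=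
  ∀ (A : GL (Fin 2) k) (d : kˣ) (b c b' c' : k) (w : W),
    τ (ρ (levi A d * lo 0 b c) w) = ρ (levi A d * up 0 b' c') (τ w)

/-- A lift of a coset to the integral matrices. -/
noncomputable def cosetLift (q : GL (Fin 3) 𝓀[F] ⧸ parUp 𝓀[F]) : GL (Fin 3) 𝒪[F] :=
  Function.surjInv redGL_surjective q.out

theorem redGL_cosetLift (q : GL (Fin 3) 𝓀[F] ⧸ parUp 𝓀[F]) :
    (redGL F (cosetLift q) : GL (Fin 3) 𝓀[F] ⧸ parUp 𝓀[F]) = q := by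
  rw [cosetLift, Function.surjInv_eq redGL_surjective, QuotientGroup.out_eq']

/-- A summand of the spherical Hecke operator. -/
noncomputable def opTerm (f : GL (Fin 3) F → W) (g : GL (Fin 3) F) (x : GL (Fin 3) 𝒪[F]) : W :=
  ρ (redGL F x) (τ (f (sMat hϖ * (inclGL F x)⁻¹ * g)))

/-- The spherical Hecke operator attached to `τ` and the double coset of `diag(ϖ, ϖ, 1)`. -/
noncomputable def opT (f : GL (Fin 3) F → W) (g : GL (Fin 3) F) : W :=
  ∑ᶠ q : GL (Fin 3) 𝓀[F] ⧸ parUp 𝓀[F], opTerm hϖ ρ τ f g (cosetLift q)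

variable {hϖ ρ τ}

/-- Put `j = y⁻¹ x` and `s j = j' s`. The reduction of `j'` is lower block triangular with the Levi
part of `j`, and `τ` converts the action of `j'` into that of `j`, which compensates the change of
representative. -/
theorem opTerm_congr (hτ : IsParabolicMap ρ τ)
    {f : GL (Fin 3) F → W} (hf : IsEquivariant hϖ ρ f) (g : GL (Fin 3) F)
    {x y : GL (Fin 3) 𝒪[F]}
    (h : (redGL F x : GL (Fin 3) 𝓀[F] ⧸ parUp 𝓀[F]) = redGL F y) :
    opTerm hϖ ρ τ f g x = opTerm hϖ ρ τ f g y := by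
  have h' : redGL F (y⁻¹ * x) ∈ parUp 𝓀[F] := by
    rw [map_mul, map_inv]; exact QuotientGroup.eq.1 h.symm
  obtain ⟨j', hj', A, d, b, c, b', c', e, e'⟩ := exists_sMat_conj hϖ h'
  have h1 : sMat hϖ * (inclGL F y)⁻¹ * g = inclGL F j' * (sMat hϖ * (inclGL F x)⁻¹ * g) := by
    rw [map_mul, map_inv] at hj'
    rw [← mul_assoc, ← mul_assoc, ← hj']
    group
  rw [opTerm, opTerm, h1, hf.1, e, hτ A d b c b' c', ← e', ← Module.End.mul_apply (ρ _) (ρ _), ← map_mul,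
    ← map_mul, mul_inv_cancel_left]

theorem opT_eq_finsum (hτ : IsParabolicMap ρ τ)
    {f : GL (Fin 3) F → W} (hf : IsEquivariant hϖ ρ f) (g : GL (Fin 3) F)
    {X : Type*} (e : X ≃ GL (Fin 3) 𝓀[F] ⧸ parUp 𝓀[F]) (x : X → GL (Fin 3) 𝒪[F])
    (hx : ∀ i, (redGL F (x i) : GL (Fin 3) 𝓀[F] ⧸ parUp 𝓀[F]) = e i) :
    opT hϖ ρ τ f g = ∑ᶠ i, opTerm hϖ ρ τ f g (x i) := by
  rw [opT, ← finsum_comp_equiv e]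
  exact finsum_congr fun i => opTerm_congr hτ hf g (by rw [redGL_cosetLift, hx])

theorem isEquivariant_opT (hτ : IsParabolicMap ρ τ)
    {f : GL (Fin 3) F → W} (hf : IsEquivariant hϖ ρ f) : IsEquivariant hϖ ρ (opT hϖ ρ τ f) := by
  constructor
  · intro A g
    -- Left translation by `A` only permutes the cosets, and independence of representatives allows
    -- the translated lifts.
    rw [opT_eq_finsum hτ hf g (MulAction.toPerm (redGL F A)⁻¹) (fun q => A⁻¹ * cosetLift q)]
    · rw [opT]
      change _ = (ρ (redGL F A)).toAddMonoidHom _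
      rw [AddMonoidHom.map_finsum _ (Set.toFinite _)]
      refine finsum_congr fun q => ?_
      change _ = ρ (redGL F A) _
      rw [opTerm, opTerm, ← Module.End.mul_apply (ρ _) (ρ _), ← map_mul, ← map_mul, mul_inv_cancel_left,
        map_mul, map_inv]
      congr 3
      group
    · intro q
      rw [map_mul, map_inv]
      exact congrArg (fun r => (redGL F A)⁻¹ • r) (redGL_cosetLift q)
  · intro n g
    refine finsum_congr fun q => ?_
    rw [opTerm, opTerm, ← hf.2 n (sMat hϖ * (inclGL F (cosetLift q))⁻¹ * g), ← mul_assoc,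
      ← mul_assoc (scalarUnif hϖ ^ n), scalarUnif_zpow_comm]

/-- The operator acts from the left of the argument, so it commutes with right translation: this is
its `G`-equivariance. -/
theorem opT_comp_mul_right (f : GL (Fin 3) F → W) (h g : GL (Fin 3) F) :
    opT hϖ ρ τ (fun x => f (x * h)) g = opT hϖ ρ τ f (g * h) :=
  finsum_congr fun q => by rw [opTerm, opTerm, mul_assoc]

theorem opT_smul (c : C) (f : GL (Fin 3) F → W) (g : GL (Fin 3) F) :
    opT hϖ ρ τ (c • f) g = c • opT hϖ ρ τ f g := by
  rw [opT, opT, smul_finsum' c (Set.toFinite _)]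
  exact finsum_congr fun q => by simp [opTerm]

theorem opT_add (f f' : GL (Fin 3) F → W) (g : GL (Fin 3) F) :
    opT hϖ ρ τ (f + f') g = opT hϖ ρ τ f g + opT hϖ ρ τ f' g := by
  rw [opT, opT, opT, ← finsum_add_distrib (Set.toFinite _) (Set.toFinite _)]
  exact finsum_congr fun q => by simp [opTerm]

end Operator

end GL3

/-! ## The standard functions -/

namespace GL3
open ValuativeRel (valuation ValueGroupWithZero)

/-! ### Upper triangular matrices acting on a `U`-fixed vector -/

section UpperTriangular

variable {k C W : Type*} [Field k] [Field C] [AddCommGroup W] [Module C W]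
  {ρ : Representation C (GL (Fin 3) k) W}

theorem upperTri_diag_ne_zero {g : GL (Fin 3) k} (hg : g ∈ upperTri k) (i : Fin 3) :
    g.1 i i ≠ 0 := by
  intro h
  have := upperTri_mul_diag hg ((upperTri k).inv_mem hg) i
  rw [mul_inv_cancel, h, zero_mul] at this
  simp at this

theorem exists_eq_dg_mul_up {g : GL (Fin 3) k} (hg : g ∈ upperTri k) :
    ∃ a b c, g = dg (Units.mk0 _ (upperTri_diag_ne_zero hg 0))
      (Units.mk0 _ (upperTri_diag_ne_zero hg 1)) (Units.mk0 _ (upperTri_diag_ne_zero hg 2)) *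
        up a b c := by
  have h0 := upperTri_diag_ne_zero hg 0
  have h1 := upperTri_diag_ne_zero hg 1
  have h10 := hg 1 0 (by decide)
  have h20 := hg 2 0 (by decide)
  have h21 := hg 2 1 (by decide)
  refine ⟨g.1 0 1 / g.1 0 0, g.1 0 2 / g.1 0 0, g.1 1 2 / g.1 1 1, ?_⟩
  apply ext_fin_three <;> simp [dg_val, up_val, h0, h1, h10, h20, h21, mul_div_cancel₀]

theorem up_mem_upperTri (a b c : k) : up a b c ∈ upperTri k := (up_mem_upperUnip a b c).1

theorem dg_mem_upperTri (x y z : kˣ) : dg x y z ∈ upperTri k := by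
  intro i j h
  fin_cases i <;> fin_cases j <;> simp [dg_val] at h ⊢

theorem UFixed.apply_eq_of_diag_eq {v : W} (hv : UFixed ρ v) {g g' : GL (Fin 3) k}
    (hg : g ∈ upperTri k) (hg' : g' ∈ upperTri k) (h : ∀ i, g.1 i i = g'.1 i i) :
    ρ g v = ρ g' v := by
  obtain ⟨a, b, c, e⟩ := exists_eq_dg_mul_up hg
  obtain ⟨a', b', c', e'⟩ := exists_eq_dg_mul_up hg'
  rw [e, e', map_mul, map_mul, Module.End.mul_apply, Module.End.mul_apply, hv, hv]
  simp only [h]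

theorem TEigen.exists_smul {v : W} (ht : TEigen ρ v) (hv : UFixed ρ v) {g : GL (Fin 3) k}
    (hg : g ∈ upperTri k) : ∃ c : C, ρ g v = c • v := by
  obtain ⟨a, b, c, e⟩ := exists_eq_dg_mul_up hg
  rw [e, map_mul, Module.End.mul_apply, hv]
  exact ht _ _ _

end UpperTriangular

theorem mul_eq_mul_of_central {G : Type*} [Group G] {a a' z z' t b b' : G}
    (hz' : ∀ g, z' * g = g * z') (e : a * z * t * b = a' * z' * t * b') :
    a'⁻¹ * a * (z * z'⁻¹) * t = t * (b' * b⁻¹) := by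
  have h1 : z'⁻¹ * t = t * z'⁻¹ := by
    rw [inv_mul_eq_iff_eq_mul, ← mul_assoc, hz', mul_inv_cancel_right]
  calc a'⁻¹ * a * (z * z'⁻¹) * t = a'⁻¹ * a * z * (z'⁻¹ * t) := by group
    _ = a'⁻¹ * (a * z * t * b) * b⁻¹ * z'⁻¹ := by rw [h1]; group
    _ = z' * (t * (b' * b⁻¹)) * z'⁻¹ := by rw [e]; group
    _ = t * (b' * b⁻¹) := by rw [hz', mul_inv_cancel_right]

/-! ### The double cosets `K Z t_b I` and the functions on them -/

section Standard

variable {F : Type*} [Field F] [ValuativeRel F] [TopologicalSpace F] [IsNonarchimedeanLocalField F]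
  {ϖ : 𝒪[F]} (hϖ : Irreducible ϖ)

theorem diagT_eq_dg (a b : ℤ) : diagT hϖ a b = dg (unif hϖ ^ a) (unif hϖ ^ b) 1 := by
  apply ext_fin_three <;> simp [diagT, dg_val, unif]

theorem scalarUnif_zpow_eq_dg (n : ℤ) :
    scalarUnif hϖ ^ n = dg (unif hϖ ^ n) (unif hϖ ^ n) (unif hϖ ^ n) := by
  have h : ∀ x : Fˣ, Matrix.GeneralLinearGroup.scalar (Fin 3) x = dg x x x := fun x => by
    apply ext_fin_three <;> simp [dg_val]
  rw [scalarUnif, ← map_zpow, h]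

theorem val_unif_zpow_le_one_iff {n : ℤ} : valuation F ((unif hϖ ^ n : Fˣ) : F) ≤ 1 ↔ 0 ≤ n := by
  rw [Units.val_zpow_eq_zpow_val, map_zpow₀]
  exact zpow_le_one_iff_right_of_lt_one₀ (val_unif_pos hϖ) (val_unif_lt_one hϖ)

theorem val_unif_zpow_eq_one_iff {n : ℤ} : valuation F ((unif hϖ ^ n : Fˣ) : F) = 1 ↔ n = 0 := by
  rw [Units.val_zpow_eq_zpow_val, map_zpow₀]
  exact zpow_eq_one_iff_right₀ (val_unif_pos hϖ).le (val_unif_lt_one hϖ).ne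

theorem val_det_dg (x y z : Fˣ) : valuation F (dg x y z).1.det =
    valuation F ((x * y * z : Fˣ) : F) := by
  rw [dg_val, Matrix.det_fin_three]
  simp

theorem exists_iwahoriZ {i : GL (Fin 3) F} (hi : i ∈ iwahoriZ F) :
    ∃ (B : GL (Fin 3) 𝒪[F]) (n : ℤ), redGL F B ∈ upperTri 𝓀[F] ∧
      i = inclGL F B * scalarUnif hϖ ^ n := by
  obtain ⟨_, ⟨B, hB, rfl⟩, z, hz, e⟩ := Subgroup.mem_sup_of_normal_right.1 hi
  rw [Matrix.GeneralLinearGroup.center_eq_range_scalar] at hz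
  obtain ⟨x, rfl⟩ := hz
  obtain ⟨u, n, rfl⟩ := exists_unit_mul_zpow hϖ x
  refine ⟨B * dg u u u, n, ?_, ?_⟩
  · rw [map_mul]
    refine (upperTri _).mul_mem hB ?_
    rw [map_dg]
    exact dg_mem_upperTri _ _ _
  · rw [← e, map_mul, map_zpow, map_mul, ← mul_assoc]
    congr 2
    apply ext_fin_three <;> simp [dg_val]

theorem exists_maxCompactZ {g : GL (Fin 3) F} (hg : g ∈ maxCompactZ F) :
    ∃ (A : GL (Fin 3) 𝒪[F]) (n : ℤ), g = inclGL F A * scalarUnif hϖ ^ n := by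
  obtain ⟨⟨_, A, rfl⟩, n, h⟩ := exists_decomp hϖ ⟨g, hg⟩
  exact ⟨A, n, h⟩

variable {hϖ} in
/-- Conjugation by `t_b`, for weakly dominant `b`, preserves the Iwahori subgroup modulo its
intersection with `K`, and the diagonal entries. -/
theorem upperTri_of_conj {b₁ b₂ : ℤ} (h12 : b₁ ≤ b₂) (h2 : b₂ ≤ 0) {A B : GL (Fin 3) 𝒪[F]} {n : ℤ}
    (hB : redGL F B ∈ upperTri 𝓀[F])
    (h : inclGL F A * scalarUnif hϖ ^ n * diagT hϖ b₁ b₂ = diagT hϖ b₁ b₂ * inclGL F B) :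
    redGL F A ∈ upperTri 𝓀[F] ∧ ∀ i, (redGL F A).1 i i = (redGL F B).1 i i := by
  -- The determinants of `A` and `B` are units, so the scalar has determinant of valuation `1`.
  have hn : n = 0 := by
    have hd := congrArg (fun g : GL (Fin 3) F => valuation F g.1.det) h
    simp only [Units.val_mul, Matrix.det_mul, map_mul, val_det_inclGL, one_mul, mul_one] at hd
    have ht : valuation F (diagT hϖ b₁ b₂).1.det ≠ 0 :=
      (Valuation.ne_zero_iff _).2 (Matrix.isUnits_det_units _).ne_zero
    have hd' := mul_eq_right₀ ht |>.1 hd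
    rw [scalarUnif_zpow_eq_dg, val_det_dg, ← zpow_add, ← zpow_add, val_unif_zpow_eq_one_iff] at hd'
    omega
  subst hn
  rw [zpow_zero, mul_one, diagT_eq_dg] at h
  have he : ∀ i j, (inclGL F A).1 i j * (![unif hϖ ^ b₁, unif hϖ ^ b₂, 1] j : Fˣ) =
      (![unif hϖ ^ b₁, unif hϖ ^ b₂, 1] i : Fˣ) * (inclGL F B).1 i j := fun i j => by
    rw [← mul_dg_apply, ← dg_mul_apply, h]
  -- Entries of `A` below the diagonal are those of `B` times `ϖ ^ m`, with `m` one of `b₂ - b₁`,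
  -- `-b₁`, `-b₂`; the inequalities on `b` make these exponents nonnegative.
  have hlow : ∀ i j (m : ℤ), 0 ≤ m → ![unif hϖ ^ b₁, unif hϖ ^ b₂, 1] i =
      ![unif hϖ ^ b₁, unif hϖ ^ b₂, 1] j * unif hϖ ^ m → (redGL F B).1 i j = 0 →
      (redGL F A).1 i j = 0 := by
    intro i j m hm e h0
    rw [redGL_apply, residue_eq_zero_iff_val] at h0 ⊢
    have h1 : ((A.1 i j : 𝒪[F]) : F) = ((unif hϖ ^ m : Fˣ) : F) * ((B.1 i j : 𝒪[F]) : F) := by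
      have h2 := he i j
      rw [e, Units.val_mul, mul_assoc, mul_comm] at h2
      exact mul_left_cancel₀ (Units.ne_zero _) h2
    rw [h1, map_mul]
    exact mul_lt_one_of_nonneg_of_lt_one_right ((val_unif_zpow_le_one_iff hϖ).2 hm) zero_le h0
  refine ⟨fun i j hij => ?_, fun i => ?_⟩
  · have h0 := hB i j hij
    fin_cases i <;> fin_cases j <;> simp only [Fin.reduceFinMk, Fin.isValue] at hij h0 ⊢ <;>
      first
      | exact absurd hij (by decide)
      | skip
    · exact hlow 1 0 (b₂ - b₁) (by omega) (by simp [← zpow_add]) h0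
    · exact hlow 2 0 (-b₁) (by omega) (by simp) h0
    · exact hlow 2 1 (-b₂) (by omega) (by simp) h0
  · rw [redGL_apply, redGL_apply]
    congr 1
    have h2 := he i i
    rw [mul_comm] at h2
    exact Subtype.ext (mul_left_cancel₀ (Units.ne_zero _) h2)

variable {C W : Type*} [Field C] [AddCommGroup W] [Module C W]
  (ρ : Representation C (GL (Fin 3) 𝓀[F]) W)

/-- The presentations of an element of `K Z t_b I`. -/
def IsPresentation (b₁ b₂ : ℤ) (g : GL (Fin 3) F) (A : GL (Fin 3) 𝒪[F]) (n : ℤ)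
    (B : GL (Fin 3) 𝒪[F]) : Prop :=
  redGL F B ∈ upperTri 𝓀[F] ∧ g = inclGL F A * scalarUnif hϖ ^ n * diagT hϖ b₁ b₂ * inclGL F B

open scoped Classical in
/-- The function supported on `K Z t_b I` which is given there by `k t_b i ↦ k i v`. -/
noncomputable def stdFun (v : W) (b₁ b₂ : ℤ) (g : GL (Fin 3) F) : W :=
  if h : ∃ t : GL (Fin 3) 𝒪[F] × ℤ × GL (Fin 3) 𝒪[F],
      IsPresentation hϖ b₁ b₂ g t.1 t.2.1 t.2.2 then
    ρ (redGL F h.choose.1) (ρ (redGL F h.choose.2.2) v) else 0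

variable {hϖ ρ} {v : W} {b₁ b₂ : ℤ}

theorem exists_presentation_of_stdFun_ne_zero {g : GL (Fin 3) F}
    (h : stdFun hϖ ρ v b₁ b₂ g ≠ 0) : ∃ A n B, IsPresentation hϖ b₁ b₂ g A n B := by
  by_contra h'
  refine h (dif_neg ?_)
  rintro ⟨⟨A, n, B⟩, ht⟩
  exact h' ⟨A, n, B, ht⟩

theorem IsPresentation.mul_left {g : GL (Fin 3) F} {A B : GL (Fin 3) 𝒪[F]} {n : ℤ}
    (h : IsPresentation hϖ b₁ b₂ g A n B) (A' : GL (Fin 3) 𝒪[F]) :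
    IsPresentation hϖ b₁ b₂ (inclGL F A' * g) (A' * A) n B :=
  ⟨h.1, by rw [h.2, map_mul]; simp only [mul_assoc]⟩

theorem IsPresentation.scalar_mul {g : GL (Fin 3) F} {A B : GL (Fin 3) 𝒪[F]} {n : ℤ}
    (h : IsPresentation hϖ b₁ b₂ g A n B) (m : ℤ) :
    IsPresentation hϖ b₁ b₂ (scalarUnif hϖ ^ m * g) A (m + n) B :=
  ⟨h.1, by
    rw [h.2, zpow_add]
    simp only [← mul_assoc]
    rw [scalarUnif_zpow_comm]⟩

theorem IsPresentation.mul_right {g : GL (Fin 3) F} {A B : GL (Fin 3) 𝒪[F]} {n : ℤ}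
    (h : IsPresentation hϖ b₁ b₂ g A n B) {B' : GL (Fin 3) 𝒪[F]}
    (hB' : redGL F B' ∈ upperTri 𝓀[F]) :
    IsPresentation hϖ b₁ b₂ (g * inclGL F B') A n (B * B') :=
  ⟨by rw [map_mul]; exact (upperTri _).mul_mem h.1 hB', by rw [h.2, map_mul]; simp only [mul_assoc]⟩

variable (hv : UFixed ρ v) (ht : TEigen ρ v) (h12 : b₁ ≤ b₂) (h2 : b₂ ≤ 0)

-- This makes the choice in `stdFun` harmless. Two presentations differ by an element of `I` and its
-- conjugate under `t_b`; both are upper triangular modulo `ϖ` with the same diagonal, hence act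
-- alike on the line of `v`.
include hv ht h12 h2 in
theorem IsPresentation.apply_unique {g : GL (Fin 3) F} {A B A' B' : GL (Fin 3) 𝒪[F]} {n n' : ℤ}
    (h : IsPresentation hϖ b₁ b₂ g A n B) (h' : IsPresentation hϖ b₁ b₂ g A' n' B') :
    ρ (redGL F A) (ρ (redGL F B) v) = ρ (redGL F A') (ρ (redGL F B') v) := by
  have hB : redGL F (B' * B⁻¹) ∈ upperTri 𝓀[F] := by
    rw [map_mul, map_inv]; exact (upperTri _).mul_mem h'.1 ((upperTri _).inv_mem h.1)
  obtain ⟨h1, hd⟩ := upperTri_of_conj (hϖ := hϖ) (A := A'⁻¹ * A) (n := n - n') h12 h2 hB (by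
    rw [zpow_sub, map_mul, map_mul, map_inv, map_inv]
    exact mul_eq_mul_of_central (fun g => scalarUnif_zpow_comm hϖ n' g) (h.2.symm.trans h'.2))
  have key := hv.apply_eq_of_diag_eq h1 hB hd
  obtain ⟨c, hc⟩ := ht.exists_smul hv h.1
  have e1 : redGL F A = redGL F A' * redGL F (A'⁻¹ * A) := by
    rw [map_mul, map_inv, mul_inv_cancel_left]
  have e2 : redGL F B' = redGL F (B' * B⁻¹) * redGL F B := by
    rw [← map_mul, inv_mul_cancel_right]
  rw [e1, e2, map_mul ρ (redGL F A'), map_mul ρ (redGL F (B' * B⁻¹)), Module.End.mul_apply,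
    Module.End.mul_apply, hc, map_smul, map_smul,
    map_smul, map_smul, key]

include hv ht h12 h2 in
theorem stdFun_eq {g : GL (Fin 3) F} {A B : GL (Fin 3) 𝒪[F]} {n : ℤ}
    (h : IsPresentation hϖ b₁ b₂ g A n B) :
    stdFun hϖ ρ v b₁ b₂ g = ρ (redGL F A) (ρ (redGL F B) v) := by
  have h' : ∃ t : GL (Fin 3) 𝒪[F] × ℤ × GL (Fin 3) 𝒪[F],
      IsPresentation hϖ b₁ b₂ g t.1 t.2.1 t.2.2 := ⟨(A, n, B), h⟩
  rw [stdFun, dif_pos h']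
  exact IsPresentation.apply_unique hv ht h12 h2 h'.choose_spec h

include hv ht h12 h2 in
theorem isEquivariant_stdFun : IsEquivariant hϖ ρ (stdFun hϖ ρ v b₁ b₂) := by
  constructor
  · intro A g
    by_cases h : ∃ A n B, IsPresentation hϖ b₁ b₂ g A n B
    · obtain ⟨A', n, B, h⟩ := h
      rw [stdFun_eq hv ht h12 h2 h, stdFun_eq hv ht h12 h2 (h.mul_left A), map_mul, map_mul,
        Module.End.mul_apply]
    · have h1 : stdFun hϖ ρ v b₁ b₂ g = 0 := by
        by_contra h0; exact h (exists_presentation_of_stdFun_ne_zero h0)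
      rw [h1, map_zero]
      by_contra h0
      obtain ⟨A', n, B, h'⟩ := exists_presentation_of_stdFun_ne_zero h0
      refine h ⟨A⁻¹ * A', n, B, ?_⟩
      have := h'.mul_left A⁻¹
      rwa [map_inv, inv_mul_cancel_left] at this
  · intro m g
    by_cases h : ∃ A n B, IsPresentation hϖ b₁ b₂ g A n B
    · obtain ⟨A', n, B, h⟩ := h
      rw [stdFun_eq hv ht h12 h2 h, stdFun_eq hv ht h12 h2 (h.scalar_mul m)]
    · have h1 : stdFun hϖ ρ v b₁ b₂ g = 0 := by
        by_contra h0; exact h (exists_presentation_of_stdFun_ne_zero h0)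
      rw [h1]
      by_contra h0
      obtain ⟨A', n, B, h'⟩ := exists_presentation_of_stdFun_ne_zero h0
      refine h ⟨A', -m + n, B, ?_⟩
      have := h'.scalar_mul (-m)
      rwa [← mul_assoc, ← zpow_add, neg_add_cancel, zpow_zero, one_mul] at this

include hv ht h12 h2 in
theorem stdFun_mul_right {B : GL (Fin 3) 𝒪[F]} (hB : redGL F B ∈ upperTri 𝓀[F]) {c : C}
    (hc : ρ (redGL F B) v = c • v) (g : GL (Fin 3) F) :
    stdFun hϖ ρ v b₁ b₂ (g * inclGL F B) = c • stdFun hϖ ρ v b₁ b₂ g := by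
  by_cases h : ∃ A n B, IsPresentation hϖ b₁ b₂ g A n B
  · obtain ⟨A', n, B', h⟩ := h
    rw [stdFun_eq hv ht h12 h2 h, stdFun_eq hv ht h12 h2 (h.mul_right hB), map_mul, map_mul,
      Module.End.mul_apply, hc, map_smul, map_smul]
  · have h1 : stdFun hϖ ρ v b₁ b₂ g = 0 := by
      by_contra h0; exact h (exists_presentation_of_stdFun_ne_zero h0)
    rw [h1, smul_zero]
    by_contra h0
    obtain ⟨A', n, B', h'⟩ := exists_presentation_of_stdFun_ne_zero h0
    refine h ⟨A', n, B' * B⁻¹, ?_⟩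
    have := h'.mul_right (B' := B⁻¹) (by rw [map_inv]; exact (upperTri _).inv_mem hB)
    rwa [map_inv, mul_inv_cancel_right] at this

theorem isPresentation_diagT : IsPresentation hϖ b₁ b₂ (diagT hϖ b₁ b₂) 1 0 1 :=
  ⟨by rw [map_one]; exact (upperTri _).one_mem, by simp⟩

include hv ht h12 h2 in
theorem stdFun_diagT : stdFun hϖ ρ v b₁ b₂ (diagT hϖ b₁ b₂) = v := by
  rw [stdFun_eq hv ht h12 h2 isPresentation_diagT]
  simp

/-- An Iwahori matrix has unit diagonal entries, so integrality of the diagonal of `A` gives an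
inequality for each exponent; comparing determinants makes all three equalities. -/
theorem eq_of_isPresentation_dg {x y w : ℤ} {A B : GL (Fin 3) 𝒪[F]} {n : ℤ}
    (h : IsPresentation hϖ b₁ b₂ (dg (unif hϖ ^ x) (unif hϖ ^ y) (unif hϖ ^ w)) A n B) :
    x - w = b₁ ∧ y - w = b₂ := by
  have hC : redGL F B⁻¹ ∈ upperTri 𝓀[F] := by
    rw [map_inv]; exact (upperTri _).inv_mem h.1
  have e : inclGL F A * dg (unif hϖ ^ (n + b₁)) (unif hϖ ^ (n + b₂)) (unif hϖ ^ n) =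
      dg (unif hϖ ^ x) (unif hϖ ^ y) (unif hϖ ^ w) * inclGL F B⁻¹ := by
    rw [h.2, map_inv, mul_inv_cancel_right, scalarUnif_zpow_eq_dg, diagT_eq_dg, mul_assoc,
      dg_mul_dg, zpow_add, zpow_add, mul_one]
  have hdet : n + b₁ + (n + b₂) + n = x + y + w := by
    have hd := congrArg (fun g : GL (Fin 3) F => valuation F g.1.det) e
    simp only [Units.val_mul, Matrix.det_mul, map_mul, val_det_inclGL, one_mul, mul_one] at hd
    rw [val_det_dg, val_det_dg, ← zpow_add, ← zpow_add, ← zpow_add, ← zpow_add,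
      Units.val_zpow_eq_zpow_val, Units.val_zpow_eq_zpow_val, map_zpow₀, map_zpow₀] at hd
    exact zpow_right_injective₀ (val_unif_pos hϖ) (val_unif_lt_one hϖ).ne hd
  have key : ∀ (i : Fin 3) (l m : ℤ),
      ![unif hϖ ^ (n + b₁), unif hϖ ^ (n + b₂), unif hϖ ^ n] i = unif hϖ ^ l →
      ![unif hϖ ^ x, unif hϖ ^ y, unif hϖ ^ w] i = unif hϖ ^ m → 0 ≤ m - l := by
    intro i l m hl hm
    have h1 : (inclGL F A).1 i i * (unif hϖ ^ l : Fˣ) = (unif hϖ ^ m : Fˣ) * (inclGL F B⁻¹).1 i i := by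
      rw [← hl, ← hm, ← mul_dg_apply, ← dg_mul_apply, e]
    have h2 : valuation F ((inclGL F B⁻¹).1 i i) = 1 := by
      refine le_antisymm (val_le_one _) (not_lt.1 fun h2 => ?_)
      exact upperTri_diag_ne_zero hC i ((residue_eq_zero_iff_val _).2 h2)
    rw [← val_unif_zpow_le_one_iff hϖ]
    have h3 : ((unif hϖ ^ (m - l) : Fˣ) : F) * (inclGL F B⁻¹).1 i i = (inclGL F A).1 i i := by
      rw [zpow_sub, Units.val_mul, mul_right_comm, ← h1, mul_assoc, Units.mul_inv, mul_one]
    have h4 : valuation F ((unif hϖ ^ (m - l) : Fˣ) : F) = valuation F ((inclGL F A).1 i i) := by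
      rw [← h3, map_mul, h2, mul_one]
    rw [h4]
    exact val_le_one _
  have k0 := key 0 _ _ rfl rfl
  have k1 := key 1 _ _ rfl rfl
  have k2 := key 2 _ _ rfl rfl
  omega

include hv ht h12 h2 in
theorem stdFun_dg (x y w : ℤ) :
    stdFun hϖ ρ v b₁ b₂ (dg (unif hϖ ^ x) (unif hϖ ^ y) (unif hϖ ^ w)) =
      if x - w = b₁ ∧ y - w = b₂ then v else 0 := by
  split_ifs with h
  · have e : dg (unif hϖ ^ x) (unif hϖ ^ y) (unif hϖ ^ w) = scalarUnif hϖ ^ w * diagT hϖ b₁ b₂ := by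
      rw [scalarUnif_zpow_eq_dg, diagT_eq_dg, dg_mul_dg, ← zpow_add, ← zpow_add, mul_one, ← h.1,
        ← h.2, add_sub_cancel, add_sub_cancel]
    rw [e, (isEquivariant_stdFun hv ht h12 h2).2, stdFun_diagT hv ht h12 h2]
  · by_contra h0
    obtain ⟨A, n, B, h'⟩ := exists_presentation_of_stdFun_ne_zero h0
    exact h (eq_of_isPresentation_dg h')

end Standard

end GL3

namespace GL3
open ValuativeRel (valuation ValueGroupWithZero)

/-! ### The Hecke operator on standard functions -/

section Image

variable {F : Type*} [Field F] [ValuativeRel F] [TopologicalSpace F] [IsNonarchimedeanLocalField F]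
  {ϖ : 𝒪[F]} {hϖ : Irreducible ϖ}

theorem exists_coe_eq_unif_zpow_mul {m : ℤ} (hm : 0 ≤ m) (a : 𝒪[F]) :
    ∃ a' : 𝒪[F], (a' : F) = ((unif hϖ ^ m : Fˣ) : F) * (a : F) :=
  ⟨⟨((unif hϖ ^ m : Fˣ) : F) * (a : F), by
    change valuation F _ ≤ 1
    rw [map_mul]
    exact mul_le_one' ((val_unif_zpow_le_one_iff hϖ).2 hm) (val_le_one a)⟩, rfl⟩

/-- For `b₁ ≤ b₂ ≤ 0`, conjugation by `t_b⁻¹` multiplies the upper entries by nonnegative powers of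
`ϖ`. -/
theorem up_mul_diagT {b₁ b₂ : ℤ} (h12 : b₁ ≤ b₂) (h2 : b₂ ≤ 0) (x y z : 𝒪[F]) :
    ∃ x' y' z' : 𝒪[F], inclGL F (up x y z) * diagT hϖ b₁ b₂ =
      diagT hϖ b₁ b₂ * inclGL F (up x' y' z') := by
  obtain ⟨x', hx⟩ := exists_coe_eq_unif_zpow_mul (hϖ := hϖ) (m := b₂ - b₁) (by omega) x
  obtain ⟨y', hy⟩ := exists_coe_eq_unif_zpow_mul (hϖ := hϖ) (m := -b₁) (by omega) y
  obtain ⟨z', hz⟩ := exists_coe_eq_unif_zpow_mul (hϖ := hϖ) (m := -b₂) (by omega) z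
  refine ⟨x', y', z', ?_⟩
  have h := (unif hϖ).ne_zero
  rw [inclGL, map_up, map_up, diagT_eq_dg]
  have hx' : algebraMap 𝒪[F] F x' = _ := hx
  have hy' : algebraMap 𝒪[F] F y' = _ := hy
  have hz' : algebraMap 𝒪[F] F z' = _ := hz
  have e : ∀ a : 𝒪[F], algebraMap 𝒪[F] F a = (a : F) := fun a => rfl
  rw [dg_mul_up, hx', hy', hz']
  congr 2
  · have h₁ := zpow_ne_zero b₁ h
    have h₂ := zpow_ne_zero b₂ h
    simp only [e, zpow_sub, Units.val_mul, Units.val_inv_eq_inv_val,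
      Units.val_zpow_eq_zpow_val]
    field_simp
  · simp only [e, zpow_neg, Units.val_inv_eq_inv_val, Units.val_zpow_eq_zpow_val, inv_one,
      Units.val_one, mul_one]
    rw [mul_inv_cancel_left₀ (zpow_ne_zero _ h)]
  · simp only [e, zpow_neg, Units.val_inv_eq_inv_val, Units.val_zpow_eq_zpow_val, inv_one,
      Units.val_one, mul_one]
    rw [mul_inv_cancel_left₀ (zpow_ne_zero _ h)]

theorem map_bruhatRep {R S : Type*} [CommRing R] [CommRing S] (f : R →+* S)
    (i : Unit ⊕ R ⊕ R × R) : Matrix.GeneralLinearGroup.map f (bruhatRep i) =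
      bruhatRep (Sum.map id (Sum.map f (Prod.map f f)) i) := by
  rcases i with i | y | ⟨y, z⟩ <;> simp [bruhatRep, map_up, map_s₁, map_s₂]

variable {C W : Type*} [Field C] [AddCommGroup W] [Module C W]
  {ρ : Representation C (GL (Fin 3) 𝓀[F]) W} {τ : W →ₗ[C] W} {v : W} {b₁ b₂ c₁ c₂ : ℤ}
  (hτ : IsParabolicMap ρ τ) (hv : UFixed ρ v) (ht : TEigen ρ v)

theorem sMat_mul_s₂ : sMat hϖ * inclGL F (s₂ _) =
    inclGL F (s₂ _) * dg (unif hϖ) 1 (unif hϖ) := by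
  rw [inclGL, map_s₂, sMat, dg_mul_s₂]

theorem sMat_mul_s₂_mul_s₁ : sMat hϖ * inclGL F (s₂ _ * s₁ _) =
    inclGL F (s₂ _ * s₁ _) * dg 1 (unif hϖ) (unif hϖ) := by
  rw [inclGL, map_mul, map_s₂, map_s₁, sMat, ← mul_assoc, dg_mul_s₂, mul_assoc, dg_mul_s₁, mul_assoc]

theorem sMat_inv_mul_s₂ : (sMat hϖ)⁻¹ * inclGL F (s₂ _) =
    inclGL F (s₂ _) * dg (unif hϖ)⁻¹ 1 (unif hϖ)⁻¹ := by
  rw [inclGL, map_s₂, sMat, dg_inv, dg_mul_s₂, inv_one]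

theorem sMat_inv_mul_s₂_mul_s₁ : (sMat hϖ)⁻¹ * inclGL F (s₂ _ * s₁ _) =
    inclGL F (s₂ _ * s₁ _) * dg 1 (unif hϖ)⁻¹ (unif hϖ)⁻¹ := by
  rw [inclGL, map_mul, map_s₂, map_s₁, sMat, dg_inv, ← mul_assoc, dg_mul_s₂, mul_assoc, dg_mul_s₁,
    mul_assoc, inv_one]

include hv ht in
theorem stdFun_mul_up (h12 : c₁ ≤ c₂) (h2 : c₂ ≤ 0) (x y z : 𝒪[F]) (g : GL (Fin 3) F) :
    stdFun hϖ ρ v c₁ c₂ (g * inclGL F (up x y z)) = stdFun hϖ ρ v c₁ c₂ g := by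
  have h : redGL F (up x y z) = up _ _ _ := map_up _ _ _ _
  rw [stdFun_mul_right hv ht h12 h2 (c := 1) (by rw [h]; exact up_mem_upperTri _ _ _)
    (by rw [h, hv, one_smul]), one_smul]

include hv ht in
/-- A summand of the Hecke operator at `t_b`, for an element of a Bruhat cell. -/
theorem opTerm_stdFun_diagT (hb12 : b₁ ≤ b₂) (hb2 : b₂ ≤ 0) (h12 : c₁ ≤ c₂) (h2 : c₂ ≤ 0)
    (x y z : 𝒪[F]) (w : GL (Fin 3) 𝒪[F]) {l m n : ℤ}
    (hw : sMat hϖ * inclGL F w⁻¹ = inclGL F w⁻¹ * dg (unif hϖ ^ l) (unif hϖ ^ m) (unif hϖ ^ n)) :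
    opTerm hϖ ρ τ (stdFun hϖ ρ v c₁ c₂) (diagT hϖ b₁ b₂) (up x y z * w) =
      ρ (redGL F (up x y z * w)) (τ (ρ (redGL F w⁻¹)
        (if l + b₁ - n = c₁ ∧ m + b₂ - n = c₂ then v else 0))) := by
  obtain ⟨x', y', z', h⟩ := up_mul_diagT (hϖ := hϖ) hb12 hb2 (-x) (x * z - y) (-z)
  rw [← up_inv, map_inv] at h
  have e : sMat hϖ * (inclGL F (up x y z * w))⁻¹ * diagT hϖ b₁ b₂ =
      inclGL F w⁻¹ * (dg (unif hϖ ^ (l + b₁)) (unif hϖ ^ (m + b₂)) (unif hϖ ^ n) *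
        inclGL F (up x' y' z')) := by
    rw [map_mul, mul_inv_rev, mul_assoc, mul_assoc, h, ← mul_assoc, ← mul_assoc, ← map_inv, hw,
      diagT_eq_dg, mul_assoc (inclGL F w⁻¹), dg_mul_dg, zpow_add, zpow_add, mul_one, mul_assoc]
  rw [opTerm, e, (isEquivariant_stdFun hv ht h12 h2).1, stdFun_mul_up hv ht h12 h2,
    stdFun_dg hv ht h12 h2]

variable [Fintype 𝓀[F]]

-- The sum splits over the three Bruhat cells. On each, the unipotent part passes through `t_b` and
-- is absorbed by invariance, so all terms involve one vector. The trivial cell gives the stated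
-- value, and the others are either termwise zero or exactly the vanishing sums `hs₂` and `hs₁`.
include hτ hv ht in
theorem opT_stdFun_diagT (hτv : τ v = v)
    (hs₂ : ∑ y : 𝓀[F], ρ (up 0 0 y * s₂ _) (τ (ρ (s₂ _) v)) = 0)
    (hs₁ : ∑ y : 𝓀[F], ∑ z : 𝓀[F], ρ (up y z 0 * (s₁ _ * s₂ _)) (τ (ρ (s₂ _ * s₁ _) v)) = 0)
    (hb12 : b₁ ≤ b₂) (hb2 : b₂ ≤ 0) (h12 : c₁ ≤ c₂) (h2 : c₂ ≤ 0) :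
    opT hϖ ρ τ (stdFun hϖ ρ v c₁ c₂) (diagT hϖ b₁ b₂) =
      if 1 + b₁ = c₁ ∧ 1 + b₂ = c₂ then v else 0 := by
  have hr : ∀ y : 𝓀[F], IsLocalRing.residue 𝒪[F] (Function.surjInv IsLocalRing.residue_surjective y)
      = y := Function.surjInv_eq _
  set r : 𝓀[F] → 𝒪[F] := Function.surjInv IsLocalRing.residue_surjective
  let x : Unit ⊕ 𝓀[F] ⊕ 𝓀[F] × 𝓀[F] → GL (Fin 3) 𝒪[F] := fun i =>
    bruhatRep (Sum.map id (Sum.map r (Prod.map r r)) i)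
  have hx : ∀ i, redGL F (x i) = bruhatRep i := by
    intro i
    rw [redGL, map_bruhatRep]
    rcases i with i | y | ⟨y, z⟩ <;> simp [hr]
  rw [opT_eq_finsum hτ (isEquivariant_stdFun hv ht h12 h2) _ (Equiv.ofBijective _ bruhatRep_bijective)
    x (fun i => by rw [hx]; rfl), finsum_eq_sum_of_fintype, Fintype.sum_sum_type,
    Fintype.sum_sum_type, Fintype.sum_prod_type]
  have e₀ : ∑ i : Unit, opTerm hϖ ρ τ (stdFun hϖ ρ v c₁ c₂) (diagT hϖ b₁ b₂) (x (.inl i)) =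
      if 1 + b₁ = c₁ ∧ 1 + b₂ = c₂ then v else 0 := by
    have := opTerm_stdFun_diagT (τ := τ) (hϖ := hϖ) hv ht hb12 hb2 h12 h2 0 0 0 1 (l := 1) (m := 1) (n := 0)
      (by simp [sMat])
    rw [up_zero, one_mul, map_one, map_one] at this
    simp only [Finset.univ_unique, Finset.sum_singleton]
    change opTerm hϖ ρ τ _ _ 1 = _
    rw [this]
    split_ifs with h h' h'
    · simp [hτv]
    · exact absurd (by simpa using h) h'
    · exact absurd (by simpa using h') h
    · simp
  have e₂ : ∑ y : 𝓀[F], opTerm hϖ ρ τ (stdFun hϖ ρ v c₁ c₂) (diagT hϖ b₁ b₂) (x (.inr (.inl y))) =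
      0 := by
    have h : ∀ y, opTerm hϖ ρ τ (stdFun hϖ ρ v c₁ c₂) (diagT hϖ b₁ b₂) (x (.inr (.inl y))) =
        ρ (up 0 0 y * s₂ _) (τ (ρ (s₂ _)
          (if 1 + b₁ - 1 = c₁ ∧ 0 + b₂ - 1 = c₂ then v else 0))) := by
      intro y
      have := opTerm_stdFun_diagT (τ := τ) (hϖ := hϖ) hv ht hb12 hb2 h12 h2 0 0 (r y) (s₂ _) (l := 1) (m := 0)
        (n := 1) (by rw [s₂_inv, sMat_mul_s₂]; simp)
      refine this.trans ?_
      have h1 : redGL F (s₂ _)⁻¹ = s₂ _ := by rw [s₂_inv]; exact map_s₂ _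
      have h2 : redGL F (up 0 0 (r y) * s₂ _) = up 0 0 y * s₂ _ := hx (.inr (.inl y))
      rw [h1, h2]
    simp only [h]
    split_ifs
    · exact hs₂
    · simp
  have e₁ : ∑ y : 𝓀[F], ∑ z : 𝓀[F], opTerm hϖ ρ τ (stdFun hϖ ρ v c₁ c₂) (diagT hϖ b₁ b₂)
      (x (.inr (.inr (y, z)))) = 0 := by
    have h : ∀ y z, opTerm hϖ ρ τ (stdFun hϖ ρ v c₁ c₂) (diagT hϖ b₁ b₂) (x (.inr (.inr (y, z)))) =
        ρ (up y z 0 * (s₁ _ * s₂ _)) (τ (ρ (s₂ _ * s₁ _)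
          (if 0 + b₁ - 1 = c₁ ∧ 1 + b₂ - 1 = c₂ then v else 0))) := by
      intro y z
      have := opTerm_stdFun_diagT (τ := τ) (hϖ := hϖ) hv ht hb12 hb2 h12 h2 (r y) (r z) 0 (s₁ _ * s₂ _) (l := 0)
        (m := 1) (n := 1) (by rw [mul_inv_rev, s₂_inv, s₁_inv, sMat_mul_s₂_mul_s₁]; simp)
      refine this.trans ?_
      have h1 : redGL F (s₁ _ * s₂ _)⁻¹ = s₂ _ * s₁ _ := by
        rw [mul_inv_rev, s₂_inv, s₁_inv, redGL, map_mul, map_s₂, map_s₁]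
      have h2 : redGL F (up (r y) (r z) 0 * (s₁ _ * s₂ _)) = up y z 0 * (s₁ _ * s₂ _) :=
        hx (.inr (.inr (y, z)))
      rw [h1, h2]
    simp only [h]
    split_ifs
    · exact hs₁
    · simp
  rw [e₀, e₁, e₂, add_zero, add_zero]

include hv ht in
theorem opT_stdFun_mul_right (h12 : c₁ ≤ c₂) (h2 : c₂ ≤ 0) {B : GL (Fin 3) 𝒪[F]}
    (hB : redGL F B ∈ upperTri 𝓀[F]) {e : C} (he : ρ (redGL F B) v = e • v) (g : GL (Fin 3) F) :
    opT hϖ ρ τ (stdFun hϖ ρ v c₁ c₂) (g * inclGL F B) =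
      e • opT hϖ ρ τ (stdFun hϖ ρ v c₁ c₂) g := by
  rw [← opT_comp_mul_right, ← opT_smul]
  congr 1
  funext x
  exact stdFun_mul_right hv ht h12 h2 hB he x

/-- Some `s x⁻¹ g` lies in `K Z t_c I`. Decompose its `K`-part modulo `ϖ` as `p w u` with `p` lower
block triangular: `p` passes `s⁻¹` on one side and `u` passes `t_c` on the other. What remains is
`w⁻¹ s⁻¹ w t_c`, and the three `w` give the three shifts, read modulo scalars. -/
theorem exists_presentation_of_opT_ne_zero (h12 : c₁ ≤ c₂) (h2 : c₂ ≤ 0) {g : GL (Fin 3) F}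
    (h : opT hϖ ρ τ (stdFun hϖ ρ v c₁ c₂) g ≠ 0) :
    ∃ b₁ b₂, ((b₁ = c₁ - 1 ∧ b₂ = c₂ - 1) ∨ (b₁ = c₁ ∧ b₂ = c₂ + 1) ∨ (b₁ = c₁ + 1 ∧ b₂ = c₂)) ∧
      ∃ A n B, IsPresentation hϖ b₁ b₂ g A n B := by
  have hq : ∃ q : GL (Fin 3) 𝓀[F] ⧸ parUp 𝓀[F],
      opTerm hϖ ρ τ (stdFun hϖ ρ v c₁ c₂) g (cosetLift q) ≠ 0 := by
    by_contra h'
    push Not at h'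
    exact h (finsum_eq_zero_of_forall_eq_zero h')
  obtain ⟨q, hq⟩ := hq
  set x := cosetLift q
  have hf : stdFun hϖ ρ v c₁ c₂ (sMat hϖ * (inclGL F x)⁻¹ * g) ≠ 0 := fun h0 => hq (by
    rw [opTerm, h0, map_zero, map_zero])
  obtain ⟨A, n, B, hB, e⟩ := exists_presentation_of_stdFun_ne_zero hf
  obtain ⟨a', b', c', w', hw', hp⟩ := exists_bruhat_low (redGL F A)
  obtain ⟨a, rfl⟩ := IsLocalRing.residue_surjective a'
  obtain ⟨b, rfl⟩ := IsLocalRing.residue_surjective b'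
  obtain ⟨c, rfl⟩ := IsLocalRing.residue_surjective c'
  obtain ⟨x', y', z', hu⟩ := up_mul_diagT (hϖ := hϖ) h12 h2 a b c
  have main : ∀ (w : GL (Fin 3) 𝒪[F]) (l m k : ℤ), redGL F w = w' →
      (sMat hϖ)⁻¹ * inclGL F w =
        inclGL F w * dg (unif hϖ ^ l) (unif hϖ ^ m) (unif hϖ ^ k) →
      ∃ A n B, IsPresentation hϖ (l + c₁ - k) (m + c₂ - k) g A n B := by
    intro w l m k hw hs
    have hp' : tr (redGL F (A * (up a b c)⁻¹ * w⁻¹)) ∈ parUp 𝓀[F] := by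
      rw [map_mul, map_mul, map_inv, map_inv, hw, redGL, map_up]
      exact hp
    obtain ⟨p', hp'⟩ := exists_sMat_inv_conj hϖ hp'
    refine ⟨x * p' * w, n + k, up x' y' z' * B, ?_, ?_⟩
    · rw [map_mul]
      refine (upperTri _).mul_mem ?_ hB
      rw [redGL, map_up]
      exact up_mem_upperTri _ _ _
    · have hA : inclGL F A = inclGL F (A * (up a b c)⁻¹ * w⁻¹) * inclGL F w * inclGL F (up a b c) := by
        rw [← map_mul, ← map_mul]; group
      have hg : g = inclGL F x * ((sMat hϖ)⁻¹ * (sMat hϖ * (inclGL F x)⁻¹ * g)) := by group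
      have hz := scalarUnif_zpow_comm hϖ n
      have hd : dg (unif hϖ ^ l) (unif hϖ ^ m) (unif hϖ ^ k) * diagT hϖ c₁ c₂ =
          scalarUnif hϖ ^ k * diagT hϖ (l + c₁ - k) (m + c₂ - k) := by
        rw [diagT_eq_dg, diagT_eq_dg, scalarUnif_zpow_eq_dg, dg_mul_dg, dg_mul_dg, ← zpow_add,
          ← zpow_add, ← zpow_add, ← zpow_add, add_sub_cancel, add_sub_cancel]
      rw [hg, e]
      calc inclGL F x * ((sMat hϖ)⁻¹ * (inclGL F A * scalarUnif hϖ ^ n * diagT hϖ c₁ c₂ * inclGL F B))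
          = inclGL F x * ((sMat hϖ)⁻¹ * inclGL F (A * (up a b c)⁻¹ * w⁻¹)) * inclGL F w *
            (inclGL F (up a b c) * scalarUnif hϖ ^ n) * diagT hϖ c₁ c₂ * inclGL F B := by
            rw [hA]; simp only [mul_assoc]
        _ = inclGL F x * inclGL F p' * ((sMat hϖ)⁻¹ * inclGL F w) * scalarUnif hϖ ^ n *
            (inclGL F (up a b c) * diagT hϖ c₁ c₂) * inclGL F B := by
            rw [hp', ← hz]; simp only [mul_assoc]
        _ = inclGL F x * inclGL F p' * inclGL F w *
            (dg (unif hϖ ^ l) (unif hϖ ^ m) (unif hϖ ^ k) * scalarUnif hϖ ^ n) *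
            diagT hϖ c₁ c₂ * inclGL F (up x' y' z') * inclGL F B := by
            rw [hs, hu]; simp only [mul_assoc]
        _ = inclGL F x * inclGL F p' * inclGL F w * scalarUnif hϖ ^ n *
            (dg (unif hϖ ^ l) (unif hϖ ^ m) (unif hϖ ^ k) *
            diagT hϖ c₁ c₂) * inclGL F (up x' y' z') * inclGL F B := by
            rw [← hz]; simp only [mul_assoc]
        _ = _ := by
            rw [hd, map_mul, map_mul, map_mul, zpow_add]; simp only [mul_assoc]
  rcases hw' with rfl | rfl | rfl
  · refine ⟨_, _, .inl ⟨rfl, rfl⟩, ?_⟩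
    have := main 1 (-1) (-1) 0 (map_one _) (by simp [sMat, dg_inv])
    convert this using 7 <;> ring
  · refine ⟨_, _, .inr (.inl ⟨rfl, rfl⟩), ?_⟩
    have := main (s₂ _) (-1) 0 (-1) (map_s₂ _) (by rw [sMat_inv_mul_s₂]; simp)
    convert this using 7 <;> ring
  · refine ⟨_, _, .inr (.inr ⟨rfl, rfl⟩), ?_⟩
    have := main (s₂ _ * s₁ _) 0 (-1) (-1) (by rw [redGL, map_mul, map_s₂, map_s₁])
      (by rw [sMat_inv_mul_s₂_mul_s₁]; simp)
    convert this using 7 <;> ring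

include hτ hv ht in
/-- The standard function at a sufficiently dominant place is the image of a standard function
under the Hecke operator. -/
theorem opT_stdFun (hτv : τ v = v)
    (hs₂ : ∑ y : 𝓀[F], ρ (up 0 0 y * s₂ _) (τ (ρ (s₂ _) v)) = 0)
    (hs₁ : ∑ y : 𝓀[F], ∑ z : 𝓀[F], ρ (up y z 0 * (s₁ _ * s₂ _)) (τ (ρ (s₂ _ * s₁ _) v)) = 0)
    {a₁ a₂ : ℤ} (h12 : a₁ < a₂) (h2 : a₂ < -1) :
    opT hϖ ρ τ (stdFun hϖ ρ v (1 + a₁) (1 + a₂)) = stdFun hϖ ρ v a₁ a₂ := by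
  have hc12 : 1 + a₁ ≤ 1 + a₂ := by omega
  have hc2 : 1 + a₂ ≤ 0 := by omega
  have hEq := isEquivariant_opT hτ (isEquivariant_stdFun (hϖ := hϖ) hv ht hc12 hc2)
  have hEq' := isEquivariant_stdFun (hϖ := hϖ) hv ht h12.le (show a₂ ≤ 0 by omega)
  -- Both sides transform alike under `K Z` on the left and `I` on the right, so it is enough to
  -- compare them at `t_b`.
  have main : ∀ b₁ b₂ : ℤ, b₁ ≤ b₂ → b₂ ≤ 0 → ∀ g A n B, IsPresentation hϖ b₁ b₂ g A n B →
      opT hϖ ρ τ (stdFun hϖ ρ v (1 + a₁) (1 + a₂)) g = stdFun hϖ ρ v a₁ a₂ g := by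
    rintro b₁ b₂ hb12 hb2 g A n B ⟨hB, rfl⟩
    obtain ⟨e, he⟩ := ht.exists_smul hv hB
    rw [opT_stdFun_mul_right hv ht hc12 hc2 hB he,
      stdFun_mul_right hv ht h12.le (by omega) hB he, mul_assoc (inclGL F A), hEq.1, hEq.2, hEq'.1,
      hEq'.2, opT_stdFun_diagT hτ hv ht hτv hs₂ hs₁ hb12 hb2 hc12 hc2]
    have h := stdFun_dg (hϖ := hϖ) hv ht h12.le (show a₂ ≤ 0 by omega) b₁ b₂ 0
    rw [zpow_zero, ← diagT_eq_dg] at h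
    rw [h]
    congr 3
    simp
  funext g
  by_cases h : opT hϖ ρ τ (stdFun hϖ ρ v (1 + a₁) (1 + a₂)) g = 0
  · by_cases h' : stdFun hϖ ρ v a₁ a₂ g = 0
    · rw [h, h']
    · obtain ⟨A, n, B, hp⟩ := exists_presentation_of_stdFun_ne_zero h'
      exact main _ _ h12.le (by omega) _ _ _ _ hp
  · obtain ⟨b₁, b₂, hb, A, n, B, hp⟩ := exists_presentation_of_opT_ne_zero hc12 hc2 h
    -- The possible `b` are `(a₁, a₂)`, `(1 + a₁, 2 + a₂)` and `(2 + a₁, 1 + a₂)`. The second needs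
    -- `a₂ < -1` and the third needs `a₁ < a₂` to satisfy `b₁ ≤ b₂ ≤ 0`.
    exact main b₁ b₂ (by omega) (by omega) _ _ _ _ hp

end Image

end GL3

/-! ## The Cartan decomposition and leading terms -/

namespace GL3
open ValuativeRel (valuation ValueGroupWithZero)

/-! ### Norms, elementary divisors and diagonalisation by `K` -/

section Cartan

variable {F : Type*} [Field F] [ValuativeRel F] [TopologicalSpace F] [IsNonarchimedeanLocalField F]
  {ϖ : 𝒪[F]} (hϖ : Irreducible ϖ)

/-- The maximum of the valuations of the entries. -/
noncomputable def maxVal (g : GL (Fin 3) F) : ValueGroupWithZero F :=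
  Finset.univ.sup' ⟨((0, 0) : Fin 3 × Fin 3), Finset.mem_univ _⟩ fun i => valuation F (g.1 i.1 i.2)

theorem maxVal_le_iff {g : GL (Fin 3) F} {c : ValueGroupWithZero F} :
    maxVal g ≤ c ↔ ∀ i j, valuation F (g.1 i j) ≤ c := by
  refine Finset.sup'_le_iff Finset.univ_nonempty _ |>.trans ?_
  simp

theorem val_le_maxVal (g : GL (Fin 3) F) (i j : Fin 3) : valuation F (g.1 i j) ≤ maxVal g :=
  maxVal_le_iff.1 le_rfl i j

theorem exists_val_eq_maxVal (g : GL (Fin 3) F) : ∃ i j, valuation F (g.1 i j) = maxVal g := by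
  obtain ⟨i, -, hi⟩ := Finset.exists_mem_eq_sup' ⟨((0, 0) : Fin 3 × Fin 3), Finset.mem_univ _⟩
    fun i => valuation F (g.1 i.1 i.2)
  exact ⟨i.1, i.2, hi.symm⟩

theorem maxVal_pos (g : GL (Fin 3) F) : 0 < maxVal g := by
  refine zero_lt_iff.2 fun h => (Matrix.isUnits_det_units g).ne_zero ?_
  have h0 : ∀ i j, g.1 i j = 0 := fun i j => by
    have := val_le_maxVal g i j
    rw [h, le_zero_iff, map_eq_zero] at this
    exact this
  simp [Matrix.det_fin_three, h0]

theorem maxVal_mul_le (g h : GL (Fin 3) F) : maxVal (g * h) ≤ maxVal g * maxVal h := by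
  rw [maxVal_le_iff]
  intro i j
  rw [Units.val_mul, Matrix.mul_apply]
  refine Valuation.map_sum_le _ fun l _ => ?_
  rw [map_mul]
  exact mul_le_mul' (val_le_maxVal _ _ _) (val_le_maxVal _ _ _)

theorem maxVal_inclGL_le (A : GL (Fin 3) 𝒪[F]) : maxVal (inclGL F A) ≤ 1 :=
  maxVal_le_iff.2 fun i j => val_le_one (A.1 i j)

theorem maxVal_inclGL_mul (A : GL (Fin 3) 𝒪[F]) (g : GL (Fin 3) F) :
    maxVal (inclGL F A * g) = maxVal g := by
  have h : ∀ A (g : GL (Fin 3) F), maxVal (inclGL F A * g) ≤ maxVal g := fun A g =>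
    (maxVal_mul_le _ _).trans (mul_le_of_le_one_left' (maxVal_inclGL_le A))
  refine le_antisymm (h A g) ?_
  have := h A⁻¹ (inclGL F A * g)
  rwa [map_inv, inv_mul_cancel_left] at this

theorem maxVal_mul_inclGL (A : GL (Fin 3) 𝒪[F]) (g : GL (Fin 3) F) :
    maxVal (g * inclGL F A) = maxVal g := by
  have h : ∀ A (g : GL (Fin 3) F), maxVal (g * inclGL F A) ≤ maxVal g := fun A g =>
    (maxVal_mul_le _ _).trans (mul_le_of_le_one_right' (maxVal_inclGL_le A))
  refine le_antisymm (h A g) ?_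
  have := h A⁻¹ (g * inclGL F A)
  rwa [map_inv, mul_inv_cancel_right] at this

theorem maxVal_dg_mul (x : Fˣ) (g : GL (Fin 3) F) :
    maxVal (dg x x x * g) = valuation F (x : F) * maxVal g := by
  have h : ∀ i j, (dg x x x * g).1 i j = x * g.1 i j := fun i j => by
    rw [dg_mul_apply]; fin_cases i <;> rfl
  refine le_antisymm (maxVal_le_iff.2 fun i j => ?_) ?_
  · rw [h, map_mul]
    exact mul_le_mul_right (val_le_maxVal g i j) _
  · obtain ⟨i, j, e⟩ := exists_val_eq_maxVal g
    rw [← e, ← map_mul, ← h]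
    exact val_le_maxVal _ i j

/-- A ratio of the elementary divisors of a matrix, namely the quotient of the second and the third
one when they are in decreasing order. -/
noncomputable def divisorRatio (g : GL (Fin 3) F) : ValueGroupWithZero F :=
  maxVal g⁻¹ ^ 2 * valuation F g.1.det / maxVal g

theorem divisorRatio_inclGL_mul (A : GL (Fin 3) 𝒪[F]) (g : GL (Fin 3) F) :
    divisorRatio (inclGL F A * g) = divisorRatio g := by
  rw [divisorRatio, mul_inv_rev, ← map_inv, maxVal_inclGL_mul, maxVal_mul_inclGL, Units.val_mul,
    Matrix.det_mul, map_mul, val_det_inclGL, one_mul, divisorRatio]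

theorem divisorRatio_mul_inclGL (A : GL (Fin 3) 𝒪[F]) (g : GL (Fin 3) F) :
    divisorRatio (g * inclGL F A) = divisorRatio g := by
  rw [divisorRatio, mul_inv_rev, ← map_inv, maxVal_inclGL_mul, maxVal_mul_inclGL, Units.val_mul,
    Matrix.det_mul, map_mul, val_det_inclGL, mul_one, divisorRatio]

theorem divisorRatio_scalarUnif_mul (n : ℤ) (g : GL (Fin 3) F) :
    divisorRatio (scalarUnif hϖ ^ n * g) = divisorRatio g := by
  have h : (scalarUnif hϖ ^ n * g)⁻¹ =
      dg (unif hϖ ^ n)⁻¹ (unif hϖ ^ n)⁻¹ (unif hϖ ^ n)⁻¹ * g⁻¹ := by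
    rw [scalarUnif_zpow_comm, mul_inv_rev, scalarUnif_zpow_eq_dg, dg_inv]
  have h0 : valuation F ((unif hϖ ^ n : Fˣ) : F) ≠ 0 :=
    (Valuation.ne_zero_iff _).2 (Units.ne_zero _)
  have h1 := (maxVal_pos g).ne'
  rw [divisorRatio, h, scalarUnif_zpow_eq_dg, maxVal_dg_mul, maxVal_dg_mul, Units.val_mul,
    Matrix.det_mul, map_mul, val_det_dg, divisorRatio, Units.val_mul, Units.val_mul,
    Units.val_inv_eq_inv_val, map_mul, map_mul, map_inv₀]
  field_simp

theorem divisorRatio_mul_scalarUnif (n : ℤ) (g : GL (Fin 3) F) :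
    divisorRatio (g * scalarUnif hϖ ^ n) = divisorRatio g := by
  rw [← scalarUnif_zpow_comm, divisorRatio_scalarUnif_mul]

theorem le_divisorRatio {g : GL (Fin 3) F} {a b : ValueGroupWithZero F} (ha : maxVal g ≤ a)
    (hb : b ≤ maxVal g⁻¹) : b ^ 2 * valuation F g.1.det / a ≤ divisorRatio g := by
  rw [divisorRatio]
  gcongr
  · exact zero_le
  · exact maxVal_pos g

theorem maxVal_dg_le {x y z : Fˣ} {c : ValueGroupWithZero F} (hx : valuation F (x : F) ≤ c)
    (hy : valuation F (y : F) ≤ c) (hz : valuation F (z : F) ≤ c) : maxVal (dg x y z) ≤ c := by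
  rw [maxVal_le_iff]
  intro i j
  fin_cases i <;> fin_cases j <;> simp [dg_val, hx, hy, hz]

theorem maxVal_dg {x y z : Fˣ} (hy : valuation F (y : F) ≤ valuation F (x : F))
    (hz : valuation F (z : F) ≤ valuation F (x : F)) :
    maxVal (dg x y z) = valuation F (x : F) :=
  le_antisymm (maxVal_dg_le le_rfl hy hz) (val_le_maxVal (dg x y z) 0 0)

theorem maxVal_dg' {x y z : Fˣ} (hx : valuation F (x : F) ≤ valuation F (z : F))
    (hy : valuation F (y : F) ≤ valuation F (z : F)) :
    maxVal (dg x y z) = valuation F (z : F) :=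
  le_antisymm (maxVal_dg_le hx hy le_rfl) (val_le_maxVal (dg x y z) 2 2)

theorem val_units_inv_le {x y : Fˣ} (h : valuation F (x : F) ≤ valuation F (y : F)) :
    valuation F ((y⁻¹ : Fˣ) : F) ≤ valuation F ((x⁻¹ : Fˣ) : F) := by
  rw [Units.val_inv_eq_inv_val, Units.val_inv_eq_inv_val, map_inv₀, map_inv₀]
  exact inv_anti₀ (zero_lt_iff.2 ((Valuation.ne_zero_iff _).2 x.ne_zero)) h

/-- The norm is `|x|` and that of the inverse is `|z|⁻¹`, so the defining formula becomes `|z|⁻²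
|xyz| / |x|`. -/
theorem divisorRatio_dg {x y z : Fˣ} (hy : valuation F (y : F) ≤ valuation F (x : F))
    (hz : valuation F (z : F) ≤ valuation F (y : F)) :
    divisorRatio (dg x y z) = valuation F (y : F) / valuation F (z : F) := by
  have hx0 := (Valuation.ne_zero_iff (valuation F)).2 x.ne_zero
  have hz0 := (Valuation.ne_zero_iff (valuation F)).2 z.ne_zero
  rw [divisorRatio, dg_inv, maxVal_dg hy (hz.trans hy),
    maxVal_dg' (val_units_inv_le (hz.trans hy)) (val_units_inv_le hz), val_det_dg, Units.val_mul,
    Units.val_mul, map_mul, map_mul, Units.val_inv_eq_inv_val, map_inv₀]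
  field_simp

theorem exists_pivot (g : GL (Fin 3) F) : ∃ A B : GL (Fin 3) 𝒪[F],
    valuation F ((inclGL F A * g * inclGL F B).1 0 0) = maxVal g := by
  obtain ⟨i, j, e⟩ := exists_val_eq_maxVal g
  refine ⟨![1, s₁ _, s₁ _ * s₂ _] i, ![1, s₁ _, s₂ _ * s₁ _] j, ?_⟩
  rw [← e]
  congr 1
  fin_cases i <;> fin_cases j <;>
    simp [map_s₁, map_s₂, s₁_val, s₂_val, Matrix.mul_apply, Matrix.vecMul, dotProduct,
      Fin.sum_univ_three]

theorem exists_coe_eq_neg_div {a b : F} (h : valuation F a ≤ valuation F b) :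
    ∃ c : 𝒪[F], (c : F) = -a / b :=
  ⟨⟨-a / b, by
    change valuation F _ ≤ 1
    rw [map_div₀, Valuation.map_neg]
    exact div_le_one_of_le₀ h zero_le⟩, rfl⟩

theorem exists_clear_first (g : GL (Fin 3) F) (hg : valuation F (g.1 0 0) = maxVal g) :
    ∃ A B : GL (Fin 3) 𝒪[F], (inclGL F A * g * inclGL F B).1 0 0 = g.1 0 0 ∧
      (∀ i, i ≠ 0 → (inclGL F A * g * inclGL F B).1 i 0 = 0) ∧
      ∀ i, i ≠ 0 → (inclGL F A * g * inclGL F B).1 0 i = 0 := by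
  have h0 : g.1 0 0 ≠ 0 := (Valuation.ne_zero_iff _).1 (hg ▸ (maxVal_pos g).ne')
  have h : ∀ i j, valuation F (g.1 i j) ≤ valuation F (g.1 0 0) := fun i j =>
    hg ▸ val_le_maxVal g i j
  obtain ⟨a, ha⟩ := exists_coe_eq_neg_div (h 1 0)
  obtain ⟨b, hb⟩ := exists_coe_eq_neg_div (h 2 0)
  obtain ⟨c, hc⟩ := exists_coe_eq_neg_div (h 0 1)
  obtain ⟨d, hd⟩ := exists_coe_eq_neg_div (h 0 2)
  refine ⟨lo a b 0, up c d 0, ?_, ?_, ?_⟩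
  all_goals
    rw [inclGL, map_lo, map_up, map_zero]
    change algebraMap 𝒪[F] F _ = _ at ha hb hc hd
    rw [ha, hb, hc, hd]
  · simp [lo_val, up_val, Matrix.mul_apply, Matrix.vecMul, dotProduct,
      Fin.sum_univ_three]
  · intro i hi
    fin_cases i <;> simp [lo_val, up_val, Matrix.mul_apply, Matrix.vecMul, dotProduct,
      Fin.sum_univ_three, h0] at hi ⊢
  · intro i hi
    fin_cases i <;> simp [lo_val, up_val, Matrix.mul_apply, Matrix.vecMul, dotProduct,
      Fin.sum_univ_three] at hi ⊢ <;>
      field_simp <;> ring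

theorem exists_pivot_second (g : GL (Fin 3) F) (h : ∀ i, i ≠ 0 → g.1 i 0 = 0)
    (h' : ∀ i, i ≠ 0 → g.1 0 i = 0) : ∃ A B : GL (Fin 3) 𝒪[F],
      (∀ i, i ≠ 0 → (inclGL F A * g * inclGL F B).1 i 0 = 0) ∧
      (∀ i, i ≠ 0 → (inclGL F A * g * inclGL F B).1 0 i = 0) ∧
      (∀ i j, i ≠ 0 → j ≠ 0 → valuation F ((inclGL F A * g * inclGL F B).1 i j) ≤
        valuation F ((inclGL F A * g * inclGL F B).1 1 1)) ∧
      (inclGL F A * g * inclGL F B).1 0 0 = g.1 0 0 := by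
  have h10 := h 1 (by decide)
  have h20 := h 2 (by decide)
  have h01 := h' 1 (by decide)
  have h02 := h' 2 (by decide)
  obtain ⟨⟨i, j⟩, hij⟩ := Finite.exists_max
    fun i : Fin 2 × Fin 2 => valuation F (g.1 i.1.succ i.2.succ)
  have h11 := hij (0, 0)
  have h12 := hij (0, 1)
  have h21 := hij (1, 0)
  have h22 := hij (1, 1)
  refine ⟨![1, s₂ _] i, ![1, s₂ _] j, ?_, ?_, ?_, ?_⟩
  · intro l hl
    fin_cases l <;> fin_cases i <;> fin_cases j <;>
      simp [map_s₂, s₂_val, Matrix.mul_apply, Matrix.vecMul, dotProduct, Fin.sum_univ_three,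
        h10, h20] at hl ⊢
  · intro l hl
    fin_cases l <;> fin_cases i <;> fin_cases j <;>
      simp [map_s₂, s₂_val, Matrix.mul_apply, Matrix.vecMul, dotProduct, Fin.sum_univ_three,
        h01, h02] at hl ⊢
  · intro l m hl hm
    have e : ∀ (i j : Fin 2) (l m : Fin 3), ∃ l' m' : Fin 3, (l ≠ 0 → l' ≠ 0) ∧ (m ≠ 0 → m' ≠ 0) ∧
        (inclGL F (![1, s₂ _] i) * g * inclGL F (![1, s₂ _] j)).1 l m = g.1 l' m' := by
      intro i j l m
      refine ⟨![l, Equiv.swap 1 2 l] i, ![m, Equiv.swap 1 2 m] j, ?_, ?_, ?_⟩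
      · fin_cases i <;> fin_cases l <;> decide
      · fin_cases j <;> fin_cases m <;> decide
      · fin_cases i <;> fin_cases j <;> fin_cases l <;> fin_cases m <;>
          simp [map_s₂, s₂_val, Matrix.mul_apply, Matrix.vecMul, dotProduct, Fin.sum_univ_three,
            Equiv.swap_apply_def]
    obtain ⟨l', m', hl', hm', e'⟩ := e i j l m
    have hp : (inclGL F (![1, s₂ _] i) * g * inclGL F (![1, s₂ _] j)).1 1 1 =
        g.1 i.succ j.succ := by
      fin_cases i <;> fin_cases j <;>
        simp [map_s₂, s₂_val, Matrix.mul_apply, Matrix.vecMul, dotProduct, Fin.sum_univ_three]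
    obtain ⟨l'', rfl⟩ := Fin.exists_succ_eq.2 (hl' hl)
    obtain ⟨m'', rfl⟩ := Fin.exists_succ_eq.2 (hm' hm)
    rw [e', hp]
    exact hij (l'', m'')
  · fin_cases i <;> fin_cases j <;>
      simp [map_s₂, s₂_val, Matrix.mul_apply, Matrix.vecMul, dotProduct, Fin.sum_univ_three]

theorem exists_clear_second (g : GL (Fin 3) F) (h : ∀ i, i ≠ 0 → g.1 i 0 = 0)
    (h' : ∀ i, i ≠ 0 → g.1 0 i = 0)
    (hm : ∀ i j, i ≠ 0 → j ≠ 0 → valuation F (g.1 i j) ≤ valuation F (g.1 1 1)) :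
    ∃ (A B : GL (Fin 3) 𝒪[F]) (x y z : Fˣ), inclGL F A * g * inclGL F B = dg x y z ∧
      (x : F) = g.1 0 0 ∧ valuation F (z : F) ≤ valuation F (y : F) := by
  have h10 := h 1 (by decide)
  have h20 := h 2 (by decide)
  have h01 := h' 1 (by decide)
  have h02 := h' 2 (by decide)
  have hdet := (Matrix.isUnits_det_units g).ne_zero
  rw [Matrix.det_fin_three, h10, h20, h01, h02] at hdet
  have h0 : g.1 0 0 ≠ 0 := fun h0 => hdet (by rw [h0]; ring)
  have h1 : g.1 1 1 ≠ 0 := fun h1 => by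
    have hz : ∀ i j, i ≠ 0 → j ≠ 0 → g.1 i j = 0 := fun i j hi hj => by
      have := hm i j hi hj
      rwa [h1, map_zero, le_zero_iff, map_eq_zero] at this
    exact hdet (by rw [h1, hz 1 2 (by decide) (by decide)]; ring)
  obtain ⟨c, hc⟩ := exists_coe_eq_neg_div (hm 2 1 (by decide) (by decide))
  obtain ⟨d, hd⟩ := exists_coe_eq_neg_div (hm 1 2 (by decide) (by decide))
  have h2 : g.1 2 2 - g.1 1 2 * g.1 2 1 / g.1 1 1 ≠ 0 := fun h2 => hdet (by
    field_simp at h2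
    linear_combination g.1 0 0 * h2)
  refine ⟨lo 0 0 c, up 0 0 d, Units.mk0 _ h0, Units.mk0 _ h1, Units.mk0 _ h2, ?_, rfl, ?_⟩
  · rw [inclGL, map_lo, map_up, map_zero]
    change algebraMap 𝒪[F] F _ = _ at hc hd
    rw [hc, hd]
    apply ext_fin_three <;>
      simp [lo_val, up_val, dg_val, Matrix.mul_apply, Matrix.vecMul, dotProduct,
        Fin.sum_univ_three, h10, h20, h01, h02] <;> field_simp <;> ring
  · change valuation F (g.1 2 2 - g.1 1 2 * g.1 2 1 / g.1 1 1) ≤ valuation F (g.1 1 1)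
    refine Valuation.map_sub_le (valuation F) (hm 2 2 (by decide) (by decide)) ?_
    rw [mul_div_assoc, map_mul, map_div₀]
    exact (mul_le_of_le_one_right' (div_le_one_of_le₀ (hm 2 1 (by decide) (by decide))
      zero_le)).trans (hm 1 2 (by decide) (by decide))

/-- Gaussian elimination with a pivot of maximal valuation, so that all multipliers are integral.
The first pivot stays dominant because multiplication by `K` preserves the norm. -/
theorem exists_cartan (g : GL (Fin 3) F) : ∃ (A B : GL (Fin 3) 𝒪[F]) (x y z : Fˣ),
    inclGL F A * g * inclGL F B = dg x y z ∧ valuation F (y : F) ≤ valuation F (x : F) ∧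
      valuation F (z : F) ≤ valuation F (y : F) := by
  obtain ⟨A₁, B₁, h₁⟩ := exists_pivot g
  obtain ⟨A₂, B₂, h₂, h₂', h₂''⟩ := exists_clear_first (inclGL F A₁ * g * inclGL F B₁) (by
    rw [h₁, maxVal_mul_inclGL, maxVal_inclGL_mul])
  set g₂ := inclGL F A₂ * (inclGL F A₁ * g * inclGL F B₁) * inclGL F B₂ with hg₂
  obtain ⟨A₃, B₃, h₃₀, h₃₀', h₃₁, h₃₂⟩ := exists_pivot_second g₂ h₂' h₂''
  set g₃ := inclGL F A₃ * g₂ * inclGL F B₃ with hg₃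
  obtain ⟨A₄, B₄, x, y, z, h₄, h₄x, h₄z⟩ := exists_clear_second g₃ h₃₀ h₃₀' h₃₁
  have hmax : maxVal (dg x y z) = maxVal g := by
    rw [← h₄, hg₃, hg₂]
    simp only [maxVal_mul_inclGL, maxVal_inclGL_mul]
  refine ⟨A₄ * A₃ * A₂ * A₁, B₁ * B₂ * B₃ * B₄, x, y, z, ?_, ?_, h₄z⟩
  · rw [← h₄, hg₃, hg₂]
    simp only [map_mul, mul_assoc]
  · rw [h₄x, h₃₂, h₂, h₁, ← hmax]
    exact val_le_maxVal (dg x y z) 1 1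

end Cartan

/-! ### Leading terms and the image of the operator -/

section LeadingTerm

variable {F : Type*} [Field F] [ValuativeRel F] [TopologicalSpace F] [IsNonarchimedeanLocalField F]
  {ϖ : 𝒪[F]} {hϖ : Irreducible ϖ} {C W : Type*} [Field C] [AddCommGroup W] [Module C W]
  {ρ : Representation C (GL (Fin 3) 𝓀[F]) W} {τ : W →ₗ[C] W}

-- These matrices are the arguments of the nontrivial summands of the operator at `s⁻¹ t`.
-- Conjugation by `s` raises the norm by at most `|ϖ|⁻¹`, while outside the parabolic the last row
-- of `A` has a unit in one of its first two places, which makes the inverse have norm at least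
-- `(|z| |ϖ|)⁻¹`. The determinant keeps its valuation.
variable (hϖ) in
theorem val_div_le_divisorRatio {x y z : Fˣ} (hy : valuation F (y : F) ≤ valuation F (x : F))
    (hz : valuation F (z : F) ≤ valuation F (y : F)) {A : GL (Fin 3) 𝒪[F]}
    (hA : redGL F A ∉ parUp 𝓀[F]) :
    valuation F (y : F) / valuation F (z : F) / valuation F (unif hϖ : F) ≤
      divisorRatio (sMat hϖ * (inclGL F A)⁻¹ * (sMat hϖ)⁻¹ * dg x y z) := by
  have hx0 := (Valuation.ne_zero_iff (valuation F)).2 x.ne_zero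
  have hz0 := (Valuation.ne_zero_iff (valuation F)).2 z.ne_zero
  have hu0 := (Valuation.ne_zero_iff (valuation F)).2 (unif hϖ).ne_zero
  have hu1 := (val_unif_lt_one hϖ).le
  have hup := val_unif_pos hϖ
  have hxu : valuation F (x : F) ≤ valuation F (x : F) / valuation F (unif hϖ : F) :=
    (le_div_iff₀ hup).2 (mul_le_of_le_one_right' hu1)
  have h1 : maxVal (sMat hϖ * (inclGL F A)⁻¹ * (sMat hϖ)⁻¹ * dg x y z) ≤
      valuation F (x : F) / valuation F (unif hϖ : F) := by
    have hS : maxVal (sMat hϖ * (inclGL F A)⁻¹ * (sMat hϖ)⁻¹) ≤ (valuation F (unif hϖ : F))⁻¹ := by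
      have h1u : 1 ≤ (valuation F (unif hϖ : F))⁻¹ := (one_le_inv₀ hup).2 hu1
      have hle : ∀ i j, valuation F ((inclGL F A⁻¹).1 i j) ≤ 1 := fun i j => val_le_one _
      rw [← map_inv, maxVal_le_iff, sMat_conj]
      intro i j
      fin_cases i <;> fin_cases j
      · exact (hle 0 0).trans h1u
      · exact (hle 0 1).trans h1u
      · exact (val_unif_mul_lt hϖ (hle 0 2)).le.trans h1u
      · exact (hle 1 0).trans h1u
      · exact (hle 1 1).trans h1u
      · exact (val_unif_mul_lt hϖ (hle 1 2)).le.trans h1u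
      · change valuation F (_ * _) ≤ _
        rw [map_mul, map_inv₀]
        exact mul_le_of_le_one_left' (hle 2 0)
      · change valuation F (_ * _) ≤ _
        rw [map_mul, map_inv₀]
        exact mul_le_of_le_one_left' (hle 2 1)
      · exact (hle 2 2).trans h1u
    refine (maxVal_mul_le _ _).trans ?_
    rw [maxVal_dg hy (hz.trans hy), div_eq_mul_inv, mul_comm]
    exact mul_le_mul_right hS _
  have h2 : (valuation F (z : F))⁻¹ / valuation F (unif hϖ : F) ≤
      maxVal (sMat hϖ * (inclGL F A)⁻¹ * (sMat hϖ)⁻¹ * dg x y z)⁻¹ := by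
    have e : (sMat hϖ * (inclGL F A)⁻¹ * (sMat hϖ)⁻¹ * dg x y z)⁻¹ =
        dg x⁻¹ y⁻¹ z⁻¹ * (sMat hϖ * inclGL F A * (sMat hϖ)⁻¹) := by
      rw [← dg_inv]; group
    rw [e]
    have hentry : ∃ j : Fin 3, (sMat hϖ * inclGL F A * (sMat hϖ)⁻¹).1 2 j =
        (inclGL F A).1 2 j * (unif hϖ : F)⁻¹ ∧ valuation F ((inclGL F A).1 2 j) = 1 := by
      rw [mem_parUp, redGL_apply, redGL_apply, residue_eq_zero_iff_val, residue_eq_zero_iff_val,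
        not_and_or, not_lt, not_lt] at hA
      rcases hA with hA | hA
      · exact ⟨0, by rw [sMat_conj]; rfl, le_antisymm (val_le_one _) hA⟩
      · exact ⟨1, by rw [sMat_conj]; rfl, le_antisymm (val_le_one _) hA⟩
    obtain ⟨j, hj, hj1⟩ := hentry
    refine le_of_eq_of_le ?_ (val_le_maxVal _ 2 j)
    rw [dg_mul_apply, hj, map_mul, map_mul, hj1, one_mul, map_inv₀, div_eq_mul_inv]
    congr 1
    change _ = valuation F ((z⁻¹ : Fˣ) : F)
    rw [Units.val_inv_eq_inv_val, map_inv₀]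
  refine le_of_eq_of_le ?_ (le_divisorRatio h1 h2)
  have hd : valuation F (sMat hϖ * (inclGL F A)⁻¹ * (sMat hϖ)⁻¹ * dg x y z).1.det =
      valuation F (x : F) * valuation F (y : F) * valuation F (z : F) := by
    have hs : (sMat hϖ).1.det * (sMat hϖ)⁻¹.1.det = 1 := by
      rw [← Matrix.det_mul, ← Units.val_mul, mul_inv_cancel, Units.val_one, Matrix.det_one]
    rw [Units.val_mul, Units.val_mul, Units.val_mul, Matrix.det_mul, Matrix.det_mul,
      Matrix.det_mul, mul_right_comm (sMat hϖ).1.det, hs, one_mul, map_mul, ← map_inv,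
      val_det_inclGL, one_mul, val_det_dg, Units.val_mul, Units.val_mul, map_mul, map_mul]
  rw [hd]
  field_simp

/-- The image of the Hecke operator contains no non-zero function which is supported on the elements
whose second and third elementary divisors coincide. -/
theorem eq_zero_of_opT_eq_zero (hτ : IsParabolicMap ρ τ)
    (hinj : ∀ w, (∀ a b c, τ (ρ (up a b c) w) = 0) → w = 0)
    {h : GL (Fin 3) F → W} (hh : IsEquivariant hϖ ρ h)
    (hfin : (divisorRatio '' Function.support h).Finite)
    (hT : ∀ g, 1 < divisorRatio g → opT hϖ ρ τ h g = 0) : h = 0 := by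
  by_contra hne
  obtain ⟨g₁, hg₁⟩ := Function.ne_iff.1 hne
  -- The leading term: a point of the support with the largest divisor ratio.
  obtain ⟨_, ⟨g₀, hg₀, rfl⟩, hmax⟩ := Set.exists_max_image _ id hfin ⟨_, g₁, hg₁, rfl⟩
  obtain ⟨A, B, x, y, z, e, hy, hz⟩ := exists_cartan g₀
  have hup := val_unif_pos hϖ
  have hz0 := (Valuation.ne_zero_iff (valuation F)).2 z.ne_zero
  have hy0 := (Valuation.ne_zero_iff (valuation F)).2 y.ne_zero
  have hzp := zero_lt_iff.2 hz0
  have hR : divisorRatio g₀ = valuation F (y : F) / valuation F (z : F) := by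
    rw [← divisorRatio_dg hy hz, ← e, divisorRatio_mul_inclGL, divisorRatio_inclGL_mul]
  have h1R : 1 ≤ valuation F (y : F) / valuation F (z : F) := (one_le_div₀ hzp).2 hz
  have hlt : valuation F (y : F) / valuation F (z : F) <
      valuation F (y : F) / valuation F (z : F) / valuation F (unif hϖ : F) := by
    rw [lt_div_iff₀ hup]
    exact mul_lt_of_lt_one_right (zero_lt_one.trans_le h1R) (val_unif_lt_one hϖ)
  have hvanish : ∀ g, valuation F (y : F) / valuation F (z : F) < divisorRatio g → h g = 0 := by
    intro g hg
    by_contra h0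
    exact absurd (hmax _ ⟨g, h0, rfl⟩) (not_le.2 (hR ▸ hg))
  -- Evaluate at `s⁻¹ t B'`, whose ratio exceeds `1`. The summands of nontrivial cosets have
  -- arguments of ratio above the maximum and vanish; the trivial coset leaves exactly `τ (h (t
  -- B'))`.
  have key : ∀ B' : GL (Fin 3) 𝒪[F], τ (h (dg x y z * inclGL F B')) = 0 := by
    intro B'
    have hs : divisorRatio ((sMat hϖ)⁻¹ * (dg x y z * inclGL F B')) =
        valuation F (y : F) / valuation F (z : F) / valuation F (unif hϖ : F) := by
      have hm : ∀ a : Fˣ, valuation F (((unif hϖ)⁻¹ * a : Fˣ) : F) =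
          (valuation F (unif hϖ : F))⁻¹ * valuation F (a : F) := fun a => by
        rw [Units.val_mul, map_mul, Units.val_inv_eq_inv_val, map_inv₀]
      rw [← mul_assoc, divisorRatio_mul_inclGL, sMat, dg_inv, dg_mul_dg, divisorRatio_dg, hm,
        inv_one, one_mul, inv_mul_eq_div, div_right_comm]
      · rw [hm, hm]
        exact mul_le_mul_right hy _
      · rw [hm, inv_one, one_mul]
        exact hz.trans (le_mul_of_one_le_left' ((one_le_inv₀ hup).2 (val_unif_lt_one hϖ).le))
    have hT' := hT _ (lt_of_le_of_lt h1R (hs ▸ hlt))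
    rw [opT, finsum_eq_single _ ((1 : GL (Fin 3) 𝓀[F]) : GL (Fin 3) 𝓀[F] ⧸ parUp 𝓀[F])] at hT'
    · rw [opTerm_congr hτ hh _ (y := 1) (by rw [redGL_cosetLift, map_one])] at hT'
      rw [opTerm, map_one, map_one, map_one, inv_one, mul_one, mul_inv_cancel_left] at hT'
      exact hT'
    · intro q hq
      have hq' : redGL F (cosetLift q) ∉ parUp 𝓀[F] := fun hmem => hq (by
        rw [← redGL_cosetLift q, eq_comm, QuotientGroup.eq, inv_one, one_mul]
        exact hmem)
      rw [opTerm, hvanish, map_zero, map_zero]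
      refine hlt.trans_le ?_
      rw [← mul_assoc, ← mul_assoc, divisorRatio_mul_inclGL]
      exact val_div_le_divisorRatio hϖ hy hz hq'
  refine hg₀ ?_
  -- A `U`-translate of this value is again a value at `t B'`, because integral upper unitriangular
  -- matrices pass through `t` when `|x| ≥ |y| ≥ |z|`. So `τ` kills all translates, and `hinj`
  -- applies.
  have hgoal : h (dg x y z * inclGL F B⁻¹) = 0 := by
    refine hinj _ fun a b c => ?_
    obtain ⟨a, rfl⟩ := IsLocalRing.residue_surjective a
    obtain ⟨b, rfl⟩ := IsLocalRing.residue_surjective b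
    obtain ⟨c, rfl⟩ := IsLocalRing.residue_surjective c
    have hdiv : ∀ {s t : Fˣ}, valuation F (s : F) ≤ valuation F (t : F) → ∀ a : 𝒪[F],
        ∃ a' : 𝒪[F], (t : F) * (a' : F) = (a : F) * (s : F) := by
      intro s t hst a
      refine ⟨⟨(t : F)⁻¹ * ((a : F) * (s : F)), ?_⟩, mul_inv_cancel_left₀ t.ne_zero _⟩
      change valuation F _ ≤ 1
      rw [map_mul, map_mul, map_inv₀, mul_left_comm]
      exact mul_le_one' (val_le_one a) (inv_mul_le_one_of_le₀ hst zero_le)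
    obtain ⟨a', ha⟩ := hdiv hy a
    obtain ⟨b', hb⟩ := hdiv (hz.trans hy) b
    obtain ⟨c', hc⟩ := hdiv hz c
    have hcomm : inclGL F (up a b c) * dg x y z = dg x y z * inclGL F (up a' b' c') := by
      have ea : ∀ a : 𝒪[F], algebraMap 𝒪[F] F a = (a : F) := fun a => rfl
      rw [inclGL, map_up, map_up]
      apply ext_fin_three <;> simp [up_val, dg_val, ea, ha, hb, hc]
    rw [← map_up, ← redGL, ← hh.1, ← mul_assoc, hcomm, mul_assoc, ← map_mul]
    exact key _
  have : g₀ = inclGL F A⁻¹ * (dg x y z * inclGL F B⁻¹) := by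
    rw [← e, map_inv, map_inv]; group
  rw [this, hh.1, hgoal, map_zero]

end LeadingTerm

end GL3

/-! ## The compact induction -/

namespace GL3
open ValuativeRel (valuation ValueGroupWithZero)

/-! ### Compactness and supports -/

section Topology

variable {F : Type*} [Field F] [ValuativeRel F] [TopologicalSpace F] [IsNonarchimedeanLocalField F]

theorem isCompact_maxCompact : IsCompact (maxCompact F : Set (GL (Fin 3) F)) := by
  have h0 : Continuous fun M : Matrix (Fin 3) (Fin 3) 𝒪[F] => M.map (algebraMap 𝒪[F] F) :=
    continuous_id.matrix_map continuous_subtype_val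
  have h : Continuous (inclGL F) :=
    Continuous.units_map (M := Matrix (Fin 3) (Fin 3) 𝒪[F]) (N := Matrix (Fin 3) (Fin 3) F)
      (algebraMap 𝒪[F] F).mapMatrix.toMonoidHom h0
  -- Compactness of the integral matrix ring passes to its unit group by means of the T1 property.
  have : T1Space F := by
    let := IsTopologicalAddGroup.rightUniformSpace F
    have := isUniformAddGroup_of_addCommGroup (G := F)
    have : T0Space F := ValuedRing.separated
    infer_instance
  have : T1Space (Matrix (Fin 3) (Fin 3) 𝒪[F]) :=
    inferInstanceAs (T1Space (Fin 3 → Fin 3 → 𝒪[F]))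
  have : CompactSpace (Matrix (Fin 3) (Fin 3) 𝒪[F]) :=
    inferInstanceAs (CompactSpace (Fin 3 → Fin 3 → 𝒪[F]))
  have hc : CompactSpace (GL (Fin 3) 𝒪[F]) :=
    inferInstanceAs (CompactSpace (Matrix (Fin 3) (Fin 3) 𝒪[F])ˣ)
  rw [maxCompact, MonoidHom.coe_range]
  exact isCompact_range h

variable {ϖ : 𝒪[F]} (hϖ : Irreducible ϖ)

theorem inclGL_mem_maxCompactZ (A : GL (Fin 3) 𝒪[F]) : inclGL F A ∈ maxCompactZ F :=
  (le_sup_left : maxCompact F ≤ _) (inclGL_mem A)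

theorem scalarUnif_zpow_mem_center (n : ℤ) :
    scalarUnif hϖ ^ n ∈ Subgroup.center (GL (Fin 3) F) :=
  Subgroup.mem_center_iff.2 fun g => (scalarUnif_zpow_comm hϖ n g).symm

theorem inclGL_mul_mem_maxCompactZ (A : GL (Fin 3) 𝒪[F]) (n : ℤ) :
    inclGL F A * scalarUnif hϖ ^ n ∈ maxCompactZ F :=
  (maxCompactZ F).mul_mem (inclGL_mem_maxCompactZ A)
    ((le_sup_right : Subgroup.center _ ≤ _) (scalarUnif_zpow_mem_center hϖ n))

theorem inclGL_mem_iwahoriZ {B : GL (Fin 3) 𝒪[F]} (hB : redGL F B ∈ upperTri 𝓀[F]) :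
    inclGL F B ∈ iwahoriZ F :=
  (le_sup_left : iwahori F ≤ _) ⟨B, hB, rfl⟩

/-- The valuations of the elementary divisors take finitely many values on the support of a
compactly supported function. -/
theorem finite_divisorRatio {C W : Type*} [Field C] [AddCommGroup W] [Module C W]
    (χ : SmoothCharacter (iwahoriZ F) C) {σ : Representation C (maxCompactZ F) W} (h : cInd σ) :
    (divisorRatio '' Function.support h.1).Finite := by
  obtain ⟨ϖ, hϖ⟩ := IsDiscreteValuationRing.exists_irreducible 𝒪[F]
  obtain ⟨U, hU, -⟩ := χ.smooth
  -- Smoothness of `χ` provides the openness of `I Z`, so a compact set meets finitely many of its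
  -- cosets; the ratio is constant on these and insensitive to `K Z` on the left.
  have hK : IsOpen (iwahoriZ F : Set (GL (Fin 3) F)) := Subgroup.isOpen_mono hU U.isOpen
  have : DiscreteTopology (GL (Fin 3) F ⧸ iwahoriZ F) := QuotientGroup.discreteTopology hK
  obtain ⟨-, -, S, hS, hh⟩ := h.2
  let R : GL (Fin 3) F ⧸ iwahoriZ F → ValueGroupWithZero F :=
    Quotient.lift divisorRatio (by
      intro a b hab
      obtain ⟨B, n, -, e⟩ := exists_iwahoriZ hϖ (QuotientGroup.leftRel_apply.1 hab)
      rw [← mul_inv_cancel_left a b, e, ← mul_assoc, divisorRatio_mul_scalarUnif,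
        divisorRatio_mul_inclGL])
  have hfin : ((QuotientGroup.mk : GL (Fin 3) F → GL (Fin 3) F ⧸ iwahoriZ F) '' S).Finite :=
    (hS.image continuous_quotient_mk').finite_of_discrete
  refine (hfin.image R).subset ?_
  rintro _ ⟨g, hg, rfl⟩
  obtain ⟨k, hk, s, hs, rfl⟩ := Set.mem_mul.1 (hh hg)
  obtain ⟨A, n, rfl⟩ := exists_maxCompactZ hϖ hk
  refine ⟨s, ⟨s, hs, rfl⟩, ?_⟩
  rw [mul_assoc, divisorRatio_inclGL_mul, divisorRatio_scalarUnif_mul]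
  rfl

end Topology

/-! ### Standard functions inside the compact induction -/

section Induction

variable {F : Type*} [Field F] [ValuativeRel F] [TopologicalSpace F] [IsNonarchimedeanLocalField F]
  {ϖ : 𝒪[F]} {hϖ : Irreducible ϖ} {C W : Type*} [Field C] [AddCommGroup W] [Module C W]
  {σ : Representation C (maxCompact F) W} {ρ : Representation C (GL (Fin 3) 𝓀[F]) W}
  (hσ : ∀ A, σ (toK F A) = ρ (redGL F A))

include hσ in
theorem extendKZ_eq (A : GL (Fin 3) 𝒪[F]) (n : ℤ) {g : maxCompactZ F}
    (h : (g : GL (Fin 3) F) = inclGL F A * scalarUnif hϖ ^ n) :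
    extendKZ hϖ σ g = ρ (redGL F A) := by
  change σ (projK hϖ g) = _
  rw [projK_eq hϖ g (toK F A) n h, hσ]

include hσ in
theorem isEquivariant_iff {f : GL (Fin 3) F → W} : IsEquivariant hϖ ρ f ↔
    ∀ (h : maxCompactZ F) (g : GL (Fin 3) F), f (h * g) = extendKZ hϖ σ h (f g) := by
  constructor
  · intro hf h g
    obtain ⟨A, n, e⟩ := exists_maxCompactZ hϖ h.2
    rw [extendKZ_eq hσ A n e, e, mul_assoc, hf.1, hf.2]
  · intro hf
    refine ⟨fun A g => ?_, fun n g => ?_⟩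
    · rw [← extendKZ_eq (hϖ := hϖ) hσ A 0 (g := ⟨_, inclGL_mem_maxCompactZ A⟩) (by simp), ← hf]
    · have e := hf ⟨_, inclGL_mul_mem_maxCompactZ hϖ 1 n⟩ g
      rw [extendKZ_eq hσ 1 n rfl] at e
      simpa using e

theorem isEquivariant_cInd (f : cInd (extendKZ hϖ σ)) (hσ : ∀ A, σ (toK F A) = ρ (redGL F A)) :
    IsEquivariant hϖ ρ f.1 := (isEquivariant_iff hσ).2 f.2.1

variable {v : W} {χ : SmoothCharacter (iwahoriZ F) C}

include hσ in
theorem redGL_apply_eq_character (hχ : IsCharacterOnLine hϖ σ v χ) {B : GL (Fin 3) 𝒪[F]} (n : ℤ)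
    {g : GL (Fin 3) F} (hg : g ∈ iwahoriZ F) (e : g = inclGL F B * scalarUnif hϖ ^ n) :
    ρ (redGL F B) v = (χ.toHom ⟨g, hg⟩ : C) • v := by
  rw [← hχ ⟨g, hg⟩, extendKZ_eq hσ B n e]

include hσ in
theorem uFixed_of_proPIwahori
    (hfix : ∀ u (hu : u ∈ proPIwahori F), σ ⟨u, proPIwahori_le_maxCompact F hu⟩ v = v) :
    UFixed ρ v := by
  intro a b c
  obtain ⟨B, hB⟩ := redGL_surjective (F := F) (up a b c)
  have hu : inclGL F B ∈ proPIwahori F := ⟨B, by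
    change redGL F B ∈ upperUnip _
    rw [hB]
    exact up_mem_upperUnip a b c, rfl⟩
  rw [← hB, ← hσ]
  exact hfix _ hu

include hσ in
theorem tEigen_of_character (hχ : IsCharacterOnLine hϖ σ v χ) : TEigen ρ v := by
  intro x y z
  obtain ⟨B, hB⟩ := redGL_surjective (F := F) (dg x y z)
  have h := redGL_apply_eq_character (B := B) hσ hχ 0
    (inclGL_mem_iwahoriZ (hB ▸ dg_mem_upperTri x y z)) (by simp)
  exact ⟨_, (congrArg (fun g => ρ g v) hB.symm).trans h⟩

variable {b₁ b₂ : ℤ} (hv : UFixed ρ v) (hχ : IsCharacterOnLine hϖ σ v χ) (h12 : b₁ ≤ b₂)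
  (h2 : b₂ ≤ 0)

include hσ hv hχ h12 h2 in
theorem stdFun_mul_iwahoriZ {i : GL (Fin 3) F} (hi : i ∈ iwahoriZ F) (g : GL (Fin 3) F) :
    stdFun hϖ ρ v b₁ b₂ (g * i) = (χ.toHom ⟨i, hi⟩ : C) • stdFun hϖ ρ v b₁ b₂ g := by
  have ht := tEigen_of_character hσ hχ
  obtain ⟨B, n, hB, e⟩ := exists_iwahoriZ hϖ hi
  have hc := redGL_apply_eq_character hσ hχ n hi e
  rw [← stdFun_mul_right hv ht h12 h2 hB hc, ← (isEquivariant_stdFun hv ht h12 h2).2 n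
    (g * inclGL F B), scalarUnif_zpow_comm, mul_assoc, ← e]

include hσ hv hχ h12 h2 in
theorem stdFun_mem_cInd : stdFun hϖ ρ v b₁ b₂ ∈ cInd (extendKZ hϖ σ) := by
  have ht := tEigen_of_character hσ hχ
  refine ⟨(isEquivariant_iff hσ).1 (isEquivariant_stdFun hv ht h12 h2), ?_,
    {diagT hϖ b₁ b₂} * maxCompact F, isCompact_singleton.mul isCompact_maxCompact, ?_⟩
  · obtain ⟨U, hU, hχU⟩ := χ.smooth
    refine ⟨U, fun u hu g => ?_⟩
    rw [stdFun_mul_iwahoriZ hσ hv hχ h12 h2 (hU hu), hχU u hu, Units.val_one, one_smul]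
  · intro g hg
    obtain ⟨A, n, B, -, rfl⟩ := exists_presentation_of_stdFun_ne_zero hg
    rw [mul_assoc]
    exact Set.mul_mem_mul (inclGL_mul_mem_maxCompactZ hϖ A n)
      (Set.mul_mem_mul rfl (inclGL_mem B))

/-- The standard function as an element of the isotypic part of the compact induction. -/
noncomputable def stdVec : χ.isotypic (cIndRep (extendKZ hϖ σ)) :=
  ⟨⟨stdFun hϖ ρ v b₁ b₂, stdFun_mem_cInd hσ hv hχ h12 h2⟩, fun h =>
    Subtype.ext (funext fun g => stdFun_mul_iwahoriZ hσ hv hχ h12 h2 h.2 g)⟩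

/-- An integral matrix which is upper triangular modulo `ϖ` is the product of a diagonal matrix and
one which is unipotent upper triangular modulo `ϖ`. -/
theorem exists_eq_dg_mul_of_upperTri {B : GL (Fin 3) 𝒪[F]} (hB : redGL F B ∈ upperTri 𝓀[F]) :
    ∃ (x y z : (𝒪[F])ˣ) (B' : GL (Fin 3) 𝒪[F]), redGL F B' ∈ upperUnip 𝓀[F] ∧
      B = dg x y z * B' := by
  have hlift : ∀ x : (𝓀[F])ˣ, ∃ y, Units.map (IsLocalRing.residue 𝒪[F]).toMonoidHom y = x :=
    IsLocalRing.surjective_units_map_of_local_ringHom _ IsLocalRing.residue_surjective inferInstance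
  obtain ⟨x', y', z', a, b, c, e⟩ : ∃ x y z a b c, redGL F B = dg x y z * up a b c :=
    ⟨_, _, _, exists_eq_dg_mul_up hB⟩
  obtain ⟨x, rfl⟩ := hlift x'
  obtain ⟨y, rfl⟩ := hlift y'
  obtain ⟨z, rfl⟩ := hlift z'
  refine ⟨x, y, z, (dg x y z)⁻¹ * B, ?_, by group⟩
  have h : (redGL F (dg x y z))⁻¹ * redGL F B = up a b c := by
    rw [e, map_dg]
    exact inv_mul_cancel_left _ _
  rw [map_mul, map_inv, h]
  exact up_mem_upperUnip a b c

theorem isStdFunction_stdVec : IsStdFunction hϖ σ v b₁ b₂ (stdVec hσ hv hχ h12 h2).1 := by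
  have ht := tEigen_of_character hσ hχ
  refine ⟨?_, ?_, stdFun_diagT hv ht h12 h2⟩
  · rintro _ ⟨B, hB, rfl⟩
    have hB' : redGL F B ∈ upperUnip 𝓀[F] := hB
    refine Subtype.ext (funext fun g => ?_)
    obtain ⟨a, b, c, e⟩ := exists_eq_up hB'
    refine (stdFun_mul_right hv ht h12 h2 hB'.1 (c := 1) ?_ g).trans (one_smul _ _)
    rw [e, hv, one_smul]
  · intro g hg
    obtain ⟨A, n, B, hB, rfl⟩ := exists_presentation_of_stdFun_ne_zero hg
    obtain ⟨x, y, z, B', hB', rfl⟩ := exists_eq_dg_mul_of_upperTri hB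
    -- The torus part of `I` commutes with `t_b` and can be moved into `K`, so `K Z t_b I` equals `K
    -- Z t_b I₁`.
    have hc : diagT hϖ b₁ b₂ * inclGL F (dg x y z) = inclGL F (dg x y z) * diagT hϖ b₁ b₂ := by
      rw [inclGL, map_dg, diagT_eq_dg, dg_mul_dg, dg_mul_dg]
      congr 1 <;> exact mul_comm _ _
    have e : inclGL F A * scalarUnif hϖ ^ n * diagT hϖ b₁ b₂ * inclGL F (dg x y z * B') =
        inclGL F (A * dg x y z) * scalarUnif hϖ ^ n * diagT hϖ b₁ b₂ * inclGL F B' := by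
      calc inclGL F A * scalarUnif hϖ ^ n * diagT hϖ b₁ b₂ * inclGL F (dg x y z * B')
          = inclGL F A * scalarUnif hϖ ^ n * (diagT hϖ b₁ b₂ * inclGL F (dg x y z)) *
              inclGL F B' := by rw [map_mul]; simp only [mul_assoc]
        _ = inclGL F A * (scalarUnif hϖ ^ n * inclGL F (dg x y z)) * diagT hϖ b₁ b₂ *
              inclGL F B' := by rw [hc]; simp only [mul_assoc]
        _ = _ := by rw [scalarUnif_zpow_comm, map_mul]; simp only [mul_assoc]
    rw [e]
    exact Set.mul_mem_mul (Set.mul_mem_mul (inclGL_mul_mem_maxCompactZ hϖ _ n) rfl)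
      ⟨B', hB', rfl⟩


theorem IsStdFunction.unique {f f' : cInd (extendKZ hϖ σ)} (h : IsStdFunction hϖ σ v b₁ b₂ f)
    (h' : IsStdFunction hϖ σ v b₁ b₂ f') : f = f' := by
  have key : ∀ {f : cInd (extendKZ hϖ σ)}, IsStdFunction hϖ σ v b₁ b₂ f → ∀ (k : maxCompactZ F),
      ∀ u ∈ proPIwahori F, f.1 (k * diagT hϖ b₁ b₂ * u) = extendKZ hϖ σ k v := by
    intro f h k u hu
    have := congrArg (fun f : cInd (extendKZ hϖ σ) => f.1 (k * diagT hϖ b₁ b₂)) (h.1 u hu)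
    exact this.trans (by rw [f.2.1, h.2.2])
  refine Subtype.ext (funext fun g => ?_)
  by_cases hg : g ∈ (maxCompactZ F : Set (GL (Fin 3) F)) * {diagT hϖ b₁ b₂} * (proPIwahori F)
  · obtain ⟨_, ⟨k, hk, _, rfl, rfl⟩, u, hu, rfl⟩ := hg
    exact (key h ⟨k, hk⟩ u hu).trans (key h' ⟨k, hk⟩ u hu).symm
  · rw [Function.notMem_support.1 fun h0 => hg (h.2.1 h0),
      Function.notMem_support.1 fun h0 => hg (h'.2.1 h0)]

end Induction

end GL3

/-! ## The main theorem -/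

/-- A subspace has infinite codimension if an infinite family is linearly independent modulo it. -/
theorem Submodule.not_finiteDimensional_quotient {C V : Type*} [Field C] [AddCommGroup V]
    [Module C V] {N : Submodule C V} {u : ℕ → V}
    (h : ∀ (s : Finset ℕ) (c : ℕ → C), ∑ n ∈ s, c n • u n ∈ N → ∀ i ∈ s, c i = 0) :
    ¬ FiniteDimensional C (V ⧸ N) := by
  intro hfin
  have hu : LinearIndependent C fun n => N.mkQ (u n) := by
    rw [linearIndependent_iff']
    intro s c hs
    refine h s c ((Submodule.Quotient.mk_eq_zero N).1 ?_)
    rw [← Submodule.mkQ_apply, map_sum, ← hs]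
    exact Finset.sum_congr rfl fun n _ => map_smul _ _ _
  exact Module.Finite.not_linearIndependent_of_infinite _ hu

/-! ### Hecke submodules and subrepresentations -/

section Hecke

variable {G : Type*} [Group G] [TopologicalSpace G] [IsTopologicalGroup G] {C : Type*} [Field C]
  {H : Subgroup G} (χ : SmoothCharacter H C)

/-- A subrepresentation which contains a vector of the isotypic part contains the Hecke submodule
generated by it. -/
theorem SmoothCharacter.span_le_of_mem {V : Type*} [AddCommGroup V] [Module C V]
    {ρ : Representation C G V} {S : Submodule C V} (hS : ∀ g, ∀ w ∈ S, ρ g w ∈ S)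
    {f : χ.isotypic ρ} (hf : f.1 ∈ S) {x : χ.isotypic ρ}
    (hx : x ∈ Submodule.span (χ.heckeAlgebra)ᵐᵒᵖ {f}) : x.1 ∈ S := by
  induction hx using Submodule.span_induction with
  | mem x h => rwa [Set.mem_singleton_iff.1 h]
  | zero => exact S.zero_mem
  | add x y _ _ hx hy => exact S.add_mem hx hy
  | smul T x _ hx =>
    -- By Frobenius reciprocity, `T` sends `x` to a sum of scalar multiples of `G`-translates of
    -- `x`.
    change χ.frobMap ρ x (T.unop χ.canonicalFun) ∈ S
    change ∑ᶠ c, χ.frobTerm ρ x (T.unop χ.canonicalFun) c ∈ S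
    refine finsum_induction (· ∈ S) S.zero_mem (fun _ _ => S.add_mem) fun c => ?_
    obtain ⟨g, rfl⟩ := QuotientGroup.mk_surjective c
    exact S.smul_mem _ (hS g _ hx)

end Hecke

namespace GL3
open ValuativeRel (valuation ValueGroupWithZero)

/-! ### Infinite codimension of the image -/

variable {F : Type*} [Field F] [ValuativeRel F] [TopologicalSpace F] [IsNonarchimedeanLocalField F]
  {ϖ : 𝒪[F]} {hϖ : Irreducible ϖ} {C W : Type*} [Field C] [AddCommGroup W] [Module C W]
  {σ : Representation C (maxCompact F) W} {ρ : Representation C (GL (Fin 3) 𝓀[F]) W}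
  {τ : W →ₗ[C] W} {v : W} {χ : SmoothCharacter (iwahoriZ F) C}

theorem opT_zero : opT hϖ ρ τ 0 = 0 := funext fun g => by
  have := opT_smul (hϖ := hϖ) (ρ := ρ) (τ := τ) 0 0 g
  rwa [zero_smul, zero_smul] at this

variable (hϖ σ ρ τ) in
/-- The functions in the image of the compact induction under the Hecke operator. -/
def opImage : Submodule C (cInd (extendKZ hϖ σ)) where
  -- Only the equality of underlying functions is asked, so that preservation of smoothness and
  -- compact support by the operator need not be established.
  carrier := {f | ∃ h : cInd (extendKZ hϖ σ), f.1 = opT hϖ ρ τ h.1}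
  zero_mem' := ⟨0, opT_zero.symm⟩
  add_mem' := by
    rintro f f' ⟨h, e⟩ ⟨h', e'⟩
    refine ⟨h + h', funext fun g => ?_⟩
    change f.1 g + f'.1 g = opT hϖ ρ τ (h.1 + h'.1) g
    rw [opT_add, e, e']
  smul_mem' := by
    rintro c f ⟨h, e⟩
    refine ⟨c • h, funext fun g => ?_⟩
    change c • f.1 g = opT hϖ ρ τ (c • h.1) g
    rw [opT_smul, e]

theorem cIndRep_mem_opImage (x : GL (Fin 3) F) {f : cInd (extendKZ hϖ σ)}
    (hf : f ∈ opImage hϖ σ ρ τ) : cIndRep (extendKZ hϖ σ) x f ∈ opImage hϖ σ ρ τ := by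
  obtain ⟨h, e⟩ := hf
  refine ⟨cIndRep (extendKZ hϖ σ) x h, funext fun g => ?_⟩
  change f.1 (g * x) = opT hϖ ρ τ (fun y => h.1 (y * x)) g
  rw [opT_comp_mul_right, e]

variable (hσ : ∀ A, σ (toK F A) = ρ (redGL F A))

include hσ in
theorem eq_zero_of_mem_opImage (hτ : IsParabolicMap ρ τ)
    (hinj : ∀ w, (∀ a b c, τ (ρ (up a b c) w) = 0) → w = 0)
    (χ : SmoothCharacter (iwahoriZ F) C) {f : cInd (extendKZ hϖ σ)}
    (hf : f ∈ opImage hϖ σ ρ τ) (h1 : ∀ g, 1 < divisorRatio g → f.1 g = 0) : f = 0 := by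
  obtain ⟨h, e⟩ := hf
  have h0 : h.1 = 0 := eq_zero_of_opT_eq_zero hτ hinj (isEquivariant_cInd h hσ)
    (finite_divisorRatio χ h) fun g hg => by rw [← e, h1 g hg]
  refine Subtype.ext ?_
  rw [e, h0, opT_zero]
  rfl

variable (hv : UFixed ρ v) (hχ : IsCharacterOnLine hϖ σ v χ)

/-- For `b ≤ 0` the matrix `diag(ϖ ^ b, 1, 1)` already has its elementary divisors in order, and the
last two coincide. -/
theorem divisorRatio_of_isPresentation {b : ℤ} (hb : b ≤ 0) {g : GL (Fin 3) F}
    {A B : GL (Fin 3) 𝒪[F]} {n : ℤ} (h : IsPresentation hϖ b 0 g A n B) : divisorRatio g = 1 := by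
  rw [h.2, divisorRatio_mul_inclGL, mul_assoc, divisorRatio_inclGL_mul,
    divisorRatio_scalarUnif_mul, diagT_eq_dg, zpow_zero, divisorRatio_dg _ le_rfl]
  · simp
  · rw [Units.val_one, map_one, ← not_lt]
    intro hlt
    have h0 := (val_unif_zpow_le_one_iff hϖ).1 hlt.le
    obtain rfl : b = 0 := le_antisymm hb h0
    simp at hlt

include hσ hv hχ in
/-- The quotient of the isotypic part by any Hecke submodule contained in the image of the Hecke
operator is infinite dimensional. -/
theorem hasInfiniteCodim_of_le_opImage (hτ : IsParabolicMap ρ τ)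
    (hinj : ∀ w, (∀ a b c, τ (ρ (up a b c) w) = 0) → w = 0) (hv0 : v ≠ 0)
    {M : Submodule (χ.heckeAlgebra)ᵐᵒᵖ (χ.isotypic (cIndRep (extendKZ hϖ σ)))}
    (hM : ∀ x ∈ M, x.1 ∈ opImage hϖ σ ρ τ) : χ.HasInfiniteCodim (cIndRep (extendKZ hϖ σ)) M := by
  have ht := tEigen_of_character hσ hχ
  have hb : ∀ n : ℕ, -(n : ℤ) ≤ 0 := fun n => by omega
  -- The test family `f_{Id,(-n,0)}`, all supported on ratio `1`: a combination lying in the image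
  -- must vanish identically.
  let u : ℕ → χ.isotypic (cIndRep (extendKZ hϖ σ)) := fun n => stdVec hσ hv hχ (hb n) le_rfl
  refine Submodule.not_finiteDimensional_quotient (u := u) fun s c hmem i hi => ?_
  let ev : GL (Fin 3) F → χ.isotypic (cIndRep (extendKZ hϖ σ)) →ₗ[C] W := fun g =>
    (LinearMap.proj g).comp ((cInd _).subtype.comp (Submodule.subtype _))
  have hev : ∀ g, (∑ n ∈ s, c n • u n).1.1 g =
      ∑ n ∈ s, c n • stdFun hϖ ρ v (-(n : ℤ)) 0 g := fun g => by
    change ev g _ = _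
    rw [map_sum]
    exact Finset.sum_congr rfl fun n _ => map_smul (ev g) _ _
  have h0 := eq_zero_of_mem_opImage hσ hτ hinj χ (hM _ hmem) fun g hg => by
    rw [hev]
    refine Finset.sum_eq_zero fun n _ => ?_
    by_cases h : stdFun hϖ ρ v (-(n : ℤ)) 0 g = 0
    · rw [h, smul_zero]
    · obtain ⟨A, m, B, hp⟩ := exists_presentation_of_stdFun_ne_zero h
      exact absurd (divisorRatio_of_isPresentation (hb n) hp) hg.ne'
  -- Evaluation at `t_{(-i,0)}` isolates the coefficient of index `i`.
  have h1 := hev (diagT hϖ (-(i : ℤ)) 0)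
  rw [h0, Finset.sum_eq_single_of_mem i hi, stdFun_diagT hv ht (hb i) le_rfl] at h1
  · exact (smul_eq_zero.1 h1.symm).resolve_right hv0
  · intro n _ hn
    have h2 := stdFun_dg (hϖ := hϖ) hv ht (hb n) le_rfl (-(i : ℤ)) 0 0
    rw [zpow_zero, ← zpow_zero (unif hϖ), zpow_zero] at h2
    rw [diagT_eq_dg, zpow_zero, h2, if_neg, smul_zero]
    rintro ⟨h, -⟩
    exact hn (by omega)

end GL3

theorem mainTheorem1
    {F : Type*} [Field F] [ValuativeRel F] [TopologicalSpace F] [IsNonarchimedeanLocalField F]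
    (p : ℕ) [Fact p.Prime] [CharP 𝓀[F] p]
    {ϖ : 𝒪[F]} (hϖ : Irreducible ϖ)
    {W : Type*} [AddCommGroup W] [Module (AlgebraicClosure (ZMod p)) W]
    (σ : Representation (AlgebraicClosure (ZMod p)) (maxCompact F) W)
    (hirr : σ.IsIrreducible) (hsm : IsSmoothRep σ)
    (v₀ : W) (hv₀ : v₀ ≠ 0)
    (hfix : ∀ u (hu : u ∈ proPIwahori F), σ ⟨u, proPIwahori_le_maxCompact F hu⟩ v₀ = v₀)
    (χ : SmoothCharacter (iwahoriZ F) (AlgebraicClosure (ZMod p)))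
    (hχ : IsCharacterOnLine hϖ σ v₀ χ) :
    (∃ M : Submodule (χ.heckeAlgebra)ᵐᵒᵖ (χ.isotypic (cIndRep (extendKZ hϖ σ))),
      M ≠ ⊥ ∧ χ.HasInfiniteCodim (cIndRep (extendKZ hϖ σ)) M) ∧
    ∀ a₁ a₂ : ℤ, a₁ < a₂ → a₂ < -1 →
      ∃ f : χ.isotypic (cIndRep (extendKZ hϖ σ)),
        IsStdFunction hϖ σ v₀ a₁ a₂ f.1 ∧
        (∀ f' : cInd (extendKZ hϖ σ), IsStdFunction hϖ σ v₀ a₁ a₂ f' → f' = f.1) ∧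
        Submodule.span (χ.heckeAlgebra)ᵐᵒᵖ {f} ≠ ⊥ ∧
        χ.HasInfiniteCodim (cIndRep (extendKZ hϖ σ))
          (Submodule.span (χ.heckeAlgebra)ᵐᵒᵖ {f}) := by
  have main : ∀ a₁ a₂ : ℤ, a₁ < a₂ → a₂ < -1 →
      ∃ f : χ.isotypic (cIndRep (extendKZ hϖ σ)),
        IsStdFunction hϖ σ v₀ a₁ a₂ f.1 ∧
        (∀ f' : cInd (extendKZ hϖ σ), IsStdFunction hϖ σ v₀ a₁ a₂ f' → f' = f.1) ∧
        Submodule.span (χ.heckeAlgebra)ᵐᵒᵖ {f} ≠ ⊥ ∧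
        χ.HasInfiniteCodim (cIndRep (extendKZ hϖ σ))
          (Submodule.span (χ.heckeAlgebra)ᵐᵒᵖ {f}) := by
    intro a₁ a₂ h12 h2
    have : Fintype 𝓀[F] := Fintype.ofFinite _
    obtain ⟨ρ, hσ, hirr'⟩ := GL3.exists_inflation σ hirr hv₀ hfix
    have hv := GL3.uFixed_of_proPIwahori hσ hfix
    have ht := GL3.tEigen_of_character hσ hχ
    obtain ⟨τ, hτv, hτ, hinj, hs₂, hs₁⟩ := GL3.exists_parabolic_projection p hirr' hv₀ hv ht
    have h2' : a₂ ≤ 0 := by omega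
    have hstd := GL3.isStdFunction_stdVec hσ hv hχ h12.le h2'
    refine ⟨GL3.stdVec hσ hv hχ h12.le h2', hstd, fun f' hf' => GL3.IsStdFunction.unique hf' hstd,
      ?_, GL3.hasInfiniteCodim_of_le_opImage hσ hv hχ hτ hinj hv₀ fun x hx => ?_⟩
    · rw [Ne, Submodule.span_singleton_eq_bot]
      intro h0
      apply hv₀
      rw [← hstd.2.2, h0]
      rfl
    · refine χ.span_le_of_mem (S := GL3.opImage hϖ σ ρ τ)
        (fun g w hw => GL3.cIndRep_mem_opImage g hw) ?_ hx
      -- The preimage of `f_{Id,a}` under the operator is `f_{Id,1+a}`.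
      exact ⟨⟨_, GL3.stdFun_mem_cInd hσ hv hχ (by omega : 1 + a₁ ≤ 1 + a₂) (by omega)⟩,
        (GL3.opT_stdFun hτ hv ht hτv hs₂ hs₁ h12 h2).symm⟩
  -- Any pair with `a₁ < a₂ < -1` serves for the existence statement.
  obtain ⟨f, -, -, h⟩ := main (-3) (-2) (by norm_num) (by norm_num)
  exact ⟨⟨_, h⟩, main⟩
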